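/- **Setting.** Isotropic 3-space $\mathbb I^3$ is $\mathfrak p^{\perp}=\{(l,x,y,l)\}\subset\mathbb R^{3,1}$ (signature $(-+++)$), $\mathfrak p=(1,0,0,1)$, with coordinates $(l,x,y)$ and induced degenerate metric $dx^2+dy^2$. A motion of $\mathbb I^3$ is the restriction to $\mathfrak p^\perp$ of an element of $SO(3,1)$ fixing $\mathfrak p$, followed by a translation. For a smooth spacelike immersion $X$ of a plane domain, the lightlike Gauss map $n$ is determined by $\langle n,n\rangle=0$, $\langle n,\mathfrak p\rangle=1$, $\langle dX,n\rangle=0$; the second fundamental form is $\mathrm{II}=\langle d^2X,n\rangle$, and $X$ has zero mean curvature if the trace of $\mathrm{II}$ with respect to the induced metric vanishes. A zero mean curvature immersion has planar curvature lines if each of its curvature lines lies in a plane of $\mathbb R^3$. It is affine minimal if its affine mean curvature (half the trace of the affine shape operator $\tilde S$, $d\tilde n=-dX\circ\tilde S$, where the affine normal $\tilde n$ is half the Laplacian of $X$ for the Berwald–Blaschke metric) vanishes wherever $X$ is affinely non-degenerate; with this convention planes belong to both classes. A surface $Y=\operatorname{Re}\int(h,1,-i)\,\eta\,dz$, with $h$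 meromorphic and $\eta$, $h^2\eta$ holomorphic, has the conjugate surface $X=\operatorname{Re}\int(h,1,-i)\,i\eta\,dz$. A *continuous deformation consisting exactly of* the surfaces of a class $\mathcal C$ of immersions is a family of smooth maps $X_t:\mathbb C\to\mathbb I^3$, $t\in[0,1]$, such that 1. $X_t\to X_{t_0}$ uniformly on compact sets as $t\to t_0$, for every $t_0\in[0,1]$; 2. for each $t$, $X_t$ is a spacelike immersion off a closed discrete subset of $\mathbb C$, and off that set it belongs to $\mathcal C$; 3. every immersion $Z:\Omega\to\mathbb I^3$ in $\mathcal C$ on a simply connected open set $\Omega\subset\mathbb R^2$ is, up to a motion and a homothety of $\mathbb I^3$, a piece of some $X_t$: $Z=A\circ X_t\circ\varphi$ on $\Omega$ with $A$ a motion followed by a homothety of positive ratio, and $\varphi$ a smooth map from $\Omega$ into the set where $X_t$ is a spacelike immersion. **Theorem.** There is a continuous deformation $(X_t)_{t\in[0,1]}$ consisting exactly of the zero mean curvature surfaces in isotropic 3-space that are also affine minimal, with $X_t$ contained in a plane if and only if $t=0$ (so that the members with $t\in(0,1]$ are exactly the non-planar ones). Moreover it can be obtained by conjugation: there is a continuous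 deformation $(Y_t)_{t\in[0,1]}$ consisting exactly of the zero mean curvature surfaces with planar curvature lines such that $X_t$ is the conjugate surface of $Y_t$ for every $t\in[0,1]$. -/

import Mathlib

open scoped ContDiff Topology

noncomputable section

/-! ### Isotropic 3-space inside Minkowski 4-space -/

/-- The bilinear form of signature `(- + + +)` on Minkowski 4-space. -/
def mink (a b : Fin 4 → ℝ) : ℝ := -(a 0 * b 0) + a 1 * b 1 + a 2 * b 2 + a 3 * b 3

/-- The lightlike vector `𝔭 = (1,0,0,1)`; isotropic 3-space is its orthogonal complement. -/
def pVec : Fin 4 → ℝ := ![1, 0, 0, 1]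

/-- The point of isotropic 3-space with coordinates `(l, x, y)`, as a vector `(l, x, y, l)` of
Minkowski space. The induced (degenerate) metric is
`dx² + dy²`. -/
def isoEmb (P : Fin 3 → ℝ) : Fin 4 → ℝ := ![P 0, P 1, P 2, P 0]

/-- A motion of isotropic 3-space (the restriction to `𝔭^⊥` of an element of `SO(3,1)` that fixes
`𝔭`, followed by a translation), followed by the homothety with factor `r`. -/
def isoSimilarity (r θ a b : ℝ) (c : Fin 3 → ℝ) (P : Fin 3 → ℝ) : Fin 3 → ℝ :=
  r • (![P 0 + a * P 1 + b * P 2,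
         Real.cos θ * P 1 - Real.sin θ * P 2,
         Real.sin θ * P 1 + Real.cos θ * P 2] + c)

/-! ### Parametrized surfaces

The parameter plane is `ℂ`, with coordinates `u + i v`; the directions `1` and `I` are those of
`u` and `v`. Surfaces are written in the coordinates `(l, x, y)`. -/

/-- Derivative of `f` in the constant direction `a`, as a function of the point. -/
def dirD {V : Type*} [NormedAddCommGroup V] [NormedSpace ℝ V] (a : ℂ) (f : ℂ → V) : ℂ → V :=
  fun z => fderiv ℝ f z a

/-- First fundamental form (induced metric). -/
def firstFF (X : ℂ → Fin 3 → ℝ) (z a b : ℂ) : ℝ :=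
  mink (isoEmb (dirD a X z)) (isoEmb (dirD b X z))

/-- The induced metric at `z` is positive definite (so `X` is a spacelike immersion at `z`). -/
def IsSpacelikeAt (X : ℂ → Fin 3 → ℝ) (z : ℂ) : Prop :=
  ∀ a : ℂ, a ≠ 0 → 0 < firstFF X z a a

/-- The points at which `X` is a spacelike immersion. -/
def regularSet (X : ℂ → Fin 3 → ℝ) : Set ℂ := {z | IsSpacelikeAt X z}

/-- `n` is the value at `z` of the lightlike Gauss map of `X`. -/
def IsGaussVector (X : ℂ → Fin 3 → ℝ) (z : ℂ) (n : Fin 4 → ℝ) : Prop :=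
  mink n n = 0 ∧ mink n pVec = 1 ∧ ∀ a : ℂ, mink (isoEmb (dirD a X z)) n = 0

/-- Second fundamental form of `X` at `z`, with respect to the normal vector `n`. -/
def secondFF (X : ℂ → Fin 3 → ℝ) (n : Fin 4 → ℝ) (z a b : ℂ) : ℝ :=
  mink (isoEmb (dirD a (dirD b X) z)) n

/-- Mean curvature: half the trace of the second fundamental form with respect to the first. -/
def meanCurv (X : ℂ → Fin 3 → ℝ) (n : Fin 4 → ℝ) (z : ℂ) : ℝ :=
  (firstFF X z 1 1 * secondFF X n z Complex.I Complex.I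
      - 2 * firstFF X z 1 Complex.I * secondFF X n z 1 Complex.I
      + firstFF X z Complex.I Complex.I * secondFF X n z 1 1) /
    (2 * (firstFF X z 1 1 * firstFF X z Complex.I Complex.I - firstFF X z 1 Complex.I ^ 2))

/-- `X` is a smooth spacelike immersion of zero mean curvature on the open set `Ω`. -/
structure IsZMCOn (X : ℂ → Fin 3 → ℝ) (Ω : Set ℂ) : Prop where
  smooth : ContDiffOn ℝ ∞ X Ω
  spacelike : ∀ z ∈ Ω, IsSpacelikeAt X z
  zero_mean : ∀ z ∈ Ω, ∃ n, IsGaussVector X z n ∧ meanCurv X n z = 0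

/-! ### Planar curvature lines -/

/-- A set of points lies in some affine plane of `ℝ³` (of any position). -/
def LiesInPlane (S : Set (Fin 3 → ℝ)) : Prop :=
  ∃ ν : Fin 3 → ℝ, ν ≠ 0 ∧ ∃ c : ℝ, ∀ P ∈ S, ν ⬝ᵥ P = c

/-- `a` is a principal direction of `X` at `z`. -/
def IsPrincipal (X : ℂ → Fin 3 → ℝ) (z a : ℂ) : Prop :=
  a ≠ 0 ∧ ∃ n, IsGaussVector X z n ∧
    ∃ κ : ℝ, ∀ b : ℂ, secondFF X n z a b = κ * firstFF X z a b

/-- `γ`, restricted to the interval `(s₀, s₁)`, is a regular curve in `Ω` that parametrizes a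
curvature line of `X`. -/
def IsCurvatureLine (X : ℂ → Fin 3 → ℝ) (Ω : Set ℂ) (γ : ℝ → ℂ) (s₀ s₁ : ℝ) : Prop :=
  ContDiffOn ℝ ∞ γ (Set.Ioo s₀ s₁) ∧
    ∀ s ∈ Set.Ioo s₀ s₁, γ s ∈ Ω ∧ IsPrincipal X (γ s) (deriv γ s)

/-- Zero mean curvature immersion all of whose curvature lines are planar. -/
def IsZMCWithPlanarCurvatureLines (X : ℂ → Fin 3 → ℝ) (Ω : Set ℂ) : Prop :=
  IsZMCOn X Ω ∧ ∀ (γ : ℝ → ℂ) (s₀ s₁ : ℝ), IsCurvatureLine X Ω γ s₀ s₁ →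
    LiesInPlane ((fun s => X (γ s)) '' Set.Ioo s₀ s₁)

/-! ### Affine minimality -/

/-- The functions `det (X_u, X_v, X_{ab})`. -/
def affineForm (X : ℂ → Fin 3 → ℝ) (a b : ℂ) (z : ℂ) : ℝ :=
  Matrix.det (Matrix.of ![dirD 1 X z, dirD Complex.I X z, dirD a (dirD b X) z])

/-- The discriminant of `affineForm`; the surface is affinely non-degenerate where it does not
vanish. -/
def affineDisc (X : ℂ → Fin 3 → ℝ) (z : ℂ) : ℝ :=
  affineForm X 1 1 z * affineForm X Complex.I Complex.I z - affineForm X 1 Complex.I z ^ 2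

/-- The coefficients of the Berwald–Blaschke metric. -/
def blaschke (X : ℂ → Fin 3 → ℝ) (a b : ℂ) (z : ℂ) : ℝ :=
  affineForm X a b z / |affineDisc X z| ^ (1 / 4 : ℝ)

/-- Laplace–Beltrami operator `|g|^{-1/2} ∂ᵢ (|g|^{1/2} g^{ij} ∂ⱼ f)` of the (possibly indefinite)
metric `E du² + 2 F du dv + G dv²`, on vector-valued functions. -/
def laplaceBeltrami (E F G : ℂ → ℝ) (f : ℂ → Fin 3 → ℝ) (z : ℂ) : Fin 3 → ℝ :=
  let δ : ℂ → ℝ := fun w => E w * G w - F w ^ 2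
  (Real.sqrt |δ z|)⁻¹ •
    (dirD 1 (fun w => (Real.sqrt |δ w| / δ w) •
        (G w • dirD 1 f w - F w • dirD Complex.I f w)) z
      + dirD Complex.I (fun w => (Real.sqrt |δ w| / δ w) •
        (E w • dirD Complex.I f w - F w • dirD 1 f w)) z)

/-- The affine normal: half the Laplacian of `X` with respect to the Berwald–Blaschke metric
(in asymptotic coordinates, with metric `2 F du dv`, this is `F⁻¹ X_{uv}`). -/
def affineNormal (X : ℂ → Fin 3 → ℝ) (z : ℂ) : Fin 3 → ℝ :=
  (1 / 2 : ℝ) • laplaceBeltrami (blaschke X 1 1) (blaschke X 1 Complex.I)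
    (blaschke X Complex.I Complex.I) X z

/-- `S` is the affine shape operator of `X` at `z`: `dñ = - dX ∘ S`. -/
def IsAffineShape (X : ℂ → Fin 3 → ℝ) (z : ℂ) (S : ℂ →ₗ[ℝ] ℂ) : Prop :=
  ∀ a : ℂ, dirD a (affineNormal X) z = -dirD (S a) X z

/-- Zero mean curvature immersion whose affine mean curvature `(1/2) tr S` vanishes at every point
at which the surface is affinely non-degenerate. (A plane has no such point and is included.) -/
def IsZMCAffineMinimal (X : ℂ → Fin 3 → ℝ) (Ω : Set ℂ) : Prop :=
  IsZMCOn X Ω ∧ ∀ z ∈ Ω, affineDisc X z ≠ 0 →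
    ∃ S : ℂ →ₗ[ℝ] ℂ, IsAffineShape X z S ∧ (1 / 2 : ℝ) * LinearMap.trace ℝ ℂ S = 0

/-! ### Conjugate surfaces -/

/-- `X` is given on all of `ℂ` by the Weierstrass data `(h, η dz)`: `X = Re ∫ (h, 1, -i) η dz`
with `h` meromorphic, `η` holomorphic and `h² η` holomorphic. (At a pole of `h` the last condition
makes `h η` vanish, as does `η`, so the value assigned to `h` there is irrelevant.) -/
structure HasWeierstrassData (X : ℂ → Fin 3 → ℝ) (h η : ℂ → ℂ) : Prop where
  meromorphic : MeromorphicOn h Set.univ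
  holomorphic : Differentiable ℂ η
  holomorphic_sq : ∃ k : ℂ → ℂ, Differentiable ℂ k ∧
    (fun z => h z ^ 2 * η z) =ᶠ[Filter.codiscrete ℂ] k
  differentiable : Differentiable ℝ X
  deriv_eq : ∀ z a : ℂ, fderiv ℝ X z a =
    ![(h z * η z * a).re, (η z * a).re, (-Complex.I * η z * a).re]

/-- `X` is the conjugate surface of `Y`: the Weierstrass data are `(h, η)` and `(h, i η)`. -/
def IsConjugateOf (X Y : ℂ → Fin 3 → ℝ) : Prop :=
  ∃ h η : ℂ → ℂ, HasWeierstrassData Y h η ∧ HasWeierstrassData X h (fun z => Complex.I * η z)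

/-! ### Deformations -/

/-- `Z` is a piece of `X`, up to isometries and homotheties of isotropic 3-space: after a motion
and a homothety, `Z` is a reparametrization of part of the regular part of `X`. (When `Z` is an
immersion, `φ` is automatically a local diffeomorphism.) -/
def IsPieceOf (Z : ℂ → Fin 3 → ℝ) (Ω : Set ℂ) (X : ℂ → Fin 3 → ℝ) : Prop :=
  ∃ (r θ a b : ℝ) (c : Fin 3 → ℝ) (φ : ℂ → ℂ), 0 < r ∧ ContDiffOn ℝ ∞ φ Ω ∧
    Set.MapsTo φ Ω (regularSet X) ∧ ∀ z ∈ Ω, Z z = isoSimilarity r θ a b c (X (φ z))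

/-- `X t`, `0 ≤ t ≤ 1`, is a continuous deformation (uniformly on compact sets) consisting exactly
of the surfaces of the class `P`. The members are defined on all of `ℂ`, and are immersions off a
closed discrete set of singular points. -/
structure IsDeformationExactlyOf (P : (ℂ → Fin 3 → ℝ) → Set ℂ → Prop)
    (X : ℝ → ℂ → Fin 3 → ℝ) : Prop where
  smooth : ∀ t ∈ Set.Icc (0 : ℝ) 1, ContDiff ℝ ∞ (X t)
  continuous : ∀ t ∈ Set.Icc (0 : ℝ) 1, ∀ K : Set ℂ, IsCompact K →
    TendstoUniformlyOn X (X t) (𝓝[Set.Icc 0 1] t) K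
  singular : ∀ t ∈ Set.Icc (0 : ℝ) 1, ∀ K : Set ℂ, IsCompact K → (K \ regularSet (X t)).Finite
  mem : ∀ t ∈ Set.Icc (0 : ℝ) 1, P (X t) (regularSet (X t))
  exhaust : ∀ (Ω : Set ℂ) (Z : ℂ → Fin 3 → ℝ), IsOpen Ω → SimplyConnectedSpace Ω → P Z Ω →
    ∃ t ∈ Set.Icc (0 : ℝ) 1, IsPieceOf Z Ω (X t)

end

noncomputable section

/-! Let `w = x + i y` be the horizontal part of the surface and `J` its Jacobian. The surface is
spacelike exactly where `J ≠ 0`, and then `dl = Re (G dw)` for a unique complex function `G`. Zero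
mean curvature says that `dG = q dw`, so `G` is locally a holomorphic function of `w`. Write `q`,
`q₁`, `q₂` for its successive derivatives. Since `II = Re (q dw²)`, the umbilics are the zeros of
`q`. As `w` need not be injective, the argument never passes to `w` as a global coordinate. It uses
the relation `dF = d · dw` (`HasWDerivAt`) instead.

Both classes are governed by one holomorphic invariant, `B = (7 q₁² - 4 q q₂) / (16 q³)`.
Differentiating the equation of a plane three times along a curvature line gives `Im B = 0`
(`im_eq_zero_of_planar`). The affine shape operator has trace `-2 m Re B` with `m` real and nonzero,
so affine minimality is `Re B = 0` (`exists_isAffineShape_iff`). With `ε = 1` or `ε = i` both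
conditions read `Im (ε B) = 0`. Replacing `η` by `i η` divides `B` by `i`, so conjugation exchanges
them.

A holomorphic function with real values is locally constant, so `ε B = c₀` away from umbilics. A
first integral combined with a Grönwall estimate shows that a connected surface is either totally
umbilic, hence planar, or free of umbilics (`umbilic_dichotomy`). In the second case put `Φ = (ε
q)^(-1/4)` and `du = ε⁻¹ dw / Φ²`. The condition becomes the linear equation `Φ_uu = c₀ Φ`, with
conserved energy `E = Φ_u² - c₀ Φ²`. Translating and scaling `u`, multiplying `Φ` by a constant, and
applying similarities of the ambient space reduce the pair `(c₀, E)` to a path of normal forms. Zero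
energy gives constant or exponential solutions, and nonzero energy gives the remaining ones
(`exists_normal_form_of_eq_zero`, `exists_normal_form_of_ne_zero`).

Conversely, each solution `φ` of `φ'' = c φ` with `φ(0) = 1` defines an entire model surface with `h
= κ S / φ` and `η = ε φ²`. Here `S` is the solution with `S(0) = 0`, `S'(0) = 1`, and `κ = 0` gives
the plane. The two deformations are the same path of models with `ε = i` and `ε = 1`. -/

open Complex in
/-- Two real-linear maps on `ℂ` that agree at `1` and `I` are equal. -/
theorem realLinear_ext {V : Type*} [NormedAddCommGroup V] [NormedSpace ℝ V] {f g : ℂ →L[ℝ] V}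
    (h1 : f 1 = g 1) (hI : f I = g I) : f = g := by
  ext a
  have : a = a.re • (1 : ℂ) + a.im • I := by
    simp [Complex.re_add_im]
  rw [this, map_add, map_add, map_smul, map_smul, map_smul, map_smul, h1, hI]

theorem dirD_contDiffOn {V : Type*} [NormedAddCommGroup V] [NormedSpace ℝ V] {f : ℂ → V}
    {Ω : Set ℂ} (hΩ : IsOpen Ω) (hf : ContDiffOn ℝ ∞ f Ω) (a : ℂ) :
    ContDiffOn ℝ ∞ (dirD a f) Ω :=
  (hf.fderiv_of_isOpen hΩ (by simp)).clm_apply contDiffOn_const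

theorem dirD_comm {V : Type*} [NormedAddCommGroup V] [NormedSpace ℝ V] {f : ℂ → V}
    {Ω : Set ℂ} (hΩ : IsOpen Ω) (hf : ContDiffOn ℝ ∞ f Ω) {z : ℂ} (hz : z ∈ Ω) (a b : ℂ) :
    dirD a (dirD b f) z = dirD b (dirD a f) z := by
  have hfz : ContDiffAt ℝ ∞ f z := hf.contDiffAt (hΩ.mem_nhds hz)
  have hd : DifferentiableAt ℝ (fderiv ℝ f) z :=
    (hfz.fderiv_right (m := 1) (by norm_cast)).differentiableAt (by norm_num)
  have key : ∀ a b : ℂ, dirD a (dirD b f) z = fderiv ℝ (fderiv ℝ f) z a b := by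
    intro a b
    have := (hd.hasFDerivAt.clm_apply (hasFDerivAt_const b z)).fderiv
    change fderiv ℝ (fun y => (fderiv ℝ f y) b) z a = _
    rw [this]
    simp
  rw [key, key]
  exact (hfz.isSymmSndFDerivAt (by
    simp only [minSmoothness_of_isRCLikeNormedField]
    exact WithTop.coe_le_coe.mpr le_top)).eq a b

/-! ### Calculus with respect to a complex function `w` of full rank. -/

/-- The Jacobian determinant of `w`. -/
def jac (w : ℂ → ℂ) (z : ℂ) : ℝ :=
  (starRingEnd ℂ (fderiv ℝ w z 1) * fderiv ℝ w z Complex.I).im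

theorem fderiv_one_ne_zero {w : ℂ → ℂ} {z : ℂ} (h : jac w z ≠ 0) : fderiv ℝ w z 1 ≠ 0 := by
  intro h0
  simp [jac, h0] at h

/-- `dF = d · dw` at `z`. -/
def HasWDerivAt (w F : ℂ → ℂ) (d z : ℂ) : Prop := HasFDerivAt F (d • fderiv ℝ w z) z

namespace HasWDerivAt

variable {w F H : ℂ → ℂ} {d e z : ℂ}

theorem apply (h : HasWDerivAt w F d z) (a : ℂ) : fderiv ℝ F z a = d * fderiv ℝ w z a := by
  rw [HasFDerivAt.fderiv h]; simp

theorem differentiableAt (h : HasWDerivAt w F d z) : DifferentiableAt ℝ F z :=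
  HasFDerivAt.differentiableAt h

theorem self (h : DifferentiableAt ℝ w z) : HasWDerivAt w w 1 z := by
  simpa [HasWDerivAt] using h.hasFDerivAt

theorem const (c : ℂ) : HasWDerivAt w (fun _ => c) 0 z := by
  simpa [HasWDerivAt] using hasFDerivAt_const c z

theorem add (hF : HasWDerivAt w F d z) (hH : HasWDerivAt w H e z) :
    HasWDerivAt w (fun x => F x + H x) (d + e) z := by
  have := HasFDerivAt.add hF hH
  rwa [← add_smul] at this

theorem sub (hF : HasWDerivAt w F d z) (hH : HasWDerivAt w H e z) :
    HasWDerivAt w (fun x => F x - H x) (d - e) z := by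
  have := HasFDerivAt.sub hF hH
  rwa [← sub_smul] at this

theorem mul (hF : HasWDerivAt w F d z) (hH : HasWDerivAt w H e z) :
    HasWDerivAt w (fun x => F x * H x) (F z * e + H z * d) z := by
  have := HasFDerivAt.mul hF hH
  rwa [← mul_smul, ← mul_smul, ← add_smul] at this

theorem const_mul (c : ℂ) (hF : HasWDerivAt w F d z) :
    HasWDerivAt w (fun x => c * F x) (c * d) z := by
  simpa using (const c).mul hF

theorem comp {f : ℂ → ℂ} {f' : ℂ} (hf : HasDerivAt f f' (F z)) (hF : HasWDerivAt w F d z) :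
    HasWDerivAt w (fun x => f (F x)) (f' * d) z := by
  have := (hf.hasFDerivAt.restrictScalars ℝ).comp z hF
  refine HasFDerivAt.congr_fderiv this ?_
  ext a
  simp only [ContinuousLinearMap.coe_comp, Function.comp_apply, smul_apply, smul_eq_mul,
    ContinuousLinearMap.coe_restrictScalars', ContinuousLinearMap.toSpanSingleton_apply]
  ring

theorem inv (hF : HasWDerivAt w F d z) (h0 : F z ≠ 0) :
    HasWDerivAt w (fun x => (F x)⁻¹) (-(F z ^ 2)⁻¹ * d) z :=
  comp (f := fun x => x⁻¹) (hasDerivAt_inv h0) hF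

theorem pow (hF : HasWDerivAt w F d z) (n : ℕ) :
    HasWDerivAt w (fun x => F x ^ n) (n * F z ^ (n - 1) * d) z :=
  comp (f := fun x => x ^ n) (hasDerivAt_pow n (F z)) hF

theorem cexp (hF : HasWDerivAt w F d z) :
    HasWDerivAt w (fun x => Complex.exp (F x)) (Complex.exp (F z) * d) z :=
  comp (f := Complex.exp) (Complex.hasDerivAt_exp _) hF

theorem congr_deriv (hF : HasWDerivAt w F d z) (h : d = e) : HasWDerivAt w F e z := h ▸ hF

theorem congr_of_eventuallyEq (hF : HasWDerivAt w F d z) (h : H =ᶠ[𝓝 z] F) :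
    HasWDerivAt w H d z := HasFDerivAt.congr_of_eventuallyEq hF h

/-- A `w`-derivative with respect to a multiple of `w`. -/
theorem of_const_mul {ε : ℂ} (hε : ε ≠ 0) (hw : DifferentiableAt ℝ w z)
    (hF : HasWDerivAt w F d z) : HasWDerivAt (fun x => ε⁻¹ * w x) F (ε * d) z := by
  have h1 : fderiv ℝ (fun x => ε⁻¹ * w x) z = ε⁻¹ • fderiv ℝ w z := by
    rw [fderiv_const_mul hw]
  unfold HasWDerivAt
  rw [h1, smul_smul]
  refine HasFDerivAt.congr_fderiv hF ?_
  congr 1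
  field_simp

end HasWDerivAt

/-- A `w`-derivative along a curve. -/
theorem HasWDerivAt.comp_curve {w F : ℂ → ℂ} {d p v : ℂ} {γ : ℝ → ℂ} {s : ℝ}
    (hF : HasWDerivAt w F d (γ s)) (hγ : HasDerivAt γ v s) (hp : fderiv ℝ w (γ s) v = p) :
    HasDerivAt (fun x => F (γ x)) (d * p) s := by
  have := HasFDerivAt.comp_hasDerivAt s hF hγ
  exact HasDerivAt.congr_deriv this (by simp [hp])

/-- The `w`-derivative of a smooth function is again a smooth function with a `w`-derivative. -/
theorem exists_wDeriv_of_wDeriv {w F D : ℂ → ℂ} {Ω : Set ℂ} (hΩ : IsOpen Ω)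
    (hw : ContDiffOn ℝ ∞ w Ω) (hj : ∀ z ∈ Ω, jac w z ≠ 0) (hF : ContDiffOn ℝ ∞ F Ω)
    (hD : ∀ z ∈ Ω, HasWDerivAt w F (D z) z) :
    ContDiffOn ℝ ∞ D Ω ∧ ∃ D' : ℂ → ℂ, ∀ z ∈ Ω, HasWDerivAt w D (D' z) z := by
  have hw1 := dirD_contDiffOn hΩ hw 1
  have hwI := dirD_contDiffOn hΩ hw Complex.I
  have hF1 := dirD_contDiffOn hΩ hF 1
  have hDs : ContDiffOn ℝ ∞ D Ω := by
    refine (hF1.mul (hw1.inv fun z hz => fderiv_one_ne_zero (hj z hz))).congr fun z hz => ?_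
    have h0 := fderiv_one_ne_zero (hj z hz)
    change _ = fderiv ℝ F z 1 * (fderiv ℝ w z 1)⁻¹
    rw [(hD z hz).apply 1]
    field_simp
  refine ⟨hDs, fun z => fderiv ℝ D z 1 / fderiv ℝ w z 1, fun z hz => ?_⟩
  have h0 := fderiv_one_ne_zero (hj z hz)
  have hDz : DifferentiableAt ℝ D z :=
    (hDs.contDiffAt (hΩ.mem_nhds hz)).differentiableAt (by simp)
  have hda : ∀ a, DifferentiableAt ℝ (dirD a w) z := fun a =>
    ((dirD_contDiffOn hΩ hw a).contDiffAt (hΩ.mem_nhds hz)).differentiableAt (by simp)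
  have key : ∀ a b, dirD b (dirD a F) z =
      fderiv ℝ D z b * fderiv ℝ w z a + D z * dirD b (dirD a w) z := by
    intro a b
    have : dirD a F =ᶠ[𝓝 z] fun y => D y * dirD a w y := by
      filter_upwards [hΩ.mem_nhds hz] with y hy
      exact (hD y hy).apply a
    rw [dirD, this.fderiv_eq, fderiv_fun_mul hDz (hda a)]
    simp [dirD]; ring
  -- This is `d(D dw) = 0`: equality of mixed second derivatives of `F` and of `w` leaves `dD ∧ dw =
  -- 0`, so `dD` is a complex multiple of `dw`.
  have hc := key 1 Complex.I
  rw [dirD_comm hΩ hF hz, key, dirD_comm hΩ hw hz] at hc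
  refine hDz.hasFDerivAt.congr_fderiv (realLinear_ext ?_ ?_)
  · simp; field_simp
  · simp only [smul_apply, smul_eq_mul]
    field_simp
    linear_combination -hc

theorem eqOn_const_of_hasFDerivAt_zero {V : Type*} [NormedAddCommGroup V] [NormedSpace ℝ V]
    {F : ℂ → V} {Ω : Set ℂ} (hΩ : IsOpen Ω) (hc : IsPreconnected Ω)
    (h : ∀ z ∈ Ω, HasFDerivAt F (0 : ℂ →L[ℝ] V) z) : ∃ c, ∀ z ∈ Ω, F z = c :=
  hΩ.exists_is_const_of_fderiv_eq_zero hc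
    (fun z hz => (h z hz).differentiableAt.differentiableWithinAt)
    (fun z hz => (h z hz).fderiv)

theorem eqOn_const_of_wDeriv_zero {w F : ℂ → ℂ} {Ω : Set ℂ} (hΩ : IsOpen Ω)
    (hc : IsPreconnected Ω) (h : ∀ z ∈ Ω, HasWDerivAt w F 0 z) : ∃ c, ∀ z ∈ Ω, F z = c :=
  eqOn_const_of_hasFDerivAt_zero hΩ hc fun z hz => by simpa [HasWDerivAt] using h z hz

/-- A function with a `w`-derivative and real values has `w`-derivative zero. -/
theorem wDeriv_eq_zero_of_im_eq_zero {w F : ℂ → ℂ} {d z : ℂ} (hj : jac w z ≠ 0)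
    (h : HasWDerivAt w F d z) (him : ∀ᶠ y in 𝓝 z, (F y).im = 0) : d = 0 := by
  have h1 : ∀ a, (d * fderiv ℝ w z a).im = 0 := by
    intro a
    have h2 : HasFDerivAt (fun y => (F y).im) (Complex.imCLM.comp (d • fderiv ℝ w z)) z :=
      Complex.imCLM.hasFDerivAt.comp z h
    have h3 : HasFDerivAt (fun y => (F y).im) (0 : ℂ →L[ℝ] ℝ) z :=
      (hasFDerivAt_const (0 : ℝ) z).congr_of_eventuallyEq him
    have := congrArg (fun f : ℂ →L[ℝ] ℝ => f a) (h2.unique h3)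
    simpa using this
  have e1 := h1 1
  have e2 := h1 Complex.I
  simp only [jac, Complex.mul_im, Complex.conj_re, Complex.conj_im] at e1 e2 hj
  set u := fderiv ℝ w z 1
  set v := fderiv ℝ w z Complex.I
  apply Complex.ext
  · have : d.re * (u.re * v.im + -u.im * v.re) = 0 := by linear_combination u.re * e2 - v.re * e1
    exact (mul_eq_zero.mp this).resolve_right hj
  · have : d.im * (u.re * v.im + -u.im * v.re) = 0 := by linear_combination v.im * e1 - u.im * e2
    exact (mul_eq_zero.mp this).resolve_right hj

/-! ### Continuous logarithms and their derivatives. -/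

open Complex in
/-- A continuous logarithm agrees locally with a translate of the principal one. -/
theorem eventuallyEq_log_of_exp_eq {q L : ℂ → ℂ} {z : ℂ} (hL : ContinuousAt L z)
    (he : ∀ᶠ y in 𝓝 z, exp (L y) = q y) :
    L =ᶠ[𝓝 z] fun y => L z + log (q y / q z) := by
  have hz := he.self_of_nhds
  -- Inside this strip the principal logarithm inverts the exponential, so no multiple of `2πi`
  -- appears.
  have h1 : ∀ᶠ y in 𝓝 z, |(L y - L z).im| < Real.pi := by
    have : ContinuousAt (fun y => |(L y - L z).im|) z := by fun_prop
    exact this.eventually_lt continuousAt_const (by simp [Real.pi_pos])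
  filter_upwards [he, h1] with y hy hy1
  rw [← hy, ← hz, ← exp_sub, log_exp (by linarith [(abs_lt.mp hy1).1]) (abs_lt.mp hy1).2.le]
  ring

open Complex in
theorem contDiffAt_log_div {q : ℂ → ℂ} {z : ℂ} (hq : ContDiffAt ℝ ∞ q z) (h0 : q z ≠ 0) (c : ℂ) :
    ContDiffAt ℝ ∞ (fun y => c + log (q y / q z)) z := by
  have : ContDiffAt ℝ ∞ log (q z / q z) := by
    rw [div_self h0]
    exact (contDiffAt_log (n := ∞) (by simp)).restrict_scalars ℝ
  exact contDiffAt_const.add (ContDiffAt.comp (g := log) z this (hq.div_const (q z)))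

open Complex in
theorem HasWDerivAt.log_div {w q : ℂ → ℂ} {d z : ℂ} (hq : HasWDerivAt w q d z) (h0 : q z ≠ 0)
    (c : ℂ) : HasWDerivAt w (fun y => c + log (q y / q z)) (d / q z) z := by
  have h1 : HasWDerivAt w (fun y => q y / q z) (d / q z) z := by
    simpa [div_eq_inv_mul] using hq.const_mul (q z)⁻¹
  have h2 : HasDerivAt log 1 (q z / q z) := by
    have := hasDerivAt_log (z := q z / q z) (by simp [div_self h0])
    simpa [div_self h0] using this
  simpa using (const c).add (comp (F := fun y => q y / q z) h2 h1)

open Complex in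
/-- A continuous logarithm of a function with a `w`-derivative. -/
theorem HasWDerivAt.of_exp_eq {w q L : ℂ → ℂ} {d z : ℂ} (hL : ContinuousAt L z)
    (he : ∀ᶠ y in 𝓝 z, exp (L y) = q y) (hq : HasWDerivAt w q d z) :
    HasWDerivAt w L (d / q z) z :=
  (hq.log_div (by rw [← he.self_of_nhds]; exact exp_ne_zero _) _).congr_of_eventuallyEq
    (eventuallyEq_log_of_exp_eq hL he)

open Complex in
theorem contDiffAt_of_exp_eq {q L : ℂ → ℂ} {z : ℂ} (hL : ContinuousAt L z)
    (he : ∀ᶠ y in 𝓝 z, exp (L y) = q y) (hq : ContDiffAt ℝ ∞ q z) : ContDiffAt ℝ ∞ L z :=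
  (contDiffAt_log_div hq (by rw [← he.self_of_nhds]; exact exp_ne_zero _) _).congr_of_eventuallyEq
    (eventuallyEq_log_of_exp_eq hL he)

open Complex in
/-- A nonvanishing smooth function has a smooth logarithm near each point. -/
theorem exists_local_log {q : ℂ → ℂ} {z : ℂ} (hq : ContDiffAt ℝ ∞ q z) (h0 : q z ≠ 0) :
    ∃ L : ℂ → ℂ, ∃ U : Set ℂ, IsOpen U ∧ z ∈ U ∧ ContinuousOn L U ∧ ∀ y ∈ U, exp (L y) = q y := by
  have h1 : ContDiffAt ℝ ∞ (fun y => log (q z) + log (q y / q z)) z :=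
    contDiffAt_log_div hq h0 _
  have h2 : ∀ᶠ y in 𝓝 z, ContinuousAt (fun y => log (q z) + log (q y / q z)) y :=
    ((h1.of_le (m := 0) (by simp)).eventually (by simp)).mono fun y hy => hy.continuousAt
  have h3 : ∀ᶠ y in 𝓝 z, q y ≠ 0 := hq.continuousAt.eventually_ne h0
  obtain ⟨U, hU, hUo, hzU⟩ := eventually_nhds_iff.mp (h2.and h3)
  refine ⟨_, U, hUo, hzU, fun y hy => (hU y hy).1.continuousWithinAt, fun y hy => ?_⟩
  rw [exp_add, exp_log h0, exp_log (div_ne_zero (hU y hy).2 h0)]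
  field_simp

open Complex in
/-- A nonvanishing continuous function on a simply connected open set has a continuous
logarithm. -/
theorem exists_log_of_simplyConnected {Ω : Set ℂ} (hΩ : IsOpen Ω) (hs : SimplyConnectedSpace Ω)
    {q : ℂ → ℂ} (hq : ContinuousOn q Ω) (h0 : ∀ z ∈ Ω, q z ≠ 0) :
    ∃ L : ℂ → ℂ, ContinuousOn L Ω ∧ ∀ z ∈ Ω, exp (L z) = q z := by
  have : LocallyPathConnectedSpace Ω := hΩ.locallyPathConnectedSpace
  obtain ⟨a₀⟩ : Nonempty Ω := inferInstance
  obtain ⟨F, ⟨-, hF⟩, -⟩ := isCoveringMapOn_exp.existsUnique_continuousMap_lifts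
    (⟨Ω.domRestrict q, hq.domRestrict⟩ : C(Ω, ℂ)) (a₀ := a₀) (e₀ := log (q a₀))
    (exp_log (h0 a₀ a₀.2)) (fun a => h0 a a.2)
  classical
  refine ⟨fun z => if h : z ∈ Ω then F ⟨z, h⟩ else 0, ?_, fun z hz => ?_⟩
  · rw [continuousOn_iff_continuous_domRestrict]
    convert F.continuous using 1
    ext z
    simp
  · simp only [hz, dite_true]
    exact congrFun hF ⟨z, hz⟩

theorem isPreconnected_of_simplyConnected {Ω : Set ℂ} (hs : SimplyConnectedSpace Ω) :
    IsPreconnected Ω :=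
  isPreconnected_iff_preconnectedSpace.mpr inferInstance

/-! ### The horizontal coordinate and the holomorphic data of a zero mean curvature surface. -/

/-- The horizontal part `x + i y` of a point `(l, x, y)`. -/
def horizL : (Fin 3 → ℝ) →L[ℝ] ℂ :=
  Complex.ofRealCLM.comp (ContinuousLinearMap.proj 1) +
    Complex.I • Complex.ofRealCLM.comp (ContinuousLinearMap.proj 2)

@[simp] theorem horizL_re (P : Fin 3 → ℝ) : (horizL P).re = P 1 := by simp [horizL]

@[simp] theorem horizL_im (P : Fin 3 → ℝ) : (horizL P).im = P 2 := by simp [horizL]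

/-- The horizontal part of a surface. -/
def horiz (X : ℂ → Fin 3 → ℝ) (z : ℂ) : ℂ := horizL (X z)

theorem dirD_apply {f : ℂ → Fin 3 → ℝ} {z : ℂ} (h : DifferentiableAt ℝ f z) (a : ℂ) (i : Fin 3) :
    dirD a f z i = fderiv ℝ (fun y => f y i) z a := by
  have := (hasFDerivAt_pi'.mp h.hasFDerivAt i).fderiv
  rw [this]
  rfl

theorem hasFDerivAt_horiz {X : ℂ → Fin 3 → ℝ} {z : ℂ} (h : DifferentiableAt ℝ X z) :
    HasFDerivAt (horiz X) (horizL.comp (fderiv ℝ X z)) z :=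
  horizL.hasFDerivAt.comp z h.hasFDerivAt

theorem fderiv_horiz {X : ℂ → Fin 3 → ℝ} {z : ℂ} (h : DifferentiableAt ℝ X z) (a : ℂ) :
    fderiv ℝ (horiz X) z a = horizL (dirD a X z) := by
  rw [(hasFDerivAt_horiz h).fderiv]
  rfl

theorem horiz_contDiffOn {X : ℂ → Fin 3 → ℝ} {Ω : Set ℂ} (h : ContDiffOn ℝ ∞ X Ω) :
    ContDiffOn ℝ ∞ (horiz X) Ω := horizL.contDiff.comp_contDiffOn h

theorem differentiableAt_of_contDiffOn {V : Type*} [NormedAddCommGroup V] [NormedSpace ℝ V]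
    {f : ℂ → V} {Ω : Set ℂ} (hΩ : IsOpen Ω) (h : ContDiffOn ℝ ∞ f Ω) {z : ℂ} (hz : z ∈ Ω) :
    DifferentiableAt ℝ f z :=
  (h.contDiffAt (hΩ.mem_nhds hz)).differentiableAt (by simp)

theorem dirD_dirD_horiz {X : ℂ → Fin 3 → ℝ} {Ω : Set ℂ} (hΩ : IsOpen Ω)
    (h : ContDiffOn ℝ ∞ X Ω) {z : ℂ} (hz : z ∈ Ω) (a b : ℂ) :
    dirD a (dirD b (horiz X)) z = horizL (dirD a (dirD b X) z) := by
  have h1 : dirD b (horiz X) =ᶠ[𝓝 z] horiz (dirD b X) := by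
    filter_upwards [hΩ.mem_nhds hz] with y hy
    exact fderiv_horiz (differentiableAt_of_contDiffOn hΩ h hy) b
  rw [dirD, h1.fderiv_eq]
  exact fderiv_horiz (differentiableAt_of_contDiffOn hΩ (dirD_contDiffOn hΩ h b) hz) a

theorem mink_isoEmb (P : Fin 3 → ℝ) (n : Fin 4 → ℝ) (hn : mink n pVec = 1) :
    mink (isoEmb P) n = P 0 + P 1 * n 1 + P 2 * n 2 := by
  have : n 3 = 1 + n 0 := by
    simp [mink, pVec] at hn
    linarith
  simp [mink, isoEmb, this]
  ring

theorem firstFF_eq {X : ℂ → Fin 3 → ℝ} {z : ℂ} (h : DifferentiableAt ℝ X z) (a b : ℂ) :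
    firstFF X z a b =
      (starRingEnd ℂ (fderiv ℝ (horiz X) z a) * fderiv ℝ (horiz X) z b).re := by
  rw [fderiv_horiz h, fderiv_horiz h]
  simp [firstFF, mink, isoEmb]
  ring

theorem isSpacelikeAt_iff {X : ℂ → Fin 3 → ℝ} {z : ℂ} (h : DifferentiableAt ℝ X z) :
    IsSpacelikeAt X z ↔ jac (horiz X) z ≠ 0 := by
  constructor
  · intro hs hj
    have h1 := hs 1 one_ne_zero
    rw [firstFF_eq h] at h1
    set u := fderiv ℝ (horiz X) z 1 with hu
    set v := fderiv ℝ (horiz X) z Complex.I with hv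
    -- If `conj u * v` is real, then `Re (conj u * v) u = |u|² v`, so this vector lies in the kernel
    -- of `dw`. It is nonzero because its imaginary part is `-|u|²`.
    have h2 := hs (((starRingEnd ℂ u * v).re : ℂ) - ((starRingEnd ℂ u * u).re : ℂ) * Complex.I) (by
      intro h0
      have := congrArg Complex.im h0
      simp at this
      simp at h1
      linarith)
    rw [firstFF_eq h] at h2
    have h3 : fderiv ℝ (horiz X) z
        (((starRingEnd ℂ u * v).re : ℂ) - ((starRingEnd ℂ u * u).re : ℂ) * Complex.I) = 0 := by
      have e : (((starRingEnd ℂ u * v).re : ℂ) - ((starRingEnd ℂ u * u).re : ℂ) * Complex.I) =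
          ((starRingEnd ℂ u * v).re) • (1 : ℂ) - ((starRingEnd ℂ u * u).re) • Complex.I := by
        simp
      rw [e, map_sub, map_smul, map_smul, ← hu, ← hv]
      simp only [jac, ← hu, ← hv, Complex.mul_im, Complex.conj_re, Complex.conj_im] at hj
      apply Complex.ext
      · simp
        linear_combination u.im * hj
      · simp
        linear_combination -u.re * hj
    rw [h3] at h2
    simp at h2
  · intro hj a ha
    rw [firstFF_eq h]
    have h1 : fderiv ℝ (horiz X) z a ≠ 0 := by
      intro h0
      have e : a = a.re • (1 : ℂ) + a.im • Complex.I := by simp [Complex.re_add_im]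
      rw [e, map_add, map_smul, map_smul] at h0
      simp only [jac, Complex.mul_im, Complex.conj_re, Complex.conj_im] at hj
      set u := fderiv ℝ (horiz X) z 1
      set v := fderiv ℝ (horiz X) z Complex.I
      have e1 := congrArg Complex.re h0
      have e2 := congrArg Complex.im h0
      simp at e1 e2
      have r1 : a.re * (u.re * v.im + -u.im * v.re) = 0 := by
        linear_combination v.im * e1 - v.re * e2
      have r2 : a.im * (u.re * v.im + -u.im * v.re) = 0 := by
        linear_combination u.re * e2 - u.im * e1
      exact ha (Complex.ext ((mul_eq_zero.mp r1).resolve_right hj)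
        ((mul_eq_zero.mp r2).resolve_right hj))
    have h2 := Complex.normSq_pos.mpr h1
    rw [Complex.normSq_apply] at h2
    simpa using h2

/-- The data `G = l_x - i l_y` of a zero mean curvature surface, written as a function of the
parameter, together with its first three derivatives with respect to `x + i y`. -/
structure IsZMCData (X : ℂ → Fin 3 → ℝ) (Ω : Set ℂ) (G q q₁ q₂ : ℂ → ℂ) : Prop where
  smooth : ContDiffOn ℝ ∞ X Ω
  jac_ne : ∀ z ∈ Ω, jac (horiz X) z ≠ 0
  height : ∀ z ∈ Ω, ∀ a, dirD a X z 0 = (G z * fderiv ℝ (horiz X) z a).re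
  smooth_q : ContDiffOn ℝ ∞ q Ω
  smooth_q₁ : ContDiffOn ℝ ∞ q₁ Ω
  dG : ∀ z ∈ Ω, HasWDerivAt (horiz X) G (q z) z
  dq : ∀ z ∈ Ω, HasWDerivAt (horiz X) q (q₁ z) z
  dq₁ : ∀ z ∈ Ω, HasWDerivAt (horiz X) q₁ (q₂ z) z

/-- The second derivatives of the height, if its differential is `Re (G dw)`. -/
theorem dirD_dirD_height {X : ℂ → Fin 3 → ℝ} {Ω : Set ℂ} {G : ℂ → ℂ} (hΩ : IsOpen Ω)
    (hX : ContDiffOn ℝ ∞ X Ω)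
    (hl : ∀ z ∈ Ω, ∀ a, dirD a X z 0 = (G z * fderiv ℝ (horiz X) z a).re) {z : ℂ} (hz : z ∈ Ω)
    (hG : DifferentiableAt ℝ G z) (a b : ℂ) :
    dirD a (dirD b X) z 0 = (fderiv ℝ G z a * fderiv ℝ (horiz X) z b +
      G z * horizL (dirD a (dirD b X) z)).re := by
  have hb := differentiableAt_of_contDiffOn hΩ (dirD_contDiffOn hΩ hX b) hz
  have hbw := differentiableAt_of_contDiffOn hΩ (dirD_contDiffOn hΩ (horiz_contDiffOn hX) b) hz
  rw [dirD_apply hb]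
  have h1 : (fun y => dirD b X y 0) =ᶠ[𝓝 z] fun y => Complex.reCLM (G y * dirD b (horiz X) y) := by
    filter_upwards [hΩ.mem_nhds hz] with y hy
    exact hl y hy b
  have h2 : HasFDerivAt (fun y => G y * dirD b (horiz X) y) _ z :=
    hG.hasFDerivAt.mul hbw.hasFDerivAt
  have h3 : HasFDerivAt (fun y => Complex.reCLM (G y * dirD b (horiz X) y)) _ z :=
    Complex.reCLM.hasFDerivAt.comp z h2
  rw [h1.fderiv_eq, h3.fderiv]
  rw [← dirD_dirD_horiz hΩ hX hz]
  simp [dirD]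
  ring

/-- Orthogonality to `dX` is a linear condition on `dw`. Since `dw` has rank two, it fixes both
horizontal components of the vector. -/
theorem isGaussVector_iff {X : ℂ → Fin 3 → ℝ} {z : ℂ} {g : ℂ} (h : DifferentiableAt ℝ X z)
    (hj : jac (horiz X) z ≠ 0)
    (hl : ∀ a, dirD a X z 0 = (g * fderiv ℝ (horiz X) z a).re) (n : Fin 4 → ℝ) :
    IsGaussVector X z n ↔
      mink n n = 0 ∧ mink n pVec = 1 ∧ n 1 = -g.re ∧ n 2 = g.im := by
  have key : ∀ hp : mink n pVec = 1, ∀ a, mink (isoEmb (dirD a X z)) n =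
      (g.re + n 1) * (fderiv ℝ (horiz X) z a).re
        + (n 2 - g.im) * (fderiv ℝ (horiz X) z a).im := by
    intro hp a
    rw [mink_isoEmb _ _ hp, hl, fderiv_horiz h]
    simp
    ring
  constructor
  · rintro ⟨h1, h2, h3⟩
    refine ⟨h1, h2, ?_⟩
    have e1 := (key h2 1).symm.trans (h3 1)
    have e2 := (key h2 Complex.I).symm.trans (h3 Complex.I)
    simp only [jac, Complex.mul_im, Complex.conj_re, Complex.conj_im] at hj
    set u := fderiv ℝ (horiz X) z 1
    set v := fderiv ℝ (horiz X) z Complex.I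
    have r1 : (g.re + n 1) * (u.re * v.im + -u.im * v.re) = 0 := by
      linear_combination v.im * e1 - u.im * e2
    have r2 : (n 2 - g.im) * (u.re * v.im + -u.im * v.re) = 0 := by
      linear_combination u.re * e2 - v.re * e1
    have := (mul_eq_zero.mp r1).resolve_right hj
    have := (mul_eq_zero.mp r2).resolve_right hj
    constructor <;> linarith
  · rintro ⟨h1, h2, h3, h4⟩
    refine ⟨h1, h2, fun a => ?_⟩
    rw [key h2, h3, h4]
    ring

theorem exists_isGaussVector {X : ℂ → Fin 3 → ℝ} {z : ℂ} {g : ℂ} (h : DifferentiableAt ℝ X z)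
    (hj : jac (horiz X) z ≠ 0)
    (hl : ∀ a, dirD a X z 0 = (g * fderiv ℝ (horiz X) z a).re) : ∃ n, IsGaussVector X z n := by
  -- The outer components solve `n₃ - n₀ = 1` and `n₃ + n₀ = -|g|²`, which are the normalization and
  -- the nullity.
  refine ⟨![(-1 - (g.re ^ 2 + g.im ^ 2)) / 2, -g.re, g.im, (1 - (g.re ^ 2 + g.im ^ 2)) / 2],
    (isGaussVector_iff h hj hl _).mpr ⟨?_, ?_, ?_, ?_⟩⟩ <;> simp [mink, pVec] <;> ring

/-- The second fundamental form, if `dl = Re (G dw)`. -/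
theorem secondFF_eq {X : ℂ → Fin 3 → ℝ} {Ω : Set ℂ} {G : ℂ → ℂ} (hΩ : IsOpen Ω)
    (hX : ContDiffOn ℝ ∞ X Ω) (hj : ∀ z ∈ Ω, jac (horiz X) z ≠ 0)
    (hl : ∀ z ∈ Ω, ∀ a, dirD a X z 0 = (G z * fderiv ℝ (horiz X) z a).re) {z : ℂ} (hz : z ∈ Ω)
    (hG : DifferentiableAt ℝ G z) {n : Fin 4 → ℝ} (hn : IsGaussVector X z n) (a b : ℂ) :
    secondFF X n z a b = (fderiv ℝ G z a * fderiv ℝ (horiz X) z b).re := by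
  obtain ⟨-, h2, h3, h4⟩ := (isGaussVector_iff (differentiableAt_of_contDiffOn hΩ hX hz)
    (hj z hz) (hl z hz) n).mp hn
  rw [secondFF, mink_isoEmb _ _ h2, dirD_dirD_height hΩ hX hl hz hG, h3, h4]
  simp
  ring

theorem firstFF_gram {X : ℂ → Fin 3 → ℝ} {z : ℂ} (h : DifferentiableAt ℝ X z) :
    firstFF X z 1 1 * firstFF X z Complex.I Complex.I - firstFF X z 1 Complex.I ^ 2 =
      jac (horiz X) z ^ 2 := by
  simp only [firstFF_eq h, jac]
  simp
  ring

/-- The mean curvature vanishes exactly if `dG` is a multiple of `dw`. -/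
theorem meanCurv_eq_zero_iff {X : ℂ → Fin 3 → ℝ} {Ω : Set ℂ} {G : ℂ → ℂ} (hΩ : IsOpen Ω)
    (hX : ContDiffOn ℝ ∞ X Ω) (hj : ∀ z ∈ Ω, jac (horiz X) z ≠ 0)
    (hl : ∀ z ∈ Ω, ∀ a, dirD a X z 0 = (G z * fderiv ℝ (horiz X) z a).re) {z : ℂ} (hz : z ∈ Ω)
    (hG : DifferentiableAt ℝ G z) {n : Fin 4 → ℝ} (hn : IsGaussVector X z n) :
    meanCurv X n z = 0 ↔ fderiv ℝ G z 1 * fderiv ℝ (horiz X) z Complex.I =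
      fderiv ℝ G z Complex.I * fderiv ℝ (horiz X) z 1 := by
  have hd := differentiableAt_of_contDiffOn hΩ hX hz
  have hJ := hj z hz
  -- The claimed complex equation splits: its real part is the symmetry of the second fundamental
  -- form, its imaginary part the vanishing of the trace.
  have hsymm : (fderiv ℝ G z 1 * fderiv ℝ (horiz X) z Complex.I).re =
      (fderiv ℝ G z Complex.I * fderiv ℝ (horiz X) z 1).re := by
    rw [← secondFF_eq hΩ hX hj hl hz hG hn, ← secondFF_eq hΩ hX hj hl hz hG hn, secondFF,
      secondFF, dirD_comm hΩ hX hz]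
  rw [meanCurv, firstFF_gram hd, div_eq_zero_iff, or_iff_left (by positivity)]
  simp only [firstFF_eq hd, secondFF_eq hΩ hX hj hl hz hG hn]
  simp only [jac] at hJ
  set u := fderiv ℝ (horiz X) z 1
  set v := fderiv ℝ (horiz X) z Complex.I
  set g := fderiv ℝ G z 1
  set k := fderiv ℝ G z Complex.I
  have key : (starRingEnd ℂ u * u).re * (k * v).re
      - 2 * (starRingEnd ℂ u * v).re * (g * v).re
      + (starRingEnd ℂ v * v).re * (g * u).re =
      (starRingEnd ℂ u * v).im * (g * v - k * u).im := by
    simp only [Complex.mul_re, Complex.mul_im, Complex.conj_re, Complex.conj_im,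
      Complex.sub_im] at hsymm ⊢
    linear_combination (-(u.re * v.re + u.im * v.im)) * hsymm
  rw [key, mul_eq_zero, or_iff_right hJ]
  constructor
  · intro h
    refine Complex.ext hsymm ?_
    rw [Complex.sub_im] at h
    linarith
  · intro h
    rw [h, sub_self, Complex.zero_im]

/-- Cramer's rule solves `dl = Re (G dw)` for a smooth `G`. Zero mean curvature makes `dG` a
multiple of `dw`, and from there every coefficient is again differentiable with respect to `w`. -/
theorem IsZMCOn.exists_data {X : ℂ → Fin 3 → ℝ} {Ω : Set ℂ} (hΩ : IsOpen Ω) (h : IsZMCOn X Ω) :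
    ∃ G q q₁ q₂, IsZMCData X Ω G q q₁ q₂ := by
  have hX := h.smooth
  have hd := fun z (hz : z ∈ Ω) => differentiableAt_of_contDiffOn hΩ hX hz
  have hj : ∀ z ∈ Ω, jac (horiz X) z ≠ 0 := fun z hz =>
    (isSpacelikeAt_iff (hd z hz)).mp (h.spacelike z hz)
  have hw := horiz_contDiffOn hX
  have hw1 := dirD_contDiffOn hΩ hw 1
  have hwI := dirD_contDiffOn hΩ hw Complex.I
  let G : ℂ → ℂ := fun z => ((jac (horiz X) z)⁻¹ : ℝ) * (Complex.I * ((dirD 1 X z 0 : ℝ) *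
      starRingEnd ℂ (dirD Complex.I (horiz X) z) -
    (dirD Complex.I X z 0 : ℝ) * starRingEnd ℂ (dirD 1 (horiz X) z)))
  have hc : ∀ {f : ℂ → ℂ}, ContDiffOn ℝ ∞ f Ω → ContDiffOn ℝ ∞ (fun z => starRingEnd ℂ (f z)) Ω :=
    fun hf => Complex.conjCLE.contDiff.comp_contDiffOn hf
  have hr : ∀ {f : ℂ → ℝ}, ContDiffOn ℝ ∞ f Ω → ContDiffOn ℝ ∞ (fun z => (f z : ℂ)) Ω :=
    fun hf => Complex.ofRealCLM.contDiff.comp_contDiffOn hf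
  have hX0 : ∀ a, ContDiffOn ℝ ∞ (fun z => dirD a X z 0) Ω := fun a =>
    contDiffOn_pi.mp (dirD_contDiffOn hΩ hX a) 0
  have hjs : ContDiffOn ℝ ∞ (jac (horiz X)) Ω :=
    Complex.imCLM.contDiff.comp_contDiffOn ((hc hw1).mul hwI)
  have hG : ContDiffOn ℝ ∞ G Ω :=
    (hr (hjs.inv hj)).mul (contDiffOn_const.mul (((hr (hX0 1)).mul (hc hwI)).sub
      ((hr (hX0 Complex.I)).mul (hc hw1))))
  have hl : ∀ z ∈ Ω, ∀ a, dirD a X z 0 = (G z * fderiv ℝ (horiz X) z a).re := by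
    intro z hz a
    have e : (ContinuousLinearMap.proj (R := ℝ) (φ := fun _ : Fin 3 => ℝ) 0).comp (fderiv ℝ X z) =
        Complex.reCLM.comp (G z • fderiv ℝ (horiz X) z) := by
      have hJ := hj z hz
      apply realLinear_ext
      · simp only [ContinuousLinearMap.comp_apply, ContinuousLinearMap.proj_apply, smul_apply,
          Complex.reCLM_apply, smul_eq_mul, G, dirD, mul_assoc, Complex.re_ofReal_mul]
        rw [eq_inv_mul_iff_mul_eq₀ hJ, jac]
        simp
        ring
      · simp only [ContinuousLinearMap.comp_apply, ContinuousLinearMap.proj_apply, smul_apply,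
          Complex.reCLM_apply, smul_eq_mul, G, dirD, mul_assoc, Complex.re_ofReal_mul]
        rw [eq_inv_mul_iff_mul_eq₀ hJ, jac]
        simp
        ring
    simpa [dirD] using congrArg (fun f : ℂ →L[ℝ] ℝ => f a) e
  let q : ℂ → ℂ := fun z => fderiv ℝ G z 1 / fderiv ℝ (horiz X) z 1
  have hq : ∀ z ∈ Ω, HasWDerivAt (horiz X) G (q z) z := by
    intro z hz
    have hGz := differentiableAt_of_contDiffOn hΩ hG hz
    obtain ⟨n, hn, hm⟩ := h.zero_mean z hz
    have := (meanCurv_eq_zero_iff hΩ hX hj hl hz hGz hn).mp hm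
    have h0 := fderiv_one_ne_zero (hj z hz)
    refine hGz.hasFDerivAt.congr_fderiv (realLinear_ext ?_ ?_)
    · simp only [smul_apply, smul_eq_mul, q]
      field_simp
    · simp only [smul_apply, smul_eq_mul, q]
      field_simp
      exact this.symm
  obtain ⟨hqs, q₁, hq₁⟩ := exists_wDeriv_of_wDeriv hΩ hw hj hG hq
  obtain ⟨hqs₁, q₂, hq₂⟩ := exists_wDeriv_of_wDeriv hΩ hw hj hqs hq₁
  exact ⟨G, q, q₁, q₂, hX, hj, hl, hqs, hqs₁, hq, hq₁, hq₂⟩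

namespace IsZMCData

variable {X : ℂ → Fin 3 → ℝ} {Ω : Set ℂ} {G q q₁ q₂ : ℂ → ℂ}

theorem differentiableAt (h : IsZMCData X Ω G q q₁ q₂) (hΩ : IsOpen Ω) {z : ℂ} (hz : z ∈ Ω) :
    DifferentiableAt ℝ X z := differentiableAt_of_contDiffOn hΩ h.smooth hz

theorem mono {U : Set ℂ} (h : IsZMCData X Ω G q q₁ q₂) (hU : U ⊆ Ω) :
    IsZMCData X U G q q₁ q₂ where
  smooth := h.smooth.mono hU
  jac_ne z hz := h.jac_ne z (hU hz)
  height z hz := h.height z (hU hz)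
  smooth_q := h.smooth_q.mono hU
  smooth_q₁ := h.smooth_q₁.mono hU
  dG z hz := h.dG z (hU hz)
  dq z hz := h.dq z (hU hz)
  dq₁ z hz := h.dq₁ z (hU hz)

theorem isZMCOn (h : IsZMCData X Ω G q q₁ q₂) (hΩ : IsOpen Ω) : IsZMCOn X Ω where
  smooth := h.smooth
  spacelike z hz := (isSpacelikeAt_iff (h.differentiableAt hΩ hz)).mpr (h.jac_ne z hz)
  zero_mean z hz := by
    obtain ⟨n, hn⟩ := exists_isGaussVector (h.differentiableAt hΩ hz) (h.jac_ne z hz)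
      (h.height z hz)
    refine ⟨n, hn, (meanCurv_eq_zero_iff hΩ h.smooth h.jac_ne h.height hz
      (h.dG z hz).differentiableAt hn).mpr ?_⟩
    rw [(h.dG z hz).apply, (h.dG z hz).apply]
    ring

/-- Principal directions are the directions `a` with `q dw(a)² ∈ ℝ`. -/
theorem isPrincipal_iff (h : IsZMCData X Ω G q q₁ q₂) (hΩ : IsOpen Ω) {z : ℂ} (hz : z ∈ Ω)
    (a : ℂ) :
    IsPrincipal X z a ↔ a ≠ 0 ∧ (q z * fderiv ℝ (horiz X) z a ^ 2).im = 0 := by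
  have hd := h.differentiableAt hΩ hz
  have hII : ∀ n, IsGaussVector X z n → ∀ b, secondFF X n z a b =
      (q z * fderiv ℝ (horiz X) z a * fderiv ℝ (horiz X) z b).re := by
    intro n hn b
    rw [secondFF_eq hΩ h.smooth h.jac_ne h.height hz (h.dG z hz).differentiableAt hn,
      (h.dG z hz).apply]
  have hJ := h.jac_ne z hz
  refine and_congr_right fun ha => ?_
  have hpos := (isSpacelikeAt_iff hd).mpr hJ a ha
  rw [firstFF_eq hd] at hpos
  constructor
  · rintro ⟨n, hn, κ, hκ⟩
    have e1 := hκ 1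
    have e2 := hκ Complex.I
    rw [hII n hn, firstFF_eq hd] at e1 e2
    simp only [jac, Complex.mul_im, Complex.conj_re, Complex.conj_im] at hJ
    set u := fderiv ℝ (horiz X) z 1
    set v := fderiv ℝ (horiz X) z Complex.I
    set p := fderiv ℝ (horiz X) z a
    have hp : q z * p = κ * starRingEnd ℂ p := by
      rw [Complex.mul_re, Complex.mul_re (starRingEnd ℂ p)] at e1 e2
      apply Complex.ext
      · have : ((q z * p).re - κ * p.re) * (u.re * v.im + -u.im * v.re) = 0 := by
          simp only [Complex.conj_re, Complex.conj_im] at e1 e2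
          linear_combination v.im * e1 - u.im * e2
        have := (mul_eq_zero.mp this).resolve_right hJ
        rw [Complex.re_ofReal_mul, Complex.conj_re]
        linarith
      · have : ((q z * p).im + κ * p.im) * (u.re * v.im + -u.im * v.re) = 0 := by
          simp only [Complex.conj_re, Complex.conj_im] at e1 e2
          linear_combination v.re * e1 - u.re * e2
        have := (mul_eq_zero.mp this).resolve_right hJ
        rw [Complex.im_ofReal_mul, Complex.conj_im]
        linarith
    have : q z * p ^ 2 = κ * (starRingEnd ℂ p * p) := by
      rw [pow_two, ← mul_assoc, hp]; ring
    rw [this]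
    simp
    ring_nf
    simp
  · intro him
    obtain ⟨n, hn⟩ := exists_isGaussVector hd hJ (h.height z hz)
    set p := fderiv ℝ (horiz X) z a with hp
    refine ⟨n, hn, (q z * p ^ 2).re / (starRingEnd ℂ p * p).re, fun b => ?_⟩
    rw [hII n hn, firstFF_eq hd, ← hp]
    rw [div_mul_eq_mul_div, eq_div_iff hpos.ne']
    set v := fderiv ℝ (horiz X) z b
    simp [pow_two] at him ⊢
    linear_combination (p.im * v.re - p.re * v.im) * him

theorem differentiableAt_horiz (h : IsZMCData X Ω G q q₁ q₂) (hΩ : IsOpen Ω) {z : ℂ}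
    (hz : z ∈ Ω) : DifferentiableAt ℝ (horiz X) z :=
  differentiableAt_of_contDiffOn hΩ (horiz_contDiffOn h.smooth) hz

/-! ### The Blaschke metric, the affine normal and the affine shape operator. -/

/-- In all three rows the height entry contains `Re (G ·)` of the horizontal part, which column
operations remove. Only the Hessian term `Re (q dw dw)` of the last row survives, multiplied by the
horizontal minor `J`. -/
theorem affineForm_eq (h : IsZMCData X Ω G q q₁ q₂) (hΩ : IsOpen Ω) {z : ℂ} (hz : z ∈ Ω)
    (a b : ℂ) : affineForm X a b z =
      (q z * fderiv ℝ (horiz X) z a * fderiv ℝ (horiz X) z b).re * jac (horiz X) z := by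
  have hd := h.differentiableAt hΩ hz
  rw [affineForm, Matrix.det_fin_three]
  simp only [Matrix.of_apply, Matrix.cons_val, jac]
  rw [h.height z hz, h.height z hz,
    dirD_dirD_height hΩ h.smooth h.height hz (h.dG z hz).differentiableAt, (h.dG z hz).apply]
  simp only [fderiv_horiz hd, Complex.add_re, Complex.mul_re, Complex.mul_im, Complex.conj_re,
    Complex.conj_im, horizL_re, horizL_im]
  ring

/-- The real part of a complex quadratic form is indefinite, so the sign is negative. Affine
degeneracy is therefore the same as being umbilic. -/
theorem affineDisc_eq (h : IsZMCData X Ω G q q₁ q₂) (hΩ : IsOpen Ω) {z : ℂ} (hz : z ∈ Ω) :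
    affineDisc X z = -(jac (horiz X) z ^ 4 * ‖q z‖ ^ 2) := by
  rw [affineDisc, h.affineForm_eq hΩ hz, h.affineForm_eq hΩ hz, h.affineForm_eq hΩ hz, jac,
    Complex.sq_norm, Complex.normSq_apply]
  simp only [Complex.mul_re, Complex.mul_im, Complex.conj_re, Complex.conj_im]
  ring

theorem affineDisc_ne_zero_iff (h : IsZMCData X Ω G q q₁ q₂) (hΩ : IsOpen Ω) {z : ℂ}
    (hz : z ∈ Ω) : affineDisc X z ≠ 0 ↔ q z ≠ 0 := by
  have := h.jac_ne z hz
  rw [h.affineDisc_eq hΩ hz]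
  simp [this]

theorem abs_affineDisc_rpow (h : IsZMCData X Ω G q q₁ q₂) (hΩ : IsOpen Ω) {z l : ℂ} (hz : z ∈ Ω)
    (hl : Complex.exp l = q z) :
    |affineDisc X z| ^ (1 / 4 : ℝ) = |jac (horiz X) z| * Real.exp (l.re / 2) := by
  have e : |affineDisc X z| = (|jac (horiz X) z| * Real.exp (l.re / 2)) ^ 4 := by
    rw [h.affineDisc_eq hΩ hz, abs_neg, abs_mul, abs_pow, abs_pow, abs_norm, ← hl,
      Complex.norm_exp, mul_pow, ← Real.exp_nat_mul, ← Real.exp_nat_mul]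
    congr 2
    push_cast
    ring
  rw [e, ← Real.rpow_natCast, ← Real.rpow_mul (by positivity)]
  norm_num

/-- With `σ` the sign of `J`, the metric is `σ |q|^(-1/2) Re (q dw²)`. A logarithm `l` of `q`
expresses the modulus and, later, the phase of `q` by smooth functions. -/
theorem blaschke_eq (h : IsZMCData X Ω G q q₁ q₂) (hΩ : IsOpen Ω) {z l : ℂ} (hz : z ∈ Ω)
    (hl : Complex.exp l = q z) {σ : ℝ} (hσ : σ * jac (horiz X) z = |jac (horiz X) z|)
    (hσ2 : σ ^ 2 = 1) (a b : ℂ) :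
    blaschke X a b z = σ * Real.exp (-l.re / 2) *
      (q z * fderiv ℝ (horiz X) z a * fderiv ℝ (horiz X) z b).re := by
  have hJ := h.jac_ne z hz
  rw [blaschke, h.abs_affineDisc_rpow hΩ hz hl, h.affineForm_eq hΩ hz, ← hσ, neg_div,
    Real.exp_neg]
  have : σ ≠ 0 := by rintro rfl; norm_num at hσ2
  field_simp
  rw [hσ2, mul_one]

theorem blaschke_disc (h : IsZMCData X Ω G q q₁ q₂) (hΩ : IsOpen Ω) {z l : ℂ} (hz : z ∈ Ω)
    (hl : Complex.exp l = q z) {σ : ℝ} (hσ : σ * jac (horiz X) z = |jac (horiz X) z|)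
    (hσ2 : σ ^ 2 = 1) :
    blaschke X 1 1 z * blaschke X Complex.I Complex.I z - blaschke X 1 Complex.I z ^ 2 =
      -(Real.exp (l.re / 2) * |jac (horiz X) z|) ^ 2 := by
  simp only [h.blaschke_eq hΩ hz hl hσ hσ2]
  have e1 : Real.exp (-l.re / 2) = Real.exp (l.re / 2) / ‖q z‖ := by
    rw [← hl, Complex.norm_exp, ← Real.exp_sub]
    congr 1; ring
  have hq : ‖q z‖ ≠ 0 := by rw [← hl]; simp
  have e2 : (q z * fderiv ℝ (horiz X) z 1 * fderiv ℝ (horiz X) z 1).re *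
      (q z * fderiv ℝ (horiz X) z Complex.I * fderiv ℝ (horiz X) z Complex.I).re -
      (q z * fderiv ℝ (horiz X) z 1 * fderiv ℝ (horiz X) z Complex.I).re ^ 2 =
      -(‖q z‖ ^ 2 * jac (horiz X) z ^ 2) := by
    rw [jac, Complex.sq_norm, Complex.normSq_apply]
    simp only [Complex.mul_re, Complex.mul_im, Complex.conj_re, Complex.conj_im]
    ring
  rw [e1, mul_pow (Real.exp (l.re / 2)) |_|, sq_abs]
  generalize (q z * fderiv ℝ (horiz X) z 1 * fderiv ℝ (horiz X) z 1).re = k₁ at *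
  generalize (q z * fderiv ℝ (horiz X) z 1 * fderiv ℝ (horiz X) z Complex.I).re = k₂ at *
  generalize (q z * fderiv ℝ (horiz X) z Complex.I *
    fderiv ℝ (horiz X) z Complex.I).re = k₃ at *
  field_simp
  rw [hσ2]
  linear_combination e2

/-- The flux of a function `f` with `df = Re (α dw)`, with respect to the Blaschke metric. -/
theorem blaschke_flux (h : IsZMCData X Ω G q q₁ q₂) (hΩ : IsOpen Ω) {z l : ℂ} (hz : z ∈ Ω)
    (hl : Complex.exp l = q z) {σ : ℝ} (hσ : σ * jac (horiz X) z = |jac (horiz X) z|)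
    (hσ2 : σ ^ 2 = 1) (α a b : ℂ) :
    let δ := blaschke X 1 1 z * blaschke X Complex.I Complex.I z - blaschke X 1 Complex.I z ^ 2
    Real.sqrt |δ| / δ * (blaschke X b b z * (α * fderiv ℝ (horiz X) z a).re -
      blaschke X a b z * (α * fderiv ℝ (horiz X) z b).re) =
    ((starRingEnd ℂ (fderiv ℝ (horiz X) z a) * fderiv ℝ (horiz X) z b).im / jac (horiz X) z) *
      (Complex.exp (l.im * Complex.I) * starRingEnd ℂ α * fderiv ℝ (horiz X) z b).im := by
  intro δ
  have hJ := h.jac_ne z hz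
  have hq : q z = Real.exp l.re * Complex.exp (l.im * Complex.I) := by
    rw [← hl, Complex.ofReal_exp, ← Complex.exp_add, Complex.re_add_im]
  have e0 : δ = _ := h.blaschke_disc hΩ hz hl hσ hσ2
  have hpos : 0 < Real.exp (l.re / 2) * |jac (horiz X) z| :=
    mul_pos (Real.exp_pos _) (abs_pos.mpr hJ)
  have e1 : Real.sqrt |δ| = Real.exp (l.re / 2) * |jac (horiz X) z| := by
    rw [e0, abs_neg, abs_of_nonneg (by positivity), Real.sqrt_sq hpos.le]
  rw [e1, e0, h.blaschke_eq hΩ hz hl hσ hσ2, h.blaschke_eq hΩ hz hl hσ hσ2, hq]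
  have e2 : Real.exp l.re = Real.exp (l.re / 2) ^ 2 := by
    rw [← Real.exp_nat_mul]; congr 1; push_cast; ring
  rw [e2, neg_div, Real.exp_neg, ← hσ]
  have hσ0 : σ ≠ 0 := by rintro rfl; norm_num at hσ2
  have hE := Real.exp_ne_zero (l.re / 2)
  generalize Real.exp (l.re / 2) = E at *
  generalize Complex.exp (l.im * Complex.I) = e at *
  generalize jac (horiz X) z = J at *
  generalize fderiv ℝ (horiz X) z a = u at *
  generalize fderiv ℝ (horiz X) z b = v at *
  have key : ((e * v * v).re * (α * u).re - (e * u * v).re * (α * v).re) =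
      -((starRingEnd ℂ u * v).im * (e * starRingEnd ℂ α * v).im) := by
    simp only [Complex.mul_re, Complex.mul_im, Complex.conj_re, Complex.conj_im]
    ring
  have k : ∀ x y, (((E ^ 2 : ℝ) : ℂ) * e * x * y).re = E ^ 2 * (e * x * y).re := fun x y => by
    rw [mul_assoc, mul_assoc, Complex.re_ofReal_mul, mul_assoc]
  rw [k, k]
  generalize (e * v * v).re = k₁ at *
  generalize (e * u * v).re = k₂ at *
  generalize (α * u).re = k₃ at *
  generalize (α * v).re = k₄ at *
  generalize (starRingEnd ℂ u * v).im = k₅ at *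
  generalize (e * starRingEnd ℂ α * v).im = k₆ at *
  field_simp
  linear_combination -key

/-- The divergence of the flux. -/
theorem divergence_eq {w α L : ℂ → ℂ} {z α' L' : ℂ} {U : Set ℂ} (hU : IsOpen U) (hz : z ∈ U)
    (hw : ContDiffOn ℝ ∞ w U) (hα : HasWDerivAt w α α' z) (hL : HasWDerivAt w L L' z) :
    (∀ b, DifferentiableAt ℝ (fun y => (Complex.exp ((L y).im * Complex.I) *
      starRingEnd ℂ (α y) * dirD b w y).im) z) ∧
    dirD 1 (fun y => (Complex.exp ((L y).im * Complex.I) * starRingEnd ℂ (α y) *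
        dirD Complex.I w y).im) z -
      dirD Complex.I (fun y => (Complex.exp ((L y).im * Complex.I) * starRingEnd ℂ (α y) *
        dirD 1 w y).im) z =
      jac w z * (Complex.exp ((L z).im * Complex.I) *
        starRingEnd ℂ (2 * α' - α z * L')).re := by
  have h1 : HasFDerivAt (fun y => ((L y).im : ℂ) * Complex.I)
      ((Complex.I • Complex.ofRealCLM.comp (Complex.imCLM)).comp (L' • fderiv ℝ w z)) z := by
    have := ((Complex.I • Complex.ofRealCLM.comp (Complex.imCLM)).hasFDerivAt (x := L z)).comp z hL
    refine this.congr_of_eventuallyEq (.of_forall fun y => ?_)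
    simp [mul_comm]
  have h2 : HasFDerivAt (fun y => Complex.exp ((L y).im * Complex.I)) _ z :=
    ((Complex.hasDerivAt_exp _).hasFDerivAt.restrictScalars ℝ).comp z h1
  have h3 : HasFDerivAt (fun y => starRingEnd ℂ (α y))
      ((Complex.conjCLE : ℂ →L[ℝ] ℂ).comp (α' • fderiv ℝ w z)) z :=
    (Complex.conjCLE : ℂ →L[ℝ] ℂ).hasFDerivAt.comp z hα
  have h4 := fun b => (differentiableAt_of_contDiffOn hU (dirD_contDiffOn hU hw b) hz).hasFDerivAt
  have h5 := fun b => Complex.imCLM.hasFDerivAt.comp z ((h2.mul h3).mul (h4 b))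
  have h6 : ∀ b, HasFDerivAt (fun y => (Complex.exp ((L y).im * Complex.I) *
      starRingEnd ℂ (α y) * dirD b w y).im) _ z := h5
  refine ⟨fun b => (h6 b).differentiableAt, ?_⟩
  -- The mixed second derivatives of `w` agree, so they cancel in the divergence and only the
  -- Jacobian factor remains.
  have h7 : fderiv ℝ (dirD Complex.I w) z 1 = fderiv ℝ (dirD 1 w) z Complex.I :=
    dirD_comm hU hw hz _ _
  rw [dirD, dirD, (h6 1).fderiv, (h6 Complex.I).fderiv]
  simp only [ContinuousLinearMap.comp_apply, smul_apply, add_apply, smul_eq_mul,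
    ContinuousLinearMap.coe_restrictScalars', ContinuousLinearMap.toSpanSingleton_apply, h7,
    Complex.imCLM_apply, Complex.ofRealCLM_apply, ContinuousLinearEquiv.coe_coe,
    Complex.conjCLE_apply, jac]
  simp only [dirD]
  generalize fderiv ℝ w z 1 = u
  generalize fderiv ℝ w z Complex.I = v
  generalize Complex.exp ((L z).im * Complex.I) = e
  generalize fderiv ℝ (dirD 1 w) z Complex.I = k
  simp [map_ofNat (starRingEnd ℂ) 2]
  ring

end IsZMCData

theorem trace_eq_re_add_im (S : ℂ →ₗ[ℝ] ℂ) :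
    LinearMap.trace ℝ ℂ S = (S 1).re + (S Complex.I).im := by
  rw [LinearMap.trace_eq_matrix_trace ℝ Complex.basisOneI, Matrix.trace_fin_two]
  simp [LinearMap.toMatrix_apply]

namespace IsZMCData

variable {X : ℂ → Fin 3 → ℝ} {Ω : Set ℂ} {G q q₁ q₂ : ℂ → ℂ}

theorem blaschke_symm (h : IsZMCData X Ω G q q₁ q₂) (hΩ : IsOpen Ω) {z : ℂ}
    (hz : z ∈ Ω) (a b : ℂ) : blaschke X a b z = blaschke X b a z := by
  rw [blaschke, blaschke, h.affineForm_eq hΩ hz, h.affineForm_eq hΩ hz]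
  ring_nf

/-- The components of the affine normal; `f = X i` has `df = Re (α dw)`, and `L` is a logarithm
of `q`. -/
theorem affineNormal_apply (h : IsZMCData X Ω G q q₁ q₂) {U : Set ℂ}
    (hU : IsOpen U) (hΩU : U = Ω) {L : ℂ → ℂ} (hL : ContinuousOn L U)
    (he : ∀ y ∈ U, Complex.exp (L y) = q y) {σ : ℝ}
    (hσ : ∀ y ∈ U, σ * jac (horiz X) y = |jac (horiz X) y|) (hσ2 : σ ^ 2 = 1) {z : ℂ}
    (hz : z ∈ U) {i : Fin 3} {α : Fin 3 → ℂ → ℂ} {α' : Fin 3 → ℂ}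
    (hα : ∀ i, HasWDerivAt (horiz X) (α i) (α' i) z)
    (hX : ∀ i, ∀ y ∈ U, ∀ a, dirD a X y i = (α i y * fderiv ℝ (horiz X) y a).re) :
    affineNormal X z i = σ * Real.exp (-(L z).re / 2) *
      (Complex.exp ((L z).im * Complex.I) *
        starRingEnd ℂ (α' i - α i z * (q₁ z / q z) / 2)).re := by
  subst hΩU
  have hLz : HasWDerivAt (horiz X) L (q₁ z / q z) z :=
    (h.dq z hz).of_exp_eq (hL.continuousAt (hU.mem_nhds hz))
      (by filter_upwards [hU.mem_nhds hz] with y hy using he y hy)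
  have hw := horiz_contDiffOn h.smooth
  have hdiv := fun j => divergence_eq hU hz hw (hα j) hLz
  have hJ := h.jac_ne z hz
  let Φ : ℂ → ℂ → Fin 3 → ℝ := fun b y j => (Complex.exp ((L y).im * Complex.I) *
      starRingEnd ℂ (α j y) * dirD b (horiz X) y).im
  have hΦ : ∀ b, DifferentiableAt ℝ (Φ b) z := fun b =>
    differentiableAt_pi.mpr fun j => (hdiv j).1 b
  have hflux := fun a b j y (hy : y ∈ U) =>
    h.blaschke_flux hU hy (he y hy) (hσ y hy) hσ2 (α j y) a b
  let δ : ℂ → ℝ := fun y => blaschke X 1 1 y * blaschke X Complex.I Complex.I y -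
    blaschke X 1 Complex.I y ^ 2
  have h1 : (fun y => (Real.sqrt |δ y| / δ y) •
      (blaschke X Complex.I Complex.I y • dirD 1 X y -
        blaschke X 1 Complex.I y • dirD Complex.I X y)) =ᶠ[𝓝 z] Φ Complex.I := by
    filter_upwards [hU.mem_nhds hz] with y hy
    ext j
    have := hflux 1 Complex.I j y hy
    simp only [Pi.smul_apply, Pi.sub_apply, smul_eq_mul, hX j y hy]
    rw [this, ← jac, div_self (h.jac_ne y hy), one_mul]
    rfl
  have h2 : (fun y => (Real.sqrt |δ y| / δ y) •
      (blaschke X 1 1 y • dirD Complex.I X y -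
        blaschke X 1 Complex.I y • dirD 1 X y)) =ᶠ[𝓝 z] fun y => -Φ 1 y := by
    filter_upwards [hU.mem_nhds hz] with y hy
    ext j
    have := hflux Complex.I 1 j y hy
    simp only [Pi.smul_apply, Pi.sub_apply, smul_eq_mul, hX j y hy, Pi.neg_apply]
    rw [h.blaschke_symm hU hy 1 Complex.I, this]
    have e : (starRingEnd ℂ (fderiv ℝ (horiz X) y Complex.I) * fderiv ℝ (horiz X) y 1).im =
        -jac (horiz X) y := by
      simp only [jac, Complex.mul_im, Complex.conj_re, Complex.conj_im]
      ring
    rw [e, neg_div, div_self (h.jac_ne y hy), neg_one_mul]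
    rfl
  have h3 : dirD 1 (Φ Complex.I) z i + dirD Complex.I (fun y => -Φ 1 y) z i =
      jac (horiz X) z * (Complex.exp ((L z).im * Complex.I) *
        starRingEnd ℂ (2 * α' i - α i z * (q₁ z / q z))).re := by
    rw [← (hdiv i).2, dirD_apply (hΦ _)]
    have : dirD Complex.I (fun y => -Φ 1 y) z = -dirD Complex.I (Φ 1) z := by
      have := (hΦ 1).hasFDerivAt.neg.fderiv
      change fderiv ℝ (-Φ 1) z Complex.I = _
      rw [this]
      rfl
    rw [this, Pi.neg_apply, dirD_apply (hΦ _)]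
    rfl
  have e0 : δ z = _ := h.blaschke_disc hU hz (he z hz) (hσ z hz) hσ2
  have hpos : 0 < Real.exp ((L z).re / 2) * |jac (horiz X) z| :=
    mul_pos (Real.exp_pos _) (abs_pos.mpr hJ)
  have e1 : Real.sqrt |δ z| = Real.exp ((L z).re / 2) * |jac (horiz X) z| := by
    rw [e0, abs_neg, abs_of_nonneg (by positivity), Real.sqrt_sq hpos.le]
  have e2 : affineNormal X z i = (1 / 2) * ((Real.sqrt |δ z|)⁻¹ *
      (dirD 1 (Φ Complex.I) z i + dirD Complex.I (fun y => -Φ 1 y) z i)) := by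
    have a1 : dirD 1 _ z = dirD 1 _ z := congrArg (fun f : ℂ →L[ℝ] Fin 3 → ℝ => f 1) h1.fderiv_eq
    have a2 : dirD Complex.I _ z = dirD Complex.I _ z :=
      congrArg (fun f : ℂ →L[ℝ] Fin 3 → ℝ => f Complex.I) h2.fderiv_eq
    rw [← a1, ← a2]
    rfl
  rw [e2, h3, e1, ← hσ z hz]
  have hσ0 : σ ≠ 0 := by rintro rfl; norm_num at hσ2
  have e3 : starRingEnd ℂ (2 * α' i - α i z * (q₁ z / q z)) =
      ((2 : ℝ) : ℂ) * starRingEnd ℂ (α' i - α i z * (q₁ z / q z) / 2) := by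
    rw [← Complex.conj_ofReal, ← map_mul]
    congr 1
    push_cast
    ring
  rw [e3, mul_left_comm (Complex.exp _), Complex.re_ofReal_mul, neg_div, Real.exp_neg]
  generalize (Complex.exp ((L z).im * Complex.I) *
        starRingEnd ℂ (α' i - α i z * (q₁ z / q z) / 2)).re = k
  field_simp
  linear_combination -k * hσ2

/-- The horizontal part of the affine normal. -/
theorem horizL_affineNormal (h : IsZMCData X Ω G q q₁ q₂) (hΩ : IsOpen Ω) {L : ℂ → ℂ}
    (hL : ContinuousOn L Ω) (he : ∀ y ∈ Ω, Complex.exp (L y) = q y) {σ : ℝ}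
    (hσ : ∀ y ∈ Ω, σ * jac (horiz X) y = |jac (horiz X) y|) (hσ2 : σ ^ 2 = 1) {z : ℂ}
    (hz : z ∈ Ω) :
    horizL (affineNormal X z) = -(σ / 2) *
      Complex.exp (-(3 / 4) * L z + (1 / 4) * starRingEnd ℂ (L z)) * (q₁ z / q z) ∧
    affineNormal X z 0 = σ * Real.exp ((L z).re / 2) +
      (G z * horizL (affineNormal X z)).re := by
  have hd := fun y hy => h.differentiableAt hΩ (z := y) hy
  -- The coordinates satisfy `dl = Re (G dw)`, `dx = Re dw` and `dy = Re (-i dw)`; only the first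
  -- coefficient has a nonzero derivative.
  have key := fun i => h.affineNormal_apply hΩ rfl hL he hσ hσ2 hz (i := i)
    (α := ![G, fun _ => 1, fun _ => -Complex.I]) (α' := ![q z, 0, 0])
    (by
      intro i
      fin_cases i
      · exact h.dG z hz
      · exact HasWDerivAt.const 1
      · exact HasWDerivAt.const _)
    (by
      intro i y hy a
      fin_cases i
      · exact h.height y hy a
      · simp [fderiv_horiz (hd y hy)]
      · simp [fderiv_horiz (hd y hy)])
  have hq : q z = Real.exp (L z).re * Complex.exp ((L z).im * Complex.I) := by
    rw [← he z hz, Complex.ofReal_exp, ← Complex.exp_add, Complex.re_add_im]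
  have e1 : Complex.exp (-(3 / 4) * L z + (1 / 4) * starRingEnd ℂ (L z)) =
      Real.exp (-(L z).re / 2) * starRingEnd ℂ (Complex.exp ((L z).im * Complex.I)) := by
    rw [← Complex.exp_conj, Complex.ofReal_exp, ← Complex.exp_add]
    congr 1
    apply Complex.ext <;> simp <;> ring
  have e2 : Complex.exp ((L z).im * Complex.I) *
      starRingEnd ℂ (Complex.exp ((L z).im * Complex.I)) = 1 := by
    rw [← Complex.exp_conj, ← Complex.exp_add]
    simp
  have e3 : Real.exp ((L z).re / 2) = Real.exp (-(L z).re / 2) * Real.exp (L z).re := by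
    rw [← Real.exp_add]; congr 1; ring
  have k0 := key 0
  have k1 := key 1
  have k2 := key 2
  simp only [Matrix.cons_val] at k0 k1 k2
  have hN : horizL (affineNormal X z) = -(σ / 2) *
      Complex.exp (-(3 / 4) * L z + (1 / 4) * starRingEnd ℂ (L z)) * (q₁ z / q z) := by
    rw [e1]
    generalize q₁ z / q z = v at *
    generalize Complex.exp ((L z).im * Complex.I) = e at *
    have : -((σ : ℂ) / 2) * (Real.exp (-(L z).re / 2) * starRingEnd ℂ e) * v =
        (((σ * Real.exp (-(L z).re / 2)) : ℝ) : ℂ) * (((-(1 / 2) : ℝ) : ℂ) *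
          (starRingEnd ℂ e * v)) := by
      push_cast; ring
    rw [this]
    apply Complex.ext
    · rw [horizL_re, k1, Complex.re_ofReal_mul, Complex.re_ofReal_mul]
      have : (0 : ℂ) - 1 * v / 2 = ((-(1 / 2) : ℝ) : ℂ) * v := by push_cast; ring
      rw [this, map_mul, Complex.conj_ofReal, mul_left_comm, Complex.re_ofReal_mul]
      simp
    · rw [horizL_im, k2, Complex.im_ofReal_mul, Complex.im_ofReal_mul]
      have : (0 : ℂ) - -Complex.I * v / 2 = ((-(1 / 2) : ℝ) : ℂ) * (-Complex.I * v) := by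
        push_cast; ring
      rw [this, map_mul, Complex.conj_ofReal, mul_left_comm, Complex.re_ofReal_mul]
      simp
      left
      ring
  refine ⟨hN, ?_⟩
  rw [k0, hN, e1]
  rw [e3]
  have e4 : (Complex.exp ((L z).im * Complex.I) *
      starRingEnd ℂ (q z)).re = Real.exp (L z).re := by
    rw [hq, map_mul, Complex.conj_ofReal, mul_left_comm, e2, mul_one, Complex.ofReal_re]
  rw [map_sub, mul_sub, Complex.sub_re, e4]
  generalize q₁ z / q z = v at *
  generalize Complex.exp ((L z).im * Complex.I) = e at *
  have r1 : G z * (-((σ : ℂ) / 2) * (Real.exp (-(L z).re / 2) * starRingEnd ℂ e) * v) =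
        (((σ * Real.exp (-(L z).re / 2)) : ℝ) : ℂ) * (((-(1 / 2) : ℝ) : ℂ) *
          (starRingEnd ℂ e * (G z * v))) := by
      push_cast; ring
  have r2 : G z * v / 2 = ((1 / 2 : ℝ) : ℂ) * (G z * v) := by push_cast; ring
  rw [r1, r2, Complex.re_ofReal_mul, Complex.re_ofReal_mul, map_mul, Complex.conj_ofReal,
    mul_left_comm, Complex.re_ofReal_mul]
  generalize G z * v = x
  simp
  ring

/-- The differential of the affine normal. -/
theorem dirD_affineNormal (h : IsZMCData X Ω G q q₁ q₂) (hΩ : IsOpen Ω) {L : ℂ → ℂ}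
    (hL : ContinuousOn L Ω) (he : ∀ y ∈ Ω, Complex.exp (L y) = q y) {σ : ℝ}
    (hσ : ∀ y ∈ Ω, σ * jac (horiz X) y = |jac (horiz X) y|) (hσ2 : σ ^ 2 = 1) {z : ℂ}
    (hz : z ∈ Ω) : ∃ B : ℂ, ∀ a,
    horizL (dirD a (affineNormal X) z) =
      ((2 * σ * Real.exp ((L z).re / 2) : ℝ) : ℂ) *
        ((7 * q₁ z ^ 2 - 4 * q z * q₂ z) / (16 * q z ^ 3)) * fderiv ℝ (horiz X) z a +
      B * starRingEnd ℂ (fderiv ℝ (horiz X) z a) ∧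
    dirD a (affineNormal X) z 0 = (G z * horizL (dirD a (affineNormal X) z)).re := by
  have hq0 : q z ≠ 0 := by rw [← he z hz]; exact Complex.exp_ne_zero _
  have hn := fun y (hy : y ∈ Ω) => h.horizL_affineNormal hΩ hL he hσ hσ2 hy
  have hLz : HasWDerivAt (horiz X) L (q₁ z / q z) z :=
    (h.dq z hz).of_exp_eq (hL.continuousAt (hΩ.mem_nhds hz))
      (by filter_upwards [hΩ.mem_nhds hz] with y hy using he y hy)
  have hv : HasWDerivAt (horiz X) (fun y => q₁ y / q y)
      (q₂ z / q z - q₁ z ^ 2 / q z ^ 2) z := by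
    have := (h.dq₁ z hz).mul ((h.dq z hz).inv hq0)
    refine (this.congr_deriv ?_)
    field_simp
    ring
  let N : ℂ → ℂ := fun y => -(σ / 2) *
      Complex.exp (-(3 / 4) * L y + (1 / 4) * starRingEnd ℂ (L y)) * (q₁ y / q y)
  have hE : HasFDerivAt (fun y => -(3 / 4) * L y + (1 / 4) * starRingEnd ℂ (L y))
      ((-(3 / 4) : ℂ) • ((q₁ z / q z) • fderiv ℝ (horiz X) z) +
      (1 / 4 : ℂ) • (Complex.conjCLE : ℂ →L[ℝ] ℂ).comp ((q₁ z / q z) • fderiv ℝ (horiz X) z)) z :=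
    (HasFDerivAt.const_mul hLz (-(3 / 4) : ℂ)).add
      (((Complex.conjCLE : ℂ →L[ℝ] ℂ).hasFDerivAt.comp z hLz).const_mul (1 / 4 : ℂ))
  have hE2 : HasFDerivAt (fun y => Complex.exp (-(3 / 4) * L y + (1 / 4) * starRingEnd ℂ (L y)))
      _ z := ((Complex.hasDerivAt_exp _).hasFDerivAt.restrictScalars ℝ).comp z hE
  have hN : HasFDerivAt N _ z := (hE2.const_mul (-(σ / 2 : ℂ))).mul hv
  have hN1 : HasFDerivAt (fun y => (N y).re) _ z := Complex.reCLM.hasFDerivAt.comp z hN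
  have hN2 : HasFDerivAt (fun y => (N y).im) _ z := Complex.imCLM.hasFDerivAt.comp z hN
  have hr : HasFDerivAt (fun y => σ * Real.exp ((L y).re / 2))
      ((σ * Real.exp ((L z).re / 2) / 2) •
        Complex.reCLM.comp ((q₁ z / q z) • fderiv ℝ (horiz X) z)) z := by
    have h1 : HasFDerivAt (fun y => (L y).re / 2) ((2⁻¹ : ℝ) •
        Complex.reCLM.comp ((q₁ z / q z) • fderiv ℝ (horiz X) z)) z := by
      have := (Complex.reCLM.hasFDerivAt.comp z hLz).const_mul (2⁻¹ : ℝ)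
      refine this.congr_of_eventuallyEq (.of_forall fun y => ?_)
      simp [div_eq_inv_mul]
    refine (h1.exp.const_mul σ).congr_fderiv ?_
    rw [smul_smul, smul_smul]
    congr 1
  have hGN : HasFDerivAt (fun y => (G y * N y).re) _ z :=
    Complex.reCLM.hasFDerivAt.comp z (HasFDerivAt.mul (h.dG z hz) hN)
  have h0 : HasFDerivAt (fun y => σ * Real.exp ((L y).re / 2) + (G y * N y).re) _ z := hr.add hGN
  let V : ℂ → Fin 3 → ℝ := fun y =>
    ![σ * Real.exp ((L y).re / 2) + (G y * N y).re, (N y).re, (N y).im]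
  have hV : affineNormal X =ᶠ[𝓝 z] V := by
    filter_upwards [hΩ.mem_nhds hz] with y hy
    have hNy : horizL (affineNormal X y) = N y := (hn y hy).1
    ext i
    fin_cases i
    · simpa [V, hNy] using (hn y hy).2
    · simp [V, ← hNy]
    · simp [V, ← hNy]
  have hVd : DifferentiableAt ℝ V z := by
    refine differentiableAt_pi.mpr fun i => ?_
    fin_cases i
    · exact h0.differentiableAt
    · exact hN1.differentiableAt
    · exact hN2.differentiableAt
  have hdir : ∀ a, dirD a (affineNormal X) z = dirD a V z := fun a => by
    rw [dirD, hV.fderiv_eq, dirD]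
  have hhor : ∀ a, horizL (dirD a (affineNormal X) z) = fderiv ℝ N z a := by
    intro a
    rw [hdir]
    apply Complex.ext
    · rw [horizL_re, dirD_apply hVd]
      change fderiv ℝ (fun y => (N y).re) z a = _
      rw [hN1.fderiv, hN.fderiv]
      rfl
    · rw [horizL_im, dirD_apply hVd]
      change fderiv ℝ (fun y => (N y).im) z a = _
      rw [hN2.fderiv, hN.fderiv]
      rfl
  have hexp : Complex.exp (-(3 / 4) * L z + (1 / 4) * starRingEnd ℂ (L z)) * q z =
      Real.exp ((L z).re / 2) := by
    rw [← he z hz, ← Complex.exp_add, Complex.ofReal_exp]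
    congr 1
    apply Complex.ext <;> simp <;> ring
  -- The conjugate-linear part arises from differentiating `conj L` in the exponent. Its exact value
  -- is irrelevant to the trace of the shape operator.
  refine ⟨-(σ / 2) * Complex.exp (-(3 / 4) * L z + (1 / 4) * starRingEnd ℂ (L z)) * (1 / 4) *
    (q₁ z / q z) * starRingEnd ℂ (q₁ z / q z), fun a => ⟨?_, ?_⟩⟩
  · rw [hhor, hN.fderiv, Complex.ofReal_mul, ← hexp]
    simp only [ContinuousLinearMap.comp_apply, smul_apply, add_apply, smul_eq_mul,
      ContinuousLinearMap.coe_restrictScalars', ContinuousLinearMap.toSpanSingleton_apply,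
      ContinuousLinearEquiv.coe_coe, Complex.conjCLE_apply, map_mul]
    push_cast
    field_simp
    ring
  · rw [hhor, hdir, dirD_apply hVd]
    change fderiv ℝ (fun y => σ * Real.exp ((L y).re / 2) + (G y * N y).re) z a = _
    have hGz : HasFDerivAt (fun y => G y * N y) _ z := HasFDerivAt.mul (h.dG z hz) hN
    have hqN : N z * q z = ((-(σ / 2) * Real.exp ((L z).re / 2) : ℝ) : ℂ) * (q₁ z / q z) := by
      rw [Complex.ofReal_mul, ← hexp]
      simp only [N]
      push_cast
      ring
    rw [h0.fderiv]
    have : fderiv ℝ N z = _ := hN.fderiv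
    rw [this]
    simp only [add_apply, smul_apply, ContinuousLinearMap.comp_apply, smul_eq_mul,
      Complex.reCLM_apply, ← mul_assoc (N z), hqN, Complex.add_re]
    rw [mul_assoc (Complex.ofReal _), Complex.re_ofReal_mul]
    ring

/-- Away from umbilics, a zero mean curvature surface is affine minimal exactly if the real part
of `(7 q₁² - 4 q q₂) / (16 q³)` vanishes. -/
theorem exists_isAffineShape_iff (h : IsZMCData X Ω G q q₁ q₂) (hΩ : IsOpen Ω) {z : ℂ}
    (hz : z ∈ Ω) (hq0 : q z ≠ 0) :
    (∃ S : ℂ →ₗ[ℝ] ℂ, IsAffineShape X z S ∧ (1 / 2 : ℝ) * LinearMap.trace ℝ ℂ S = 0) ↔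
      ((7 * q₁ z ^ 2 - 4 * q z * q₂ z) / (16 * q z ^ 3)).re = 0 := by
  obtain ⟨L, U, hU, hzU, hL, he⟩ := exists_local_log (h.smooth_q.contDiffAt (hΩ.mem_nhds hz)) hq0
  have hJ := h.jac_ne z hz
  have hjc : ContinuousAt (jac (horiz X)) z := by
    have hw := horiz_contDiffOn h.smooth
    have h1 := (dirD_contDiffOn hΩ hw 1).continuousOn.continuousAt (hΩ.mem_nhds hz)
    have hI := (dirD_contDiffOn hΩ hw Complex.I).continuousOn.continuousAt (hΩ.mem_nhds hz)
    exact Complex.continuous_im.continuousAt.comp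
      ((Complex.continuous_conj.continuousAt.comp h1).mul hI)
  -- `σ` is the sign of the Jacobian, which is constant near `z`.
  obtain ⟨σ, hσ2, V, hV, hVo, hzV⟩ : ∃ σ : ℝ, σ ^ 2 = 1 ∧ ∃ V : Set ℂ,
      (∀ y ∈ V, σ * jac (horiz X) y = |jac (horiz X) y|) ∧ IsOpen V ∧ z ∈ V := by
    rcases lt_or_gt_of_ne hJ with hneg | hpos
    · obtain ⟨V, hV, hVo, hzV⟩ := eventually_nhds_iff.mp (hjc.eventually_lt continuousAt_const hneg)
      exact ⟨-1, by norm_num, V, fun y hy => by rw [abs_of_neg (hV y hy), neg_one_mul], hVo, hzV⟩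
    · obtain ⟨V, hV, hVo, hzV⟩ := eventually_nhds_iff.mp (continuousAt_const.eventually_lt hjc hpos)
      exact ⟨1, by norm_num, V, fun y hy => by rw [abs_of_pos (hV y hy), one_mul], hVo, hzV⟩
  have hW : IsOpen (Ω ∩ (U ∩ V)) := hΩ.inter (hU.inter hVo)
  have hzW : z ∈ Ω ∩ (U ∩ V) := ⟨hz, hzU, hzV⟩
  have h' : IsZMCData X (Ω ∩ (U ∩ V)) G q q₁ q₂ := h.mono Set.inter_subset_left
  obtain ⟨B, hB⟩ := h'.dirD_affineNormal hW (hL.mono fun y hy => hy.2.1)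
    (fun y hy => he y hy.2.1) (fun y hy => hV y hy.2.2) hσ2 hzW
  set Q := (7 * q₁ z ^ 2 - 4 * q z * q₂ z) / (16 * q z ^ 3) with hQ
  have hd := h.differentiableAt hΩ hz
  have hm : (2 * σ * Real.exp ((L z).re / 2) : ℝ) ≠ 0 := by
    have : σ ≠ 0 := by rintro rfl; norm_num at hσ2
    have := Real.exp_ne_zero ((L z).re / 2)
    positivity
  set m : ℝ := 2 * σ * Real.exp ((L z).re / 2)
  clear_value m
  have hshape : ∀ S : ℂ →ₗ[ℝ] ℂ, IsAffineShape X z S ↔ ∀ a,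
      m * Q * fderiv ℝ (horiz X) z a + B * starRingEnd ℂ (fderiv ℝ (horiz X) z a) =
        -fderiv ℝ (horiz X) z (S a) := by
    intro S
    refine forall_congr' fun a => ?_
    rw [← (hB a).1]
    constructor
    · intro hS
      rw [hS, map_neg, fderiv_horiz hd]
    · intro hS
      have h1 := (hB a).2
      rw [hS, mul_neg, Complex.neg_re, ← h.height z hz] at h1
      rw [fderiv_horiz hd, ← map_neg] at hS
      have e1 := congrArg Complex.re hS
      have e2 := congrArg Complex.im hS
      simp only [horizL_re, horizL_im] at e1 e2
      ext i
      fin_cases i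
      · exact h1
      · exact e1
      · exact e2
  -- Through `dw` the operator `S` is conjugate to `v ↦ -(m Q v + B conj v)`. A conjugate-linear map
  -- has real trace zero, so only `-2 Re (m Q)` remains.
  have htrace : ∀ S : ℂ →ₗ[ℝ] ℂ, IsAffineShape X z S →
      LinearMap.trace ℝ ℂ S = -2 * (m * Q.re) := by
    intro S hS
    have e := (hshape S).mp hS
    have e1 := e 1
    have eI := e Complex.I
    have lin : ∀ b : ℂ, fderiv ℝ (horiz X) z b =
        b.re * fderiv ℝ (horiz X) z 1 + b.im * fderiv ℝ (horiz X) z Complex.I := by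
      intro b
      have : b = b.re • (1 : ℂ) + b.im • Complex.I := by simp [Complex.re_add_im]
      conv_lhs => rw [this, map_add, map_smul, map_smul]
      simp
    rw [lin (S 1)] at e1
    rw [lin (S Complex.I)] at eI
    rw [trace_eq_re_add_im]
    simp only [jac, Complex.mul_im, Complex.conj_re, Complex.conj_im] at hJ
    generalize fderiv ℝ (horiz X) z 1 = u at *
    generalize fderiv ℝ (horiz X) z Complex.I = v at *
    rw [mul_assoc] at e1 eI
    have r1 := congrArg Complex.re e1
    have r2 := congrArg Complex.im e1
    have r3 := congrArg Complex.re eI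
    have r4 := congrArg Complex.im eI
    simp only [Complex.add_re, Complex.add_im, Complex.neg_re, Complex.neg_im,
      Complex.ofReal_re, Complex.ofReal_im, Complex.mul_re, Complex.mul_im,
      Complex.conj_re, Complex.conj_im] at r1 r2 r3 r4
    refine mul_right_cancel₀ hJ ?_
    linear_combination v.im * r1 - v.re * r2 - u.im * r3 + u.re * r4
  constructor
  · rintro ⟨S, hS, htr⟩
    rw [htrace S hS] at htr
    have : m * Q.re = 0 := by linarith
    exact (mul_eq_zero.mp this).resolve_left hm
  · intro hre
    have hinj : Function.Injective (fderiv ℝ (horiz X) z : ℂ →ₗ[ℝ] ℂ) := by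
      rw [← LinearMap.ker_eq_bot, LinearMap.ker_eq_bot']
      intro a ha
      by_contra ha0
      have := (isSpacelikeAt_iff hd).mpr hJ a ha0
      rw [firstFF_eq hd] at this
      have ha' : fderiv ℝ (horiz X) z a = 0 := ha
      simp [ha'] at this
    let e := LinearEquiv.ofInjectiveEndo _ hinj
    let N : ℂ →ₗ[ℝ] ℂ := (((m * Q : ℂ) • fderiv ℝ (horiz X) z +
      B • (Complex.conjCLE : ℂ →L[ℝ] ℂ).comp (fderiv ℝ (horiz X) z) : ℂ →L[ℝ] ℂ) : ℂ →ₗ[ℝ] ℂ)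
    have hS : IsAffineShape X z (-(e.symm.toLinearMap ∘ₗ N)) := by
      rw [hshape]
      intro a
      have : fderiv ℝ (horiz X) z (e.symm (N a)) = N a := e.apply_symm_apply (N a)
      simp only [LinearMap.neg_apply, LinearMap.comp_apply, map_neg, neg_neg]
      exact this.symm
    exact ⟨_, hS, by rw [htrace _ hS, hre]; simp⟩

end IsZMCData

/-! ### Planar curvature lines force the invariant to be real. -/

/-- A vector field `V` with `dw(V) = p`. -/
def liftField (w p : ℂ → ℂ) (z : ℂ) : ℂ :=
  (((starRingEnd ℂ (p z) * fderiv ℝ w z Complex.I).im / jac w z : ℝ) : ℂ) +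
    (((starRingEnd ℂ (fderiv ℝ w z 1) * p z).im / jac w z : ℝ) : ℂ) * Complex.I

theorem fderiv_liftField {w p : ℂ → ℂ} {z : ℂ} (hj : jac w z ≠ 0) :
    fderiv ℝ w z (liftField w p z) = p z := by
  have e : ∀ a b : ℝ, fderiv ℝ w z ((a : ℂ) + (b : ℂ) * Complex.I) =
      a * fderiv ℝ w z 1 + b * fderiv ℝ w z Complex.I := by
    intro a b
    have : (a : ℂ) + (b : ℂ) * Complex.I = a • (1 : ℂ) + b • Complex.I := by simp
    rw [this, map_add, map_smul, map_smul]
    simp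
  rw [liftField, e]
  simp only [jac] at hj ⊢
  generalize fderiv ℝ w z 1 = u at *
  generalize fderiv ℝ w z Complex.I = v at *
  have hJ : (starRingEnd ℂ u * v).im = u.re * v.im - u.im * v.re := by simp; ring
  generalize (starRingEnd ℂ u * v).im = J at *
  apply Complex.ext
  · rw [Complex.add_re, Complex.re_ofReal_mul, Complex.re_ofReal_mul]
    field_simp
    simp
    linear_combination -(p z).re * hJ
  · rw [Complex.add_im, Complex.im_ofReal_mul, Complex.im_ofReal_mul]
    field_simp
    simp
    linear_combination -(p z).im * hJ

theorem contDiffOn_liftField {w p : ℂ → ℂ} {Ω : Set ℂ} (hΩ : IsOpen Ω) (hw : ContDiffOn ℝ ∞ w Ω)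
    (hp : ContDiffOn ℝ ∞ p Ω) (hj : ∀ z ∈ Ω, jac w z ≠ 0) :
    ContDiffOn ℝ ∞ (liftField w p) Ω := by
  have hw1 := dirD_contDiffOn hΩ hw 1
  have hwI := dirD_contDiffOn hΩ hw Complex.I
  have hc : ∀ {f : ℂ → ℂ}, ContDiffOn ℝ ∞ f Ω → ContDiffOn ℝ ∞ (fun z => starRingEnd ℂ (f z)) Ω :=
    fun hf => Complex.conjCLE.contDiff.comp_contDiffOn hf
  have hr : ∀ {f : ℂ → ℝ}, ContDiffOn ℝ ∞ f Ω → ContDiffOn ℝ ∞ (fun z => (f z : ℂ)) Ω :=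
    fun hf => Complex.ofRealCLM.contDiff.comp_contDiffOn hf
  have hi : ∀ {f : ℂ → ℂ}, ContDiffOn ℝ ∞ f Ω → ContDiffOn ℝ ∞ (fun z => (f z).im) Ω :=
    fun hf => Complex.imCLM.contDiff.comp_contDiffOn hf
  have hjs : ContDiffOn ℝ ∞ (jac w) Ω := hi ((hc hw1).mul hwI)
  exact (hr ((hi ((hc hp).mul hwI)).div hjs hj)).add
    ((hr ((hi ((hc hw1).mul hp)).div hjs hj)).mul contDiffOn_const)

/-- A smooth vector field has a smooth integral curve through each point. -/
theorem exists_smooth_integralCurve {V : ℂ → ℂ} {Ω : Set ℂ} (hΩ : IsOpen Ω)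
    (hV : ContDiffOn ℝ ∞ V Ω) {z : ℂ} (hz : z ∈ Ω) :
    ∃ γ : ℝ → ℂ, γ 0 = z ∧ ∃ ε > 0, ContDiffOn ℝ ∞ γ (Set.Ioo (-ε) ε) ∧
      ∀ s ∈ Set.Ioo (-ε) ε, γ s ∈ Ω ∧ HasDerivAt γ (V (γ s)) s := by
  obtain ⟨γ, h0, ε, hε, hγ⟩ :=
    ((hV.contDiffAt (hΩ.mem_nhds hz)).of_le
      (WithTop.coe_le_coe.mpr le_top)).exists_forall_mem_closedBall_exists_eq_forall_mem_Ioo_hasDerivAt₀ 0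
  simp only [zero_sub, zero_add] at hγ
  have hcont : ContinuousAt γ 0 := (hγ 0 ⟨by linarith, hε⟩).continuousAt
  obtain ⟨ρ, hρ, hball⟩ := Metric.mem_nhds_iff.mp
    (hcont.preimage_mem_nhds (by rw [h0]; exact hΩ.mem_nhds hz))
  have hη : 0 < min ε ρ / 2 := by positivity
  have hη1 : min ε ρ / 2 < ε := by linarith [min_le_left ε ρ]
  have hη2 : min ε ρ / 2 < ρ := by linarith [min_le_right ε ρ]
  refine ⟨γ, h0, min ε ρ / 2, hη, ?_, fun s hs => ⟨?_, ?_⟩⟩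
  · refine ContDiffOn.mono (ODE.contDiffOn_enat_Icc_of_hasDerivWithinAt (n := ⊤) (u := Ω)
      (f := fun _ x => V x) ?_ ?_ ?_) Set.Ioo_subset_Icc_self
    · exact ContDiffOn.comp (g := V) hV contDiffOn_snd fun x hx => hx.2
    · intro t ht
      exact (hγ t ⟨by linarith [ht.1], by linarith [ht.2]⟩).hasDerivWithinAt
    · intro t ht
      apply hball
      rw [Metric.mem_ball, Real.dist_eq, sub_zero, abs_lt]
      exact ⟨by linarith [ht.1], by linarith [ht.2]⟩
  · apply hball
    rw [Metric.mem_ball, Real.dist_eq, sub_zero, abs_lt]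
    exact ⟨by linarith [hs.1], by linarith [hs.2]⟩
  · exact hγ s ⟨by linarith [hs.1], by linarith [hs.2]⟩

/-- The derivative of a function vanishing on an interval around `0`. -/
theorem hasDerivAt_eq_zero_of_eq_zero {f : ℝ → ℝ} {f' ε s : ℝ} (hs : s ∈ Set.Ioo (-ε) ε)
    (hf : ∀ s ∈ Set.Ioo (-ε) ε, f s = 0) (h : HasDerivAt f f' s) : f' = 0 := by
  have : HasDerivAt f 0 s := (hasDerivAt_const s (0 : ℝ)).congr_of_eventuallyEq
    (by filter_upwards [isOpen_Ioo.mem_nhds hs] with t ht using hf t ht)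
  exact h.unique this

namespace IsZMCData

variable {X : ℂ → Fin 3 → ℝ} {Ω : Set ℂ} {G q q₁ q₂ : ℂ → ℂ}

/-- If the curvature lines are planar, the imaginary part of `(7 q₁² - 4 q q₂) / (16 q³)` vanishes
away from umbilics. -/
theorem im_eq_zero_of_planar (h : IsZMCData X Ω G q q₁ q₂) (hΩ : IsOpen Ω)
    (hP : ∀ (γ : ℝ → ℂ) (s₀ s₁ : ℝ), IsCurvatureLine X Ω γ s₀ s₁ →
      LiesInPlane ((fun s => X (γ s)) '' Set.Ioo s₀ s₁)) {z : ℂ} (hz : z ∈ Ω) (hq0 : q z ≠ 0) :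
    ((7 * q₁ z ^ 2 - 4 * q z * q₂ z) / (16 * q z ^ 3)).im = 0 := by
  obtain ⟨L, U, hU, hzU, hL, he⟩ := exists_local_log (h.smooth_q.contDiffAt (hΩ.mem_nhds hz)) hq0
  have hW : IsOpen (Ω ∩ U) := hΩ.inter hU
  have hLe : ∀ y ∈ Ω ∩ U, ∀ᶠ x in 𝓝 y, Complex.exp (L x) = q x := fun y hy => by
    filter_upwards [hU.mem_nhds hy.2] with x hx using he x hx
  have hLc : ∀ y ∈ Ω ∩ U, ContinuousAt L y := fun y hy => hL.continuousAt (hU.mem_nhds hy.2)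
  have hLs : ContDiffOn ℝ ∞ L (Ω ∩ U) := fun y hy =>
    (contDiffAt_of_exp_eq (hLc y hy) (hLe y hy)
      (h.smooth_q.contDiffAt (hΩ.mem_nhds hy.1))).contDiffWithinAt
  -- `p = q^(-1/2)`, so `q p² = 1` is real and the lifted field is principal. Along its integral
  -- curves differentiation in `s` is `p` times differentiation in `w`.
  let p : ℂ → ℂ := fun y => Complex.exp (-(1 / 2) * L y)
  have hps : ContDiffOn ℝ ∞ p (Ω ∩ U) := (contDiffOn_const.mul hLs).cexp
  have hp0 : ∀ y, p y ≠ 0 := fun y => Complex.exp_ne_zero _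
  have hpq : ∀ y ∈ Ω ∩ U, q y * p y ^ 2 = 1 := by
    intro y hy
    rw [← he y hy.2, ← Complex.exp_nat_mul, ← Complex.exp_add]
    simp
  have hq : ∀ y ∈ Ω ∩ U, q y ≠ 0 := fun y hy h0 => by simpa [h0] using hpq y hy
  have hw := horiz_contDiffOn h.smooth
  obtain ⟨γ, hγ0, ε, hε, hγs, hγ⟩ := exists_smooth_integralCurve hW
    (contDiffOn_liftField hW (hw.mono Set.inter_subset_left) hps
      fun y hy => h.jac_ne y hy.1) ⟨hz, hzU⟩
  have hdw : ∀ s ∈ Set.Ioo (-ε) ε,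
      fderiv ℝ (horiz X) (γ s) (liftField (horiz X) p (γ s)) = p (γ s) := fun s hs =>
    fderiv_liftField (h.jac_ne _ (hγ s hs).1.1)
  obtain ⟨ν, hν, c, hc⟩ := hP γ (-ε) ε ⟨hγs, fun s hs => ⟨(hγ s hs).1.1, by
    rw [(hγ s hs).2.deriv, h.isPrincipal_iff hΩ (hγ s hs).1.1, hdw s hs, hpq _ (hγ s hs).1]
    refine ⟨fun h0 => hp0 (γ s) ?_, by simp⟩
    rw [← hdw s hs, h0, map_zero]⟩⟩
  -- derivatives along the curvature line
  have dG : ∀ s ∈ Set.Ioo (-ε) ε, HasDerivAt (fun s => G (γ s)) (q (γ s) * p (γ s)) s :=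
    fun s hs => (h.dG _ (hγ s hs).1.1).comp_curve (hγ s hs).2 (hdw s hs)
  have dp : ∀ s ∈ Set.Ioo (-ε) ε,
      HasDerivAt (fun s => p (γ s)) (-(1 / 2) * (q₁ (γ s) / q (γ s) ^ 2)) s := by
    intro s hs
    have hy := (hγ s hs).1
    have h1 := (((h.dq _ hy.1).of_exp_eq (hLc _ hy) (hLe _ hy)).const_mul (-(1 / 2))).cexp
    refine (h1.comp_curve (hγ s hs).2 (hdw s hs)).congr_deriv ?_
    change p (γ s) * _ * _ = _
    have := hpq _ hy
    have := hq _ hy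
    field_simp
    linear_combination -q₁ (γ s) * hpq _ hy
  have dp₁ : ∀ s ∈ Set.Ioo (-ε) ε, HasDerivAt (fun s => -(1 / 2) * (q₁ (γ s) / q (γ s) ^ 2))
      ((-(1 / 2) * (q₂ (γ s) / q (γ s) ^ 2) + q₁ (γ s) ^ 2 / q (γ s) ^ 3) * p (γ s)) s := by
    intro s hs
    have hy := (hγ s hs).1
    have h1 := ((h.dq₁ _ hy.1).mul (((h.dq _ hy.1).pow 2).inv (pow_ne_zero 2 (hq _ hy)))).const_mul
      (-(1 / 2))
    refine (h1.comp_curve (hγ s hs).2 (hdw s hs)).congr_deriv ?_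
    have := hq _ hy
    push_cast
    field_simp
    ring
  -- The derivative of `ν · X` along the curve is `Re (M p)`. The relations `e1`, `e2`, `e3` express
  -- the vanishing of its first three derivatives.
  let M : ℝ → ℂ := fun s => ν 0 * G (γ s) + (ν 1 - ν 2 * Complex.I)
  have dM : ∀ s ∈ Set.Ioo (-ε) ε, HasDerivAt M (ν 0 * (q (γ s) * p (γ s))) s := fun s hs =>
    ((dG s hs).const_mul _).add_const _
  have e1 : ∀ s ∈ Set.Ioo (-ε) ε, (M s * p (γ s)).re = 0 := by
    intro s hs
    have hy := (hγ s hs).1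
    have hd := h.differentiableAt hΩ hy.1
    have hX : HasDerivAt (fun s => X (γ s)) (dirD (liftField (horiz X) p (γ s)) X (γ s)) s :=
      hd.hasFDerivAt.comp_hasDerivAt s (hγ s hs).2
    have hXi := hasDerivAt_pi.mp hX
    have h1 : HasDerivAt (fun s => ν ⬝ᵥ X (γ s) - c)
        (ν ⬝ᵥ dirD (liftField (horiz X) p (γ s)) X (γ s)) s := by
      simp only [dotProduct, Fin.sum_univ_three]
      exact ((((hXi 0).const_mul _).add ((hXi 1).const_mul _)).add
        ((hXi 2).const_mul _)).sub_const c
    have h2 := hasDerivAt_eq_zero_of_eq_zero hs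
      (fun s hs => by rw [hc _ ⟨s, hs, rfl⟩, sub_self]) h1
    have h3 := hdw s hs
    rw [fderiv_horiz hd] at h3
    rw [← h2, dotProduct, Fin.sum_univ_three, h.height _ hy.1, hdw s hs]
    have r1 := congrArg Complex.re h3
    have r2 := congrArg Complex.im h3
    rw [horizL_re] at r1
    rw [horizL_im] at r2
    rw [r1, r2]
    simp [M]
    ring
  have e2 : ∀ s ∈ Set.Ioo (-ε) ε,
      ν 0 + (M s * (-(1 / 2) * (q₁ (γ s) / q (γ s) ^ 2))).re = 0 := by
    intro s hs
    have h1 : HasDerivAt (fun s => (M s * p (γ s)).re) _ s :=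
      Complex.reCLM.hasFDerivAt.comp_hasDerivAt s ((dM s hs).mul (dp s hs))
    have h2 := hasDerivAt_eq_zero_of_eq_zero hs e1 h1
    rw [← h2]
    have : (ν 0 : ℂ) * (q (γ s) * p (γ s)) * p (γ s) = ν 0 := by
      linear_combination (ν 0 : ℂ) * hpq _ (hγ s hs).1
    simp [this]
  have h0 : (0 : ℝ) ∈ Set.Ioo (-ε) ε := ⟨by linarith, hε⟩
  have e3 : (ν 0 * (q z * p z) * (-(1 / 2) * (q₁ z / q z ^ 2)) + M 0 *
      ((-(1 / 2) * (q₂ z / q z ^ 2) + q₁ z ^ 2 / q z ^ 3) * p z)).re = 0 := by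
    have h1 : HasDerivAt (fun s => ν 0 + (M s * (-(1 / 2) * (q₁ (γ s) / q (γ s) ^ 2))).re) _ 0 :=
      (Complex.reCLM.hasFDerivAt.comp_hasDerivAt 0 ((dM 0 h0).mul (dp₁ 0 h0))).const_add (ν 0)
    have h2 := hasDerivAt_eq_zero_of_eq_zero h0 e2 h1
    simpa [hγ0] using h2
  have e1' := e1 0 h0
  have e2' := e2 0 h0
  rw [hγ0] at e1' e2'
  have hpqz := hpq z ⟨hz, hzU⟩
  -- solve for the plane
  obtain ⟨τ, hτ⟩ : ∃ τ : ℝ, M 0 * p z = τ * Complex.I :=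
    ⟨(M 0 * p z).im, Complex.ext (by simpa using e1') (by simp)⟩
  set S := q z * p z * (-(1 / 2) * (q₁ z / q z ^ 2)) with hS
  have hM : M 0 = τ * Complex.I * (q z * p z) := by
    rw [← hτ]; linear_combination -(M 0) * hpqz
  -- If `τ = 0`, then `M` vanishes, the second relation gives `ν 0 = 0`, and the definition of `M`
  -- kills the other two components of the normal.
  have hτ0 : τ ≠ 0 := by
    rintro rfl
    have hM0 : M 0 = 0 := by rw [hM]; simp
    rw [hM0] at e2'
    have hν0 : ν 0 = 0 := by simpa using e2'
    simp only [M, hν0] at hM0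
    have r1 := congrArg Complex.re hM0
    have r2 := congrArg Complex.im hM0
    simp at r1 r2
    apply hν
    ext i
    fin_cases i
    · exact hν0
    · exact r1
    · exact r2
  have f2 : ν 0 = τ * S.im := by
    have : M 0 * (-(1 / 2) * (q₁ z / q z ^ 2)) = τ * (Complex.I * S) := by
      rw [hM, hS]; ring
    rw [this, Complex.re_ofReal_mul] at e2'
    simp at e2'
    linarith
  have f3 : S.im * S.re - (-(1 / 2) * (q₂ z / q z ^ 2) + q₁ z ^ 2 / q z ^ 3).im = 0 := by
    have a1 : (ν 0 : ℂ) * (q z * p z) * (-(1 / 2) * (q₁ z / q z ^ 2)) = ν 0 * S := by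
      rw [hS]; ring
    have a2 : M 0 * ((-(1 / 2) * (q₂ z / q z ^ 2) + q₁ z ^ 2 / q z ^ 3) * p z) =
        τ * (Complex.I * (-(1 / 2) * (q₂ z / q z ^ 2) + q₁ z ^ 2 / q z ^ 3)) := by
      linear_combination (-(1 / 2) * (q₂ z / q z ^ 2) + q₁ z ^ 2 / q z ^ 3) * hτ
    rw [a1, a2, Complex.add_re, Complex.re_ofReal_mul, Complex.re_ofReal_mul, f2,
      Complex.I_mul_re] at e3
    refine (mul_eq_zero.mp ?_).resolve_left hτ0
    linear_combination e3
  have hS2 : S ^ 2 = (1 / 4) * (q₁ z ^ 2 / q z ^ 3) := by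
    rw [hS]
    field_simp
    linear_combination 4 * q₁ z ^ 2 * hpqz
  -- Here `S = p'/p`, and the bracket is `p''/p - (p'/p)²/2`. Eliminating `ν 0` from the second and
  -- third relations says precisely that its imaginary part vanishes.
  have f4 : (7 * q₁ z ^ 2 - 4 * q z * q₂ z) / (16 * q z ^ 3) =
      ((1 / 2 : ℝ) : ℂ) * ((-(1 / 2) * (q₂ z / q z ^ 2) + q₁ z ^ 2 / q z ^ 3) -
        ((1 / 2 : ℝ) : ℂ) * S ^ 2) := by
    rw [hS2]
    push_cast
    field_simp
    ring
  rw [f4, Complex.im_ofReal_mul, Complex.sub_im, Complex.im_ofReal_mul, pow_two S, Complex.mul_im]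
  linear_combination -(1 / 2) * f3

end IsZMCData

/-! ### Constancy of the invariant and the absence of isolated umbilics. -/

/-- The invariant of a zero mean curvature surface whose imaginary (real) part vanishes for planar
curvature lines (for affine minimality). -/
def bonnetInv (q q₁ q₂ : ℂ) : ℂ := (7 * q₁ ^ 2 - 4 * q * q₂) / (16 * q ^ 3)

section Umbilics

variable {w q q₁ q₂ q₃ : ℂ → ℂ} {Ω : Set ℂ} {ε : ℂ}

theorem exists_wDeriv_bonnetInv {z : ℂ} (h0 : HasWDerivAt w q (q₁ z) z)
    (h1 : HasWDerivAt w q₁ (q₂ z) z) (h2 : HasWDerivAt w q₂ (q₃ z) z) (hz : q z ≠ 0) :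
    ∃ d, HasWDerivAt w (fun y => bonnetInv (q y) (q₁ y) (q₂ y)) d z :=
  ⟨_, (((h1.pow 2).const_mul 7).sub ((h0.const_mul 4).mul h2)).mul
    (((h0.pow 3).const_mul 16).inv (mul_ne_zero (by norm_num) (pow_ne_zero 3 hz)))⟩

/-- A function with a `w`-derivative is holomorphic in `w`; being real after multiplication by `ε`
on an open set, it is locally constant. -/
theorem wDeriv_bonnetInv_eq_zero (hΩ : IsOpen Ω) (hj : ∀ z ∈ Ω, jac w z ≠ 0)
    (h0 : ∀ z ∈ Ω, HasWDerivAt w q (q₁ z) z)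
    (h1 : ∀ z ∈ Ω, HasWDerivAt w q₁ (q₂ z) z) (h2 : ∀ z ∈ Ω, HasWDerivAt w q₂ (q₃ z) z)
    (hε : ε ≠ 0) (him : ∀ z ∈ Ω, q z ≠ 0 → (ε * bonnetInv (q z) (q₁ z) (q₂ z)).im = 0)
    {z : ℂ} (hz : z ∈ Ω) (hq : q z ≠ 0) :
    HasWDerivAt w (fun y => bonnetInv (q y) (q₁ y) (q₂ y)) 0 z := by
  obtain ⟨d, hd⟩ := exists_wDeriv_bonnetInv (h0 z hz) (h1 z hz) (h2 z hz) hq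
  have hc : ∀ᶠ y in 𝓝 z, q y ≠ 0 := (h0 z hz).differentiableAt.continuousAt.eventually_ne hq
  have := wDeriv_eq_zero_of_im_eq_zero (hj z hz) (hd.const_mul ε)
    (by filter_upwards [hΩ.mem_nhds hz, hc] with y hy hy' using him y hy hy')
  rwa [(mul_eq_zero.mp this).resolve_left hε] at hd

/-- A first integral. -/
theorem wDeriv_first_integral (hΩ : IsOpen Ω) (hj : ∀ z ∈ Ω, jac w z ≠ 0)
    (h0 : ∀ z ∈ Ω, HasWDerivAt w q (q₁ z) z)
    (h1 : ∀ z ∈ Ω, HasWDerivAt w q₁ (q₂ z) z) (h2 : ∀ z ∈ Ω, HasWDerivAt w q₂ (q₃ z) z)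
    (hε : ε ≠ 0) (him : ∀ z ∈ Ω, q z ≠ 0 → (ε * bonnetInv (q z) (q₁ z) (q₂ z)).im = 0)
    {z : ℂ} (hz : z ∈ Ω) (hq : q z ≠ 0) :
    HasWDerivAt w (fun y => (q₁ y ^ 2 - 16 * bonnetInv (q y) (q₁ y) (q₂ y) * q y ^ 3) ^ 2 *
      (q y ^ 7)⁻¹) 0 z := by
  -- In terms of `Φ = q^(-1/4)` and `P = Φ² Φ_w`, the expression is `256 (P² - B Φ²)²`, the squared
  -- energy of `Φ_uu = B Φ`. Squaring removes the fractional powers of `q`.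
  have hQ := wDeriv_bonnetInv_eq_zero hΩ hj h0 h1 h2 hε him hz hq
  have := ((((h1 z hz).pow 2).sub ((hQ.const_mul 16).mul ((h0 z hz).pow 3))).pow 2).mul
    (((h0 z hz).pow 7).inv (pow_ne_zero 7 hq))
  refine this.congr_deriv ?_
  simp only [bonnetInv]
  push_cast
  field_simp
  ring

/-- Since `‖a‖⁷ ≤ C³ ‖a‖⁴`, the relation bounds `‖b‖²` by a multiple of `‖a‖²`. With `a = q` and `b
= q₁` this is the linear differential inequality needed for Grönwall. -/
theorem norm_le_of_first_integral {a b c e : ℂ} {C : ℝ} (hC : ‖a‖ ≤ C)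
    (h : (b ^ 2 - 16 * c * a ^ 3) ^ 2 = e * a ^ 7) :
    ‖b‖ ≤ Real.sqrt (16 * ‖c‖ * C + Real.sqrt (‖e‖ * C ^ 3)) * ‖a‖ := by
  have hC0 : 0 ≤ C := (norm_nonneg a).trans hC
  have h1 : ‖b ^ 2 - 16 * c * a ^ 3‖ ≤ Real.sqrt (‖e‖ * C ^ 3) * ‖a‖ ^ 2 := by
    refine abs_le_of_sq_le_sq' ?_ (by positivity) |>.2
    rw [mul_pow, Real.sq_sqrt (by positivity), ← norm_pow, h, norm_mul, norm_pow]
    calc ‖e‖ * ‖a‖ ^ 7 = ‖e‖ * ‖a‖ ^ 3 * (‖a‖ ^ 2) ^ 2 := by ring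
      _ ≤ ‖e‖ * C ^ 3 * (‖a‖ ^ 2) ^ 2 := by gcongr
  refine abs_le_of_sq_le_sq' ?_ (by positivity) |>.2
  rw [mul_pow, Real.sq_sqrt (by positivity)]
  calc ‖b‖ ^ 2 = ‖16 * c * a ^ 3 + (b ^ 2 - 16 * c * a ^ 3)‖ := by
        rw [← norm_pow]; congr 1; ring
    _ ≤ ‖16 * c * a ^ 3‖ + ‖b ^ 2 - 16 * c * a ^ 3‖ := norm_add_le _ _
    _ ≤ 16 * ‖c‖ * ‖a‖ * ‖a‖ ^ 2 + Real.sqrt (‖e‖ * C ^ 3) * ‖a‖ ^ 2 := by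
        refine add_le_add (le_of_eq ?_) h1
        rw [norm_mul, norm_mul, norm_pow, Complex.norm_ofNat]
        ring
    _ ≤ 16 * ‖c‖ * C * ‖a‖ ^ 2 + Real.sqrt (‖e‖ * C ^ 3) * ‖a‖ ^ 2 := by gcongr
    _ = (16 * ‖c‖ * C + Real.sqrt (‖e‖ * C ^ 3)) * ‖a‖ ^ 2 := by ring

/-- Umbilics are not isolated. -/
theorem eventually_eq_zero_of_umbilic (hΩ : IsOpen Ω) (hw : ContDiffOn ℝ ∞ w Ω)
    (hj : ∀ z ∈ Ω, jac w z ≠ 0)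
    (h0 : ∀ z ∈ Ω, HasWDerivAt w q (q₁ z) z)
    (h1 : ∀ z ∈ Ω, HasWDerivAt w q₁ (q₂ z) z) (h2 : ∀ z ∈ Ω, HasWDerivAt w q₂ (q₃ z) z)
    (hε : ε ≠ 0) (him : ∀ z ∈ Ω, q z ≠ 0 → (ε * bonnetInv (q z) (q₁ z) (q₂ z)).im = 0)
    {z : ℂ} (hz : z ∈ Ω) (hq : q z = 0) : ∀ᶠ y in 𝓝 z, q y = 0 := by
  have hwc : ContinuousAt (fun y => ‖fderiv ℝ w y‖) z :=
    ((hw.fderiv_of_isOpen hΩ (m := ∞) (by simp)).continuousOn.continuousAt (hΩ.mem_nhds hz)).norm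
  have hqc : ContinuousAt (fun y => ‖q y‖) z := (h0 z hz).differentiableAt.continuousAt.norm
  obtain ⟨A, hA⟩ : ∃ A, ‖fderiv ℝ w z‖ < A := exists_gt _
  obtain ⟨ρ, hρ, hball⟩ := Metric.eventually_nhds_iff_ball.mp
    ((Filter.Eventually.and (p := (· ∈ Ω)) (hΩ.mem_nhds hz)
      (hwc.eventually_lt continuousAt_const hA)).and
      (hqc.eventually_lt (continuousAt_const (y := (1 : ℝ))) (by simp [hq])))
  refine Metric.eventually_nhds_iff_ball.mpr ⟨ρ, hρ, fun z₁ hz₁ => ?_⟩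
  by_contra hq₁
  -- The segment runs from the supposed nonumbilic point to the umbilic. Before its first zero of
  -- `q` both first integrals are constant; Grönwall read backwards from that zero would then force
  -- `q z₁ = 0`.
  let γ : ℝ → ℂ := fun s => z₁ + s * (z - z₁)
  have hγd : ∀ s, HasDerivAt γ (z - z₁) s := fun s => by
    have := ((Complex.ofRealCLM.hasDerivAt (x := s)).mul_const (z - z₁)).const_add z₁
    rwa [Complex.ofRealCLM_apply, Complex.ofReal_one, one_mul] at this
  have hγm : ∀ s ∈ Set.Icc (0 : ℝ) 1, γ s ∈ Metric.ball z ρ := by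
    intro s hs
    have := (convex_ball z ρ).add_smul_sub_mem hz₁ (Metric.mem_ball_self hρ) hs
    simpa [γ] using this
  have hγΩ : ∀ s ∈ Set.Icc (0 : ℝ) 1, γ s ∈ Ω := fun s hs => (hball _ (hγm s hs)).1.1
  have hqγ : ∀ s ∈ Set.Icc (0 : ℝ) 1, HasDerivAt (fun s => q (γ s))
      (q₁ (γ s) * fderiv ℝ w (γ s) (z - z₁)) s := fun s hs =>
    (h0 _ (hγΩ s hs)).comp_curve (hγd s) rfl
  have hgc : ContinuousOn (fun s => q (γ s)) (Set.Icc 0 1) := fun s hs =>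
    (hqγ s hs).continuousAt.continuousWithinAt
  -- the first zero on the segment
  let Z : Set ℝ := Set.Icc 0 1 ∩ (fun s => q (γ s)) ⁻¹' {0}
  have hZc : IsClosed Z := hgc.preimage_isClosed_of_isClosed isClosed_Icc isClosed_singleton
  have hZn : Z.Nonempty := ⟨1, ⟨zero_le_one, le_rfl⟩, by simp [γ, hq]⟩
  have hZb : BddBelow Z := ⟨0, fun s hs => hs.1.1⟩
  set b := sInf Z with hb
  have hbZ : b ∈ Z := hZc.csInf_mem hZn hZb
  have hbpos : 0 < b := by
    refine lt_of_le_of_ne hbZ.1.1 fun h => hq₁ ?_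
    have := hbZ.2
    rw [← h] at this
    simpa [γ] using this
  have hlt : ∀ s ∈ Set.Ico 0 b, q (γ s) ≠ 0 := fun s hs h =>
    absurd (csInf_le hZb (show s ∈ Z from ⟨⟨hs.1, hs.2.le.trans hbZ.1.2⟩, h⟩)) (not_le.mpr hs.2)
  have hI : ∀ s ∈ Set.Icc 0 b, s ∈ Set.Icc (0 : ℝ) 1 := fun s hs => ⟨hs.1, hs.2.trans hbZ.1.2⟩
  have hconst : ∀ {F : ℂ → ℂ}, (∀ y ∈ Ω, q y ≠ 0 → HasWDerivAt w F 0 y) →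
      ∀ s ∈ Set.Ico 0 b, F (γ s) = F (γ 0) := by
    intro F hF s hs
    have hd : ∀ t ∈ Set.Icc 0 s, HasDerivAt (fun t => F (γ t)) 0 t := fun t ht => by
      have htb : t ∈ Set.Ico 0 b := ⟨ht.1, ht.2.trans_lt hs.2⟩
      simpa using (hF _ (hγΩ t (hI t ⟨htb.1, htb.2.le⟩)) (hlt t htb)).comp_curve (hγd t) rfl
    exact constant_of_has_deriv_right_zero
      (fun t ht => (hd t ht).continuousAt.continuousWithinAt)
      (fun t ht => (hd t ⟨ht.1, ht.2.le⟩).hasDerivWithinAt) s ⟨hs.1, le_rfl⟩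
  have hQc := hconst fun y hy hy' => wDeriv_bonnetInv_eq_zero hΩ hj h0 h1 h2 hε him hy hy'
  have hEc := hconst fun y hy hy' => wDeriv_first_integral hΩ hj h0 h1 h2 hε him hy hy'
  set c := bonnetInv (q (γ 0)) (q₁ (γ 0)) (q₂ (γ 0))
  set e := (q₁ (γ 0) ^ 2 - 16 * c * q (γ 0) ^ 3) ^ 2 * (q (γ 0) ^ 7)⁻¹
  set K := Real.sqrt (16 * ‖c‖ * 1 + Real.sqrt (‖e‖ * 1 ^ 3))
  have hbound : ∀ s ∈ Set.Ico 0 b, ‖q₁ (γ s)‖ ≤ K * ‖q (γ s)‖ := by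
    intro s hs
    refine norm_le_of_first_integral
      (hball _ (hγm s (hI s ⟨hs.1, hs.2.le⟩))).2.le ?_
    rw [← hQc s hs, ← hEc s hs]
    have := hlt s hs
    field_simp
  have hq₁c : ContinuousOn (fun s => q₁ (γ s)) (Set.Icc 0 b) := fun s hs =>
    ((h1 _ (hγΩ s (hI s hs))).differentiableAt.continuousAt.comp
      (f := γ) (hγd s).continuousAt).continuousWithinAt
  have hqc' : ContinuousOn (fun s => q (γ s)) (Set.Icc 0 b) := hgc.mono hI
  have hbound' : ∀ s ∈ Set.Icc 0 b, ‖q₁ (γ s)‖ ≤ K * ‖q (γ s)‖ := by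
    have hcl : closure (Set.Ico 0 b) = Set.Icc 0 b := closure_Ico hbpos.ne
    rw [← hcl] at hq₁c hqc' ⊢
    intro s hs
    exact le_on_closure hbound hq₁c.norm (continuousOn_const.mul hqc'.norm) hs
  have hrev : ∀ s ∈ Set.Icc 0 b, b - s ∈ Set.Icc 0 b := fun s hs =>
    ⟨by linarith [hs.2], by linarith [hs.1]⟩
  have hf : ∀ s ∈ Set.Icc 0 b, HasDerivAt (fun s => q (γ (b - s)))
      (-(q₁ (γ (b - s)) * fderiv ℝ w (γ (b - s)) (z - z₁))) s := by
    intro s hs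
    have := (hqγ (b - s) (hI _ (hrev s hs))).scomp s ((hasDerivAt_id s).const_sub b)
    exact this.congr_deriv (by simp)
  have := eq_zero_of_abs_deriv_le_mul_abs_self_of_eq_zero_right
    (f := fun s => q (γ (b - s))) (K := K * (A * ‖z - z₁‖)) (a := 0) (b := b)
    (fun s hs => (hf s hs).continuousAt.continuousWithinAt)
    (fun s hs => (hf s ⟨hs.1, hs.2.le⟩).hasDerivWithinAt) (by simpa using hbZ.2)
    (fun s hs => by
      have hs' := hrev s ⟨hs.1, hs.2.le⟩
      rw [norm_neg, norm_mul]
      calc ‖q₁ (γ (b - s))‖ * ‖fderiv ℝ w (γ (b - s)) (z - z₁)‖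
          ≤ (K * ‖q (γ (b - s))‖) * (A * ‖z - z₁‖) := by
            refine mul_le_mul (hbound' _ hs') ?_ (norm_nonneg _) (by positivity)
            exact (fderiv ℝ w (γ (b - s))).le_of_opNorm_le
              (hball _ (hγm _ (hI _ hs'))).1.2.le _
        _ = _ := by ring) b ⟨hbpos.le, le_rfl⟩
  exact hq₁ (by simpa [γ] using this)

/-- Either all points are umbilics, or there are none and the invariant is constant. -/
theorem umbilic_dichotomy (hΩ : IsOpen Ω) (hc : IsPreconnected Ω) (hw : ContDiffOn ℝ ∞ w Ω)
    (hj : ∀ z ∈ Ω, jac w z ≠ 0)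
    (h0 : ∀ z ∈ Ω, HasWDerivAt w q (q₁ z) z)
    (h1 : ∀ z ∈ Ω, HasWDerivAt w q₁ (q₂ z) z) (h2 : ∀ z ∈ Ω, HasWDerivAt w q₂ (q₃ z) z)
    (hε : ε ≠ 0) (him : ∀ z ∈ Ω, q z ≠ 0 → (ε * bonnetInv (q z) (q₁ z) (q₂ z)).im = 0) :
    (∀ z ∈ Ω, q z = 0) ∨
      ((∀ z ∈ Ω, q z ≠ 0) ∧ ∃ c, ∀ z ∈ Ω, bonnetInv (q z) (q₁ z) (q₂ z) = c) := by
  by_cases hall : ∀ z ∈ Ω, q z ≠ 0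
  · exact .inr ⟨hall, eqOn_const_of_wDeriv_zero hΩ hc fun z hz =>
      wDeriv_bonnetInv_eq_zero hΩ hj h0 h1 h2 hε him hz (hall z hz)⟩
  left
  by_contra hne
  push Not at hall hne
  obtain ⟨a, ha, hqa⟩ := hall
  obtain ⟨b, hb, hqb⟩ := hne
  have hA : IsOpen {z | z ∈ Ω ∧ q z = 0} := isOpen_iff_mem_nhds.mpr fun z hz => by
    filter_upwards [hΩ.mem_nhds hz.1,
      eventually_eq_zero_of_umbilic hΩ hw hj h0 h1 h2 hε him hz.1 hz.2] with y hy hy'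
    exact ⟨hy, hy'⟩
  have hB : IsOpen {z | z ∈ Ω ∧ q z ≠ 0} := isOpen_iff_mem_nhds.mpr fun z hz => by
    filter_upwards [hΩ.mem_nhds hz.1,
      (h0 z hz.1).differentiableAt.continuousAt.eventually_ne hz.2] with y hy hy'
    exact ⟨hy, hy'⟩
  obtain ⟨y, -, hy1, hy2⟩ := hc _ _ hA hB
    (fun z hz => (em (q z = 0)).imp (fun h => ⟨hz, h⟩) fun h => ⟨hz, h⟩)
    ⟨a, ha, ha, hqa⟩ ⟨b, hb, hb, hqb⟩
  exact hy2.2 hy1.2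

end Umbilics

/-! ### The model surfaces -/

/-- The primitive of an entire function that vanishes at `0`. -/
def prim (F : ℂ → ℂ) (z : ℂ) : ℂ := ∫ s in (0 : ℝ)..1, z * F (s * z)

theorem hasDerivAt_prim {F : ℂ → ℂ} (hF : Differentiable ℂ F) (z : ℂ) :
    HasDerivAt (prim F) (F z) z := by
  obtain ⟨g, hg⟩ := hF.isExactOn_univ
  have h1 : ∀ y, prim F y = g y - g 0 := by
    intro y
    have hd : ∀ s ∈ Set.uIcc (0 : ℝ) 1, HasDerivAt (fun s : ℝ => g (s * y)) (y * F (s * y)) s := by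
      intro s _
      have h2 : HasDerivAt (fun x : ℂ => g (x * y)) (F (s * y) * y) (s : ℂ) := by
        have := (hg (s * y) trivial).comp (s : ℂ) ((hasDerivAt_id (s : ℂ)).mul_const y)
        exact this.congr_deriv (by simp)
      simpa [mul_comm] using h2.comp_ofReal
    have := intervalIntegral.integral_eq_sub_of_hasDerivAt hd
      (Continuous.intervalIntegrable (by have := hF.continuous; fun_prop) _ _)
    simpa [prim] using this
  have h2 : prim F = fun y => g y - g 0 := funext h1
  rw [h2]
  exact (hg z trivial).sub_const _

/-- Integrating over a fixed interval, with the endpoint scaled into the integrand, gives joint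
continuity in parameter and point. The continuity of the deformations rests on this. -/
theorem continuous_prim {T : Type*} [TopologicalSpace T] {F : T → ℂ → ℂ}
    (hF : Continuous (Function.uncurry F)) :
    Continuous fun p : T × ℂ => prim (F p.1) p.2 := by
  have hF' : Continuous fun x : (T × ℂ) × ℝ => F x.1.1 (x.2 * x.1.2) :=
    hF.comp (by fun_prop : Continuous fun x : (T × ℂ) × ℝ => (x.1.1, (x.2 : ℂ) * x.1.2))
  exact intervalIntegral.continuous_parametric_intervalIntegral_of_continuous'
    (f := fun (p : T × ℂ) (s : ℝ) => p.2 * F p.1 (s * p.2))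
    ((by fun_prop : Continuous fun x : (T × ℂ) × ℝ => x.1.2).mul hF') 0 1

/-- A square root of the real number `c`. -/
def realSqrt (c : ℝ) : ℂ := Real.sqrt c + Real.sqrt (-c) * Complex.I

theorem realSqrt_sq (c : ℝ) : realSqrt c ^ 2 = c := by
  rw [realSqrt]
  rcases le_total 0 c with h | h
  · rw [Real.sqrt_eq_zero_of_nonpos (neg_nonpos.mpr h)]
    simp [← Complex.ofReal_pow, Real.sq_sqrt h]
  · rw [Real.sqrt_eq_zero_of_nonpos h]
    simp [mul_pow, ← Complex.ofReal_pow, Real.sq_sqrt (neg_nonneg.mpr h)]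

/-- `Real.sqrt` is zero on negative numbers, so the two summands take over from one another at `c =
0` without a jump. The models thus pass continuously from hyperbolic to trigonometric functions. -/
theorem continuous_realSqrt : Continuous realSqrt := by
  unfold realSqrt
  fun_prop

theorem realSqrt_ne_zero {c : ℝ} (hc : c ≠ 0) : realSqrt c ≠ 0 := by
  intro h
  have := realSqrt_sq c
  rw [h, zero_pow two_ne_zero] at this
  exact hc (by exact_mod_cast this.symm)

/-- `cosh (√c z)`, the solution of `f'' = c f` with `f 0 = 1`, `f' 0 = 0`. -/
def solC (c : ℝ) (z : ℂ) : ℂ := Complex.cosh (realSqrt c * z)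

/-- `sinh (√c z) / √c`, the solution of `f'' = c f` with `f 0 = 0`, `f' 0 = 1`. -/
def solS (c : ℝ) : ℂ → ℂ := prim (solC c)

theorem hasDerivAt_solC_aux (c : ℝ) (z : ℂ) :
    HasDerivAt (solC c) (realSqrt c * Complex.sinh (realSqrt c * z)) z := by
  have := ((hasDerivAt_id z).const_mul (realSqrt c)).ccosh
  exact this.congr_deriv (by simp [mul_comm])

theorem hasDerivAt_solS (c : ℝ) (z : ℂ) : HasDerivAt (solS c) (solC c z) z :=
  hasDerivAt_prim (fun z => (hasDerivAt_solC_aux c z).differentiableAt) z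

@[simp] theorem prim_zero (F : ℂ → ℂ) : prim F 0 = 0 := by simp [prim]

@[simp] theorem solS_zero (c : ℝ) : solS c 0 = 0 := prim_zero _

@[simp] theorem solC_zero (c : ℝ) : solC c 0 = 1 := by simp [solC]

/-- Taking `solS` to be a primitive avoids dividing by the square root; this product form remains
valid at `c = 0`. -/
theorem sinh_eq (c : ℝ) (z : ℂ) : Complex.sinh (realSqrt c * z) = realSqrt c * solS c z := by
  have h : ∀ z, HasDerivAt
      (fun z => Complex.sinh (realSqrt c * z) - realSqrt c * solS c z) 0 z := by
    intro z
    have := (((hasDerivAt_id z).const_mul (realSqrt c)).csinh).sub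
      ((hasDerivAt_solS c z).const_mul (realSqrt c))
    exact this.congr_deriv (by simp [solC, mul_comm])
  have := is_const_of_deriv_eq_zero (fun z => (h z).differentiableAt) (fun z => (h z).deriv) z 0
  simpa [sub_eq_zero] using this

theorem hasDerivAt_solC (c : ℝ) (z : ℂ) : HasDerivAt (solC c) (c * solS c z) z := by
  refine (hasDerivAt_solC_aux c z).congr_deriv ?_
  rw [sinh_eq, ← realSqrt_sq]
  ring

theorem solC_sq_sub (c : ℝ) (z : ℂ) : solC c z ^ 2 - c * solS c z ^ 2 = 1 := by
  rw [← realSqrt_sq, ← mul_pow, ← sinh_eq, solC, Complex.cosh_sq_sub_sinh_sq]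

theorem exp_eq (c : ℝ) (z : ℂ) :
    Complex.exp (realSqrt c * z) = solC c z + realSqrt c * solS c z := by
  rw [← sinh_eq, solC, Complex.cosh_add_sinh]

theorem solC_const_zero (z : ℂ) : solC 0 z = 1 := by simp [solC, realSqrt]

theorem solS_const_zero (z : ℂ) : solS 0 z = z := by
  have h : ∀ z, HasDerivAt (fun z => solS 0 z - z) 0 z := fun z =>
    ((hasDerivAt_solS 0 z).sub (hasDerivAt_id z)).congr_deriv (by simp [solC_const_zero])
  have := is_const_of_deriv_eq_zero (fun z => (h z).differentiableAt) (fun z => (h z).deriv) z 0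
  simpa [sub_eq_zero] using this

/-- The square root of the coefficient `η` of the Weierstrass data: the solution of `f'' = c f` with
`f 0 = 1`, `f' 0 = β`. -/
def phi (c : ℝ) (β z : ℂ) : ℂ := solC c z + β * solS c z

def phi' (c : ℝ) (β z : ℂ) : ℂ := c * solS c z + β * solC c z

theorem hasDerivAt_phi (c : ℝ) (β z : ℂ) : HasDerivAt (phi c β) (phi' c β z) z :=
  (hasDerivAt_solC c z).add ((hasDerivAt_solS c z).const_mul β)

theorem hasDerivAt_phi' (c : ℝ) (β z : ℂ) : HasDerivAt (phi' c β) (c * phi c β z) z := by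
  refine (((hasDerivAt_solS c z).const_mul (c : ℂ)).add
    ((hasDerivAt_solC c z).const_mul β)).congr_deriv ?_
  simp only [phi]
  ring

@[simp] theorem phi_zero (c : ℝ) (β : ℂ) : phi c β 0 = 1 := by simp [phi]

/-- Both functions solve `f'' = c f`, so their Wronskian is constant. Consequently `(S/φ)' = φ⁻²`,
which gives the models their simple coefficient `q = κ / (ε φ⁴)`. -/
theorem wronskian_phi (c : ℝ) (β z : ℂ) :
    phi c β z * solC c z - phi' c β z * solS c z = 1 := by
  rw [← solC_sq_sub c z, phi, phi']
  ring

/-- Conservation of energy for `f'' = c f`. Comparison of this value with the energy of a given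
surface selects its normal form. -/
theorem phi'_sq_sub (c : ℝ) (β z : ℂ) : phi' c β z ^ 2 - c * phi c β z ^ 2 = β ^ 2 - c := by
  simp only [phi, phi']
  linear_combination (β ^ 2 - c) * solC_sq_sub c z

theorem differentiable_phi (c : ℝ) (β : ℂ) : Differentiable ℂ (phi c β) := fun z =>
  (hasDerivAt_phi c β z).differentiableAt

theorem differentiable_solS (c : ℝ) : Differentiable ℂ (solS c) := fun z =>
  (hasDerivAt_solS c z).differentiableAt

theorem continuous_solC : Continuous fun p : ℝ × ℂ => solC p.1 p.2 := by
  unfold solC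
  have := continuous_realSqrt
  fun_prop

theorem continuous_solS : Continuous fun p : ℝ × ℂ => solS p.1 p.2 := continuous_prim continuous_solC

/-- The horizontal coordinate of the model surface. -/
def horizPrim (c : ℝ) (β : ℂ) : ℂ → ℂ := prim fun z => phi c β z ^ 2

/-- The complexified height of the model surface. -/
def heightPrim (κ c : ℝ) (β : ℂ) : ℂ → ℂ := prim fun z => phi c β z * (κ * solS c z)

theorem hasDerivAt_horizPrim (c : ℝ) (β z : ℂ) :
    HasDerivAt (horizPrim c β) (phi c β z ^ 2) z :=
  hasDerivAt_prim ((differentiable_phi c β).pow 2) z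

theorem hasDerivAt_heightPrim (κ c : ℝ) (β z : ℂ) :
    HasDerivAt (heightPrim κ c β) (phi c β z * (κ * solS c z)) z :=
  hasDerivAt_prim ((differentiable_phi c β).mul ((differentiable_solS c).const_mul _)) z

/-- The surface with Weierstrass data `h = κ S / φ`, `η = ε φ²`. -/
def modelSurf (ε : ℂ) (κ c : ℝ) (β z : ℂ) : Fin 3 → ℝ :=
  ![(ε * heightPrim κ c β z).re, (ε * horizPrim c β z).re, (ε * horizPrim c β z).im]

theorem continuous_modelSurf (ε : ℂ) {κ c : ℝ → ℝ} {β : ℝ → ℂ} (hκ : Continuous κ)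
    (hc : Continuous c) (hβ : Continuous β) :
    Continuous fun p : ℝ × ℂ => modelSurf ε (κ p.1) (c p.1) (β p.1) p.2 := by
  have h1 : Continuous fun p : ℝ × ℂ => solC (c p.1) p.2 :=
    continuous_solC.comp (by fun_prop : Continuous fun p : ℝ × ℂ => (c p.1, p.2))
  have h2 : Continuous fun p : ℝ × ℂ => solS (c p.1) p.2 :=
    continuous_solS.comp (by fun_prop : Continuous fun p : ℝ × ℂ => (c p.1, p.2))
  have h3 : Continuous fun p : ℝ × ℂ => phi (c p.1) (β p.1) p.2 := by
    unfold phi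
    fun_prop
  have h4 : Continuous fun p : ℝ × ℂ => horizPrim (c p.1) (β p.1) p.2 :=
    continuous_prim (F := fun t z => phi (c t) (β t) z ^ 2) (h3.pow 2)
  have h5 : Continuous fun p : ℝ × ℂ => heightPrim (κ p.1) (c p.1) (β p.1) p.2 :=
    continuous_prim (F := fun t z => phi (c t) (β t) z * (κ t * solS (c t) z))
      (h3.mul ((by fun_prop : Continuous fun p : ℝ × ℂ => (κ p.1 : ℂ)).mul h2))
  refine continuous_pi fun i => ?_
  fin_cases i
  · exact Complex.continuous_re.comp (continuous_const.mul h5)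
  · exact Complex.continuous_re.comp (continuous_const.mul h4)
  · exact Complex.continuous_im.comp (continuous_const.mul h4)

theorem contDiff_of_hasDerivAt {F F' : ℂ → ℂ} (h : ∀ z, HasDerivAt F (F' z) z) :
    ContDiff ℝ ∞ F :=
  (Differentiable.contDiff (n := ∞) fun z => (h z).differentiableAt).restrict_scalars ℝ

theorem contDiff_modelSurf (ε : ℂ) (κ c : ℝ) (β : ℂ) : ContDiff ℝ ∞ (modelSurf ε κ c β) := by
  have h1 : ContDiff ℝ ∞ fun z => ε * heightPrim κ c β z :=
    contDiff_const.mul (contDiff_of_hasDerivAt (hasDerivAt_heightPrim κ c β))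
  have h2 : ContDiff ℝ ∞ fun z => ε * horizPrim c β z :=
    contDiff_const.mul (contDiff_of_hasDerivAt (hasDerivAt_horizPrim c β))
  refine contDiff_pi.mpr fun i => ?_
  fin_cases i
  · exact Complex.reCLM.contDiff.comp h1
  · exact Complex.reCLM.contDiff.comp h2
  · exact Complex.imCLM.contDiff.comp h2

theorem dirD_modelSurf (ε : ℂ) (κ c : ℝ) (β z a : ℂ) : dirD a (modelSurf ε κ c β) z =
    ![(ε * (phi c β z * (κ * solS c z)) * a).re, (ε * phi c β z ^ 2 * a).re,
      (ε * phi c β z ^ 2 * a).im] := by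
  have hd : DifferentiableAt ℝ (modelSurf ε κ c β) z :=
    (contDiff_modelSurf ε κ c β).contDiffAt.differentiableAt (by simp)
  have h1 := ((hasDerivAt_heightPrim κ c β z).const_mul ε).hasFDerivAt.restrictScalars ℝ
  have h2 := ((hasDerivAt_horizPrim c β z).const_mul ε).hasFDerivAt.restrictScalars ℝ
  ext i
  rw [dirD_apply hd]
  fin_cases i
  · have h : HasFDerivAt (fun y => (ε * heightPrim κ c β y).re) _ z :=
      Complex.reCLM.hasFDerivAt.comp z h1
    change fderiv ℝ (fun y => (ε * heightPrim κ c β y).re) z a = _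
    rw [h.fderiv]
    simp [mul_comm]
  · have h : HasFDerivAt (fun y => (ε * horizPrim c β y).re) _ z :=
      Complex.reCLM.hasFDerivAt.comp z h2
    change fderiv ℝ (fun y => (ε * horizPrim c β y).re) z a = _
    rw [h.fderiv]
    simp [mul_comm]
  · have h : HasFDerivAt (fun y => (ε * horizPrim c β y).im) _ z :=
      Complex.imCLM.hasFDerivAt.comp z h2
    change fderiv ℝ (fun y => (ε * horizPrim c β y).im) z a = _
    rw [h.fderiv]
    simp [mul_comm]

theorem fderiv_horiz_modelSurf (ε : ℂ) (κ c : ℝ) (β z a : ℂ) :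
    fderiv ℝ (horiz (modelSurf ε κ c β)) z a = ε * phi c β z ^ 2 * a := by
  rw [fderiv_horiz ((contDiff_modelSurf ε κ c β).contDiffAt.differentiableAt (by simp)),
    dirD_modelSurf]
  apply Complex.ext <;> simp

theorem jac_horiz_modelSurf (ε : ℂ) (κ c : ℝ) (β z : ℂ) :
    jac (horiz (modelSurf ε κ c β)) z = ‖ε * phi c β z ^ 2‖ ^ 2 := by
  rw [jac, fderiv_horiz_modelSurf, fderiv_horiz_modelSurf, Complex.sq_norm, Complex.normSq_apply]
  simp only [mul_one, Complex.mul_im, Complex.mul_re, Complex.conj_re, Complex.conj_im,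
    Complex.I_re, Complex.I_im]
  ring

theorem regularSet_modelSurf {ε : ℂ} (hε : ε ≠ 0) (κ c : ℝ) (β : ℂ) :
    regularSet (modelSurf ε κ c β) = {z | phi c β z ≠ 0} := by
  ext z
  rw [regularSet, Set.mem_ofPred_eq,
    isSpacelikeAt_iff ((contDiff_modelSurf ε κ c β).contDiffAt.differentiableAt (by simp)),
    jac_horiz_modelSurf]
  simp [hε]

theorem isOpen_phi_ne (c : ℝ) (β : ℂ) : IsOpen {z | phi c β z ≠ 0} :=
  isOpen_ne_fun (differentiable_phi c β).continuous continuous_const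

theorem phi_ne_mem_codiscrete (c : ℝ) (β : ℂ) :
    {z | phi c β z ≠ 0} ∈ Filter.codiscrete ℂ := by
  have : AnalyticOnNhd ℂ (phi c β) Set.univ := fun z _ =>
    (differentiable_phi c β).analyticAt z
  exact this.preimage_zero_mem_codiscrete (x := 0) (by simp)

theorem finite_singular_modelSurf {ε : ℂ} (hε : ε ≠ 0) (κ c : ℝ) (β : ℂ) {K : Set ℂ}
    (hK : IsCompact K) : (K \ regularSet (modelSurf ε κ c β)).Finite := by
  rw [regularSet_modelSurf hε]
  have h := mem_codiscrete'.mp (phi_ne_mem_codiscrete c β)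
  rw [Set.sdiff_eq]
  exact (hK.inter_right h.1.isClosed_compl).finite (h.2.mono Set.inter_subset_right)

theorem hasWeierstrassData_modelSurf (ε : ℂ) (κ c : ℝ) (β : ℂ) :
    HasWeierstrassData (modelSurf ε κ c β) (fun z => κ * solS c z / phi c β z)
      (fun z => ε * phi c β z ^ 2) where
  meromorphic z _ :=
    (((differentiable_solS c).const_mul (κ : ℂ)).analyticAt z).meromorphicAt.div
      ((differentiable_phi c β).analyticAt z).meromorphicAt
  holomorphic := ((differentiable_phi c β).pow 2).const_mul ε
  holomorphic_sq := by
    refine ⟨fun z => ε * (κ * solS c z) ^ 2,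
      (((differentiable_solS c).const_mul (κ : ℂ)).pow 2).const_mul ε, ?_⟩
    filter_upwards [phi_ne_mem_codiscrete c β] with z hz
    have : phi c β z ≠ 0 := hz
    field_simp
  differentiable := (contDiff_modelSurf ε κ c β).differentiable (by simp)
  deriv_eq z a := by
    change dirD a _ z = _
    rw [dirD_modelSurf]
    have e1 : κ * solS c z / phi c β z * (ε * phi c β z ^ 2) * a =
        ε * (phi c β z * (κ * solS c z)) * a := by
      by_cases h : phi c β z = 0
      · simp [h]
      · field_simp
    have e2 : ∀ x : ℂ, (-Complex.I * x * a).re = (x * a).im := by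
      intro x
      simp
    rw [e1, e2]

theorem hasWDerivAt_of_hasDerivAt {w F : ℂ → ℂ} {w' F' z : ℂ}
    (hw : ∀ a, fderiv ℝ w z a = w' * a) (h0 : w' ≠ 0) (hF : HasDerivAt F F' z) :
    HasWDerivAt w F (F' / w') z := by
  refine (hF.hasFDerivAt.restrictScalars ℝ).congr_fderiv ?_
  ext a
  simp [hw]
  field_simp

/-- Since `dw = ε φ² dz`, each `w`-derivative is a `z`-derivative divided by `ε φ²`; the Wronskian
simplifies the first and `φ'' = c φ` the third. -/
theorem isZMCData_modelSurf {ε : ℂ} (hε : ε ≠ 0) (κ c : ℝ) (β : ℂ) :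
    IsZMCData (modelSurf ε κ c β) {z | phi c β z ≠ 0} (fun z => κ * solS c z / phi c β z)
      (fun z => κ / ε * (phi c β z ^ 4)⁻¹)
      (fun z => -4 * κ / ε ^ 2 * phi' c β z * (phi c β z ^ 7)⁻¹)
      (fun z => κ / ε ^ 3 * (28 * phi' c β z ^ 2 * (phi c β z ^ 10)⁻¹ -
        4 * c * (phi c β z ^ 8)⁻¹)) where
  smooth := (contDiff_modelSurf ε κ c β).contDiffOn
  jac_ne z hz := by
    have hz : phi c β z ≠ 0 := hz
    rw [jac_horiz_modelSurf]
    exact pow_ne_zero 2 (norm_ne_zero_iff.mpr (mul_ne_zero hε (pow_ne_zero 2 hz)))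
  height z hz a := by
    have hz : phi c β z ≠ 0 := hz
    rw [dirD_modelSurf, fderiv_horiz_modelSurf]
    simp only [Matrix.cons_val]
    congr 1
    field_simp
  smooth_q := contDiffOn_const.mul
    (((contDiff_of_hasDerivAt (hasDerivAt_phi c β)).contDiffOn.pow 4).inv fun z hz =>
      pow_ne_zero 4 hz)
  smooth_q₁ := (contDiffOn_const.mul
    (contDiff_of_hasDerivAt (hasDerivAt_phi' c β)).contDiffOn).mul
    (((contDiff_of_hasDerivAt (hasDerivAt_phi c β)).contDiffOn.pow 7).inv fun z hz =>
      pow_ne_zero 7 hz)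
  dG z hz := by
    have hz : phi c β z ≠ 0 := hz
    have h := ((hasDerivAt_solS c z).const_mul (κ : ℂ)).div (hasDerivAt_phi c β z) hz
    refine (hasWDerivAt_of_hasDerivAt (fderiv_horiz_modelSurf ε κ c β z) (by positivity)
      h).congr_deriv ?_
    field_simp
    linear_combination (κ : ℂ) * wronskian_phi c β z
  dq z hz := by
    have hz : phi c β z ≠ 0 := hz
    have h := (((hasDerivAt_phi c β z).pow 4).inv (pow_ne_zero 4 hz)).const_mul (κ / ε : ℂ)
    refine (hasWDerivAt_of_hasDerivAt (fderiv_horiz_modelSurf ε κ c β z) (by positivity)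
      h).congr_deriv ?_
    simp only [Pi.pow_apply]
    push_cast
    field_simp
  dq₁ z hz := by
    have hz : phi c β z ≠ 0 := hz
    have h := ((hasDerivAt_phi' c β z).const_mul (-4 * κ / ε ^ 2 : ℂ)).mul
      (((hasDerivAt_phi c β z).pow 7).inv (pow_ne_zero 7 hz))
    refine (hasWDerivAt_of_hasDerivAt (fderiv_horiz_modelSurf ε κ c β z) (by positivity)
      h).congr_deriv ?_
    simp only [Pi.pow_apply, Pi.inv_apply]
    push_cast
    field_simp
    ring

/-- The terms in `φ'` cancel. The value is real for `ε = 1` and imaginary for `ε = i`, which is why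
conjugation exchanges the two classes. -/
theorem bonnetInv_modelSurf {ε : ℂ} (hε : ε ≠ 0) {κ c : ℝ} (hκ : κ ≠ 0) {β z : ℂ}
    (hz : phi c β z ≠ 0) :
    bonnetInv (κ / ε * (phi c β z ^ 4)⁻¹)
      (-4 * κ / ε ^ 2 * phi' c β z * (phi c β z ^ 7)⁻¹)
      (κ / ε ^ 3 * (28 * phi' c β z ^ 2 * (phi c β z ^ 10)⁻¹ - 4 * c * (phi c β z ^ 8)⁻¹)) =
      c / (κ * ε) := by
  have : (κ : ℂ) ≠ 0 := by exact_mod_cast hκ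
  rw [bonnetInv]
  field_simp
  ring

/-! ### The model surfaces belong to the two classes, and which of them are planes. -/

theorem LiesInPlane.mono {S T : Set (Fin 3 → ℝ)} (h : LiesInPlane T) (hST : S ⊆ T) :
    LiesInPlane S := by
  obtain ⟨ν, hν, c, hc⟩ := h
  exact ⟨ν, hν, c, fun P hP => hc P (hST hP)⟩

theorem heightPrim_zero (c : ℝ) (β z : ℂ) : heightPrim 0 c β z = 0 := by
  simp [heightPrim, prim]

/-- A plane equation differentiates to the vanishing of `φ (ν₀ κ S + (ν₁ - i ν₂) φ)`. Its value at
`0` eliminates `ν₁` and `ν₂`, and its derivative there gives `ν₀ κ = 0`. -/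
theorem liesInPlane_modelSurf_iff {ε : ℂ} (hε : ε ≠ 0) (κ c : ℝ) (β : ℂ) :
    LiesInPlane (Set.range (modelSurf ε κ c β)) ↔ κ = 0 := by
  constructor
  · rintro ⟨ν, hν, d, hd⟩
    by_contra hκ
    let f : ℂ → ℂ := fun z => ε * (phi c β z *
      (ν 0 * (κ * solS c z) + (ν 1 - ν 2 * Complex.I) * phi c β z))
    have h0 : ∀ z a, (f z * a).re = 0 := by
      intro z a
      have hdX : DifferentiableAt ℝ (modelSurf ε κ c β) z :=
        (contDiff_modelSurf ε κ c β).contDiffAt.differentiableAt (by simp)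
      have hXi := hasFDerivAt_pi'.mp hdX.hasFDerivAt
      have h1 : HasFDerivAt (fun z => ν 0 * modelSurf ε κ c β z 0 + ν 1 * modelSurf ε κ c β z 1 +
          ν 2 * modelSurf ε κ c β z 2) _ z :=
        (((hXi 0).const_mul _).add ((hXi 1).const_mul _)).add ((hXi 2).const_mul _)
      have h2 : HasFDerivAt (fun z => ν 0 * modelSurf ε κ c β z 0 + ν 1 * modelSurf ε κ c β z 1 +
          ν 2 * modelSurf ε κ c β z 2) (0 : ℂ →L[ℝ] ℝ) z := by
        refine (hasFDerivAt_const d z).congr_of_eventuallyEq (.of_forall fun y => ?_)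
        rw [← hd _ ⟨y, rfl⟩, dotProduct, Fin.sum_univ_three]
      have h3 := congrArg (fun g : ℂ →L[ℝ] ℝ => g a) (h1.unique h2)
      have h4 : ν 0 * dirD a (modelSurf ε κ c β) z 0 + ν 1 * dirD a (modelSurf ε κ c β) z 1 +
          ν 2 * dirD a (modelSurf ε κ c β) z 2 = 0 := h3
      rw [dirD_modelSurf] at h4
      simp only [Matrix.cons_val] at h4
      rw [← h4]
      have : f z * a = ν 0 * (ε * (phi c β z * (κ * solS c z)) * a) +
          (ν 1 - ν 2 * Complex.I) * (ε * phi c β z ^ 2 * a) := by simp only [f]; ring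
      rw [this]
      generalize ε * (phi c β z * (κ * solS c z)) * a = x
      generalize ε * phi c β z ^ 2 * a = y
      simp
      ring
    have hf : ∀ z, phi c β z *
        (ν 0 * (κ * solS c z) + (ν 1 - ν 2 * Complex.I) * phi c β z) = 0 := by
      intro z
      have h1 := h0 z 1
      have h2 := h0 z Complex.I
      have : f z = 0 := Complex.ext (by simpa using h1) (by simpa using h2)
      exact (mul_eq_zero.mp this).resolve_left hε
    have hμ : (ν 1 - ν 2 * Complex.I : ℂ) = 0 := by simpa using hf 0
    have hf' : ∀ z, phi c β z * (ν 0 * (κ * solS c z)) = 0 := fun z => by simpa [hμ] using hf z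
    have hder := (hasDerivAt_phi c β 0).mul
      (((hasDerivAt_solS c 0).const_mul (κ : ℂ)).const_mul (ν 0 : ℂ))
    have hder0 : HasDerivAt (phi c β * fun z => (ν 0 : ℂ) * (κ * solS c z)) 0 0 :=
      (hasDerivAt_const (0 : ℂ) (0 : ℂ)).congr_of_eventuallyEq (.of_forall hf')
    have h5 := hder.unique hder0
    simp [hκ] at h5
    have r1 := congrArg Complex.re hμ
    have r2 := congrArg Complex.im hμ
    simp at r1 r2
    apply hν
    ext i
    fin_cases i
    · exact h5
    · exact r1
    · exact r2
  · rintro rfl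
    refine ⟨![1, 0, 0], fun h => by simpa using congrFun h 0, 0, ?_⟩
    rintro P ⟨z, rfl⟩
    simp [modelSurf, heightPrim_zero, dotProduct, Fin.sum_univ_three]

theorem isZMCOn_modelSurf {ε : ℂ} (hε : ε ≠ 0) (κ c : ℝ) (β : ℂ) :
    IsZMCOn (modelSurf ε κ c β) (regularSet (modelSurf ε κ c β)) := by
  rw [regularSet_modelSurf hε]
  exact (isZMCData_modelSurf hε κ c β).isZMCOn (isOpen_phi_ne c β)

/-- The model surfaces with `ε = i` are affine minimal. -/
theorem isZMCAffineMinimal_modelSurf (κ c : ℝ) (β : ℂ) :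
    IsZMCAffineMinimal (modelSurf Complex.I κ c β) (regularSet (modelSurf Complex.I κ c β)) := by
  refine ⟨isZMCOn_modelSurf Complex.I_ne_zero κ c β, ?_⟩
  rw [regularSet_modelSurf Complex.I_ne_zero]
  intro z hz hdisc
  have hdat := isZMCData_modelSurf Complex.I_ne_zero κ c β
  have hΩ := isOpen_phi_ne c β
  have hq := (hdat.affineDisc_ne_zero_iff hΩ hz).mp hdisc
  rw [hdat.exists_isAffineShape_iff hΩ hz hq, ← bonnetInv]
  have hκ : κ ≠ 0 := by rintro rfl; simp at hq
  rw [bonnetInv_modelSurf Complex.I_ne_zero hκ hz]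
  have : (c : ℂ) / (κ * Complex.I) = ((c / κ : ℝ) : ℂ) * (-Complex.I) := by
    have : (κ : ℂ) ≠ 0 := by exact_mod_cast hκ
    push_cast
    field_simp
    simp
  rw [this, Complex.re_ofReal_mul]
  simp

theorem eqOn_const_of_hasDerivAt_zero {V : Type*} [NormedAddCommGroup V] [NormedSpace ℝ V]
    {f : ℝ → V} {a b : ℝ} (hf : ∀ s ∈ Set.Ioo a b, HasDerivAt f 0 s) {s t : ℝ}
    (hs : s ∈ Set.Ioo a b) (ht : t ∈ Set.Ioo a b) : f s = f t :=
  isOpen_Ioo.is_const_of_deriv_eq_zero isPreconnected_Ioo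
    (fun x hx => (hf x hx).differentiableAt.differentiableWithinAt)
    (fun x hx => (hf x hx).deriv) hs ht

/-- Curves in a coordinate direction are mapped to planar curves by the model surfaces with
`ε = 1`. -/
theorem liesInPlane_of_coordinate_curve {κ c : ℝ} (hκ : κ ≠ 0) {β δ : ℂ}
    (hδ : starRingEnd ℂ δ = δ ^ 3) (hδ4 : δ ^ 4 = 1) {γ : ℝ → ℂ} {g : ℝ → ℝ} {s₀ s₁ : ℝ}
    (hγ : ∀ s ∈ Set.Ioo s₀ s₁, HasDerivAt γ (g s * δ) s)
    (h0 : ∀ s ∈ Set.Ioo s₀ s₁, phi c β (γ s) ≠ 0) :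
    LiesInPlane ((fun s => modelSurf 1 κ c β (γ s)) '' Set.Ioo s₀ s₁) := by
  rcases Set.eq_empty_or_nonempty (Set.Ioo s₀ s₁) with he | ⟨b, hb⟩
  · rw [he, Set.image_empty]
    exact ⟨![1, 0, 0], fun h => by simpa using congrFun h 0, 0, by simp⟩
  have hκ' : (κ : ℂ) ≠ 0 := by exact_mod_cast hκ
  have dcomp : ∀ {F F' : ℂ → ℂ}, (∀ z, HasDerivAt F (F' z) z) → ∀ s ∈ Set.Ioo s₀ s₁,
      HasDerivAt (fun s => F (γ s)) (F' (γ s) * (g s * δ)) s := by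
    intro F F' hF s hs
    have := (hF (γ s)).hasFDerivAt.restrictScalars ℝ |>.comp_hasDerivAt s (hγ s hs)
    exact this.congr_deriv (by simp [mul_comm])
  have dconj : ∀ {f : ℝ → ℂ} {f' : ℂ} {s : ℝ}, HasDerivAt f f' s →
      HasDerivAt (fun s => starRingEnd ℂ (f s)) (starRingEnd ℂ f') s := fun {f f' s} h =>
    (Complex.conjCLE : ℂ →L[ℝ] ℂ).hasFDerivAt.comp_hasDerivAt s h
  have d1 := dcomp (hasDerivAt_phi c β)
  have d2 := dcomp (hasDerivAt_phi' c β)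
  have d3 := dcomp (hasDerivAt_solS c)
  -- `δ` is `1` or `i` up to sign. Because `c` is real and `δ⁴ = 1`, `conj φ` along such a line
  -- solves the same linear equation as `φ`. `N` is a multiple of their Wronskian, hence constant,
  -- and it is real.
  let N : ℝ → ℂ := fun s => Complex.I / κ *
    (δ * (phi c β (γ s) * starRingEnd ℂ (phi' c β (γ s))) -
      δ ^ 3 * (phi' c β (γ s) * starRingEnd ℂ (phi c β (γ s))))
  have dN : ∀ s ∈ Set.Ioo s₀ s₁, HasDerivAt N 0 s := by
    intro s hs
    have := ((((d1 s hs).mul (dconj (d2 s hs))).const_mul δ).sub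
      (((d2 s hs).mul (dconj (d1 s hs))).const_mul (δ ^ 3))).const_mul (Complex.I / κ)
    refine this.congr_deriv ?_
    simp only [map_mul, Complex.conj_ofReal, hδ]
    linear_combination -(Complex.I / κ * g s * (phi' c β (γ s) *
      starRingEnd ℂ (phi' c β (γ s))) * δ ^ 2) * hδ4
  have hN : ∀ s ∈ Set.Ioo s₀ s₁, N s = N b := fun s hs => eqOn_const_of_hasDerivAt_zero dN hs hb
  have hNre : ((N b).re : ℂ) = N b := by
    rw [← Complex.conj_eq_iff_re]
    simp only [N, map_mul, map_sub, map_div₀, map_pow, Complex.conj_I, Complex.conj_ofReal,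
      Complex.conj_conj, hδ]
    linear_combination (Complex.I / κ * δ * starRingEnd ℂ (phi' c β (γ b)) * phi c β (γ b)) *
      (δ ^ 4 + 1) * hδ4
  -- Along the line `i δ³ conj φ` is a combination of `κ S` and `φ` with constant coefficients `N`
  -- and `M`. These are the normal `(N, Re M, -Im M)` of the plane.
  let M : ℝ → ℂ := fun s => (Complex.I * δ ^ 3 * starRingEnd ℂ (phi c β (γ s)) -
    N b * (κ * solS c (γ s))) * (phi c β (γ s))⁻¹
  have dM : ∀ s ∈ Set.Ioo s₀ s₁, HasDerivAt M 0 s := by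
    intro s hs
    have h1 := h0 s hs
    have := (((dconj (d1 s hs)).const_mul (Complex.I * δ ^ 3)).sub
      (((d3 s hs).const_mul (κ : ℂ)).const_mul (N b))).mul ((d1 s hs).inv h1)
    refine this.congr_deriv ?_
    have hNs : N b * κ = Complex.I *
      (δ * (phi c β (γ s) * starRingEnd ℂ (phi' c β (γ s))) -
      δ ^ 3 * (phi' c β (γ s) * starRingEnd ℂ (phi c β (γ s)))) := by
      rw [← hN s hs]
      simp only [N]
      field_simp
    have hW := wronskian_phi c β (γ s)
    have key : (Complex.I * δ ^ 6 * starRingEnd ℂ (phi' c β (γ s)) -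
        N b * κ * solC c (γ s) * δ) * phi c β (γ s) -
        (Complex.I * δ ^ 3 * starRingEnd ℂ (phi c β (γ s)) - N b * κ * solS c (γ s)) *
        (phi' c β (γ s) * δ) = 0 := by
      linear_combination -(N b * κ * δ) * hW - δ * hNs +
        Complex.I * phi c β (γ s) * starRingEnd ℂ (phi' c β (γ s)) * δ ^ 2 * hδ4
    simp only [map_mul, Complex.conj_ofReal, hδ, Pi.sub_apply, Pi.inv_apply]
    generalize starRingEnd ℂ (phi c β (γ s)) = x at *
    generalize starRingEnd ℂ (phi' c β (γ s)) = y at *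
    generalize N b = n at *
    field_simp
    linear_combination (g s : ℂ) * key
  have hM : ∀ s ∈ Set.Ioo s₀ s₁, M s = M b := fun s hs => eqOn_const_of_hasDerivAt_zero dM hs hb
  have hδ0 : δ ≠ 0 := by rintro rfl; norm_num at hδ4
  refine ⟨![(N b).re, (M b).re, -(M b).im], fun hz => ?_,
    ![(N b).re, (M b).re, -(M b).im] ⬝ᵥ modelSurf 1 κ c β (γ b), ?_⟩
  · have e0 : (N b).re = 0 := congrFun hz 0
    have e1 : (M b).re = 0 := congrFun hz 1
    have e2 : -(M b).im = 0 := congrFun hz 2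
    have hMb : M b = 0 := Complex.ext e1 (by simpa using e2)
    have hNb : N b = 0 := by rw [← hNre, e0, Complex.ofReal_zero]
    simp [M, hNb, hδ0, h0 b hb] at hMb
  · have hd : ∀ s ∈ Set.Ioo s₀ s₁, HasDerivAt
        (fun s => ![(N b).re, (M b).re, -(M b).im] ⬝ᵥ modelSurf 1 κ c β (γ s)) 0 s := by
      intro s hs
      have hdX : DifferentiableAt ℝ (modelSurf 1 κ c β) (γ s) :=
        (contDiff_modelSurf 1 κ c β).contDiffAt.differentiableAt (by simp)
      have hX : HasDerivAt (fun s => modelSurf 1 κ c β (γ s))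
          (dirD (g s * δ) (modelSurf 1 κ c β) (γ s)) s :=
        hdX.hasFDerivAt.comp_hasDerivAt s (hγ s hs)
      have hXi := hasDerivAt_pi.mp hX
      have h1 := (((hXi 0).const_mul (N b).re).add ((hXi 1).const_mul (M b).re)).add
        ((hXi 2).const_mul (-(M b).im))
      have h2 : (fun s => ![(N b).re, (M b).re, -(M b).im] ⬝ᵥ modelSurf 1 κ c β (γ s)) =
          fun s => (N b).re * modelSurf 1 κ c β (γ s) 0 + (M b).re * modelSurf 1 κ c β (γ s) 1 +
            -(M b).im * modelSurf 1 κ c β (γ s) 2 := by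
        funext s
        simp [dotProduct, Fin.sum_univ_three]
      rw [h2]
      refine h1.congr_deriv ?_
      rw [dirD_modelSurf]
      simp only [Matrix.cons_val, one_mul]
      have h3 : N b * (κ * solS c (γ s)) + M b * phi c β (γ s) =
          Complex.I * δ ^ 3 * starRingEnd ℂ (phi c β (γ s)) := by
        rw [← hM s hs]
        have h1 := h0 s hs
        simp only [M]
        field_simp
        ring
      -- Multiplying that relation by `g δ φ` turns the right side into `i g |φ|²`, so its real
      -- part, the derivative of the plane function, is zero.
      have h4 : ((N b).re : ℂ) * (phi c β (γ s) * (κ * solS c (γ s)) * (g s * δ)) +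
          M b * (phi c β (γ s) ^ 2 * (g s * δ)) =
          ((g s * Complex.normSq (phi c β (γ s)) : ℝ) : ℂ) * Complex.I := by
        rw [hNre]
        push_cast
        rw [Complex.normSq_eq_conj_mul_self]
        linear_combination phi c β (γ s) * g s * δ * h3 +
          phi c β (γ s) * g s * Complex.I * starRingEnd ℂ (phi c β (γ s)) * hδ4
      have h5 := congrArg Complex.re h4
      rw [Complex.add_re, Complex.re_ofReal_mul, Complex.mul_re (M b), Complex.re_ofReal_mul,
        Complex.I_re, mul_zero] at h5
      linarith
    rintro P ⟨s, hs, rfl⟩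
    exact eqOn_const_of_hasDerivAt_zero hd hs hb

/-- The model surfaces with `ε = 1` have planar curvature lines. -/
theorem isZMCWithPlanarCurvatureLines_modelSurf (κ c : ℝ) (β : ℂ) :
    IsZMCWithPlanarCurvatureLines (modelSurf 1 κ c β) (regularSet (modelSurf 1 κ c β)) := by
  refine ⟨isZMCOn_modelSurf one_ne_zero κ c β, fun γ s₀ s₁ hγ => ?_⟩
  by_cases hκ : κ = 0
  · exact ((liesInPlane_modelSurf_iff one_ne_zero κ c β).mpr hκ).mono
      (Set.image_subset_iff.mpr fun s _ => ⟨γ s, rfl⟩)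
  rw [regularSet_modelSurf one_ne_zero] at hγ
  have hdat := isZMCData_modelSurf one_ne_zero κ c β
  have hΩ := isOpen_phi_ne c β
  have hd : ∀ s ∈ Set.Ioo s₀ s₁, HasDerivAt γ (deriv γ s) s := fun s hs =>
    ((hγ.1.contDiffAt (isOpen_Ioo.mem_nhds hs)).differentiableAt (by simp)).hasDerivAt
  have hdc : ContinuousOn (deriv γ) (Set.Ioo s₀ s₁) :=
    hγ.1.continuousOn_deriv_of_isOpen isOpen_Ioo (by simp)
  have h0 : ∀ s ∈ Set.Ioo s₀ s₁, phi c β (γ s) ≠ 0 := fun s hs => (hγ.2 s hs).1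
  have hne : ∀ s ∈ Set.Ioo s₀ s₁, deriv γ s ≠ 0 := fun s hs => (hγ.2 s hs).2.1
  have him : ∀ s ∈ Set.Ioo s₀ s₁, (deriv γ s).re * (deriv γ s).im = 0 := by
    intro s hs
    have h1 := ((hdat.isPrincipal_iff hΩ (hγ.2 s hs).1 _).mp (hγ.2 s hs).2).2
    rw [fderiv_horiz_modelSurf] at h1
    have h2 : (κ : ℂ) / 1 * (phi c β (γ s) ^ 4)⁻¹ *
        (1 * phi c β (γ s) ^ 2 * deriv γ s) ^ 2 = (κ : ℂ) * deriv γ s ^ 2 := by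
      have := h0 s hs
      field_simp
    rw [h2, Complex.im_ofReal_mul, pow_two, Complex.mul_im] at h1
    have := (mul_eq_zero.mp h1).resolve_left hκ
    linarith
  -- The velocity is nonzero and parallel to an axis at each time. This difference therefore has no
  -- zero, and by connectedness the axis never changes along the curve.
  have hr0 : ∀ s ∈ Set.Ioo s₀ s₁, (deriv γ s).re ^ 2 - (deriv γ s).im ^ 2 ≠ 0 := by
    intro s hs h
    apply hne s hs
    rcases mul_eq_zero.mp (him s hs) with h1 | h1
    · rw [h1] at h
      exact Complex.ext h1 (by simpa using h)
    · rw [h1] at h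
      exact Complex.ext (by simpa using h) h1
  have hrc : ContinuousOn (fun s => (deriv γ s).re ^ 2 - (deriv γ s).im ^ 2) (Set.Ioo s₀ s₁) :=
    ((Complex.continuous_re.comp_continuousOn hdc).pow 2).sub
      ((Complex.continuous_im.comp_continuousOn hdc).pow 2)
  by_cases hpos : ∀ s ∈ Set.Ioo s₀ s₁, 0 < (deriv γ s).re ^ 2 - (deriv γ s).im ^ 2
  · refine liesInPlane_of_coordinate_curve hκ (δ := 1) (by simp) (by simp)
      (g := fun s => (deriv γ s).re) (fun s hs => (hd s hs).congr_deriv ?_) h0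
    have h1 : (deriv γ s).re ≠ 0 := by
      intro h
      have := hpos s hs
      rw [h] at this
      nlinarith [sq_nonneg (deriv γ s).im]
    have h2 := (mul_eq_zero.mp (him s hs)).resolve_left h1
    apply Complex.ext <;> simp [h2]
  · push Not at hpos
    obtain ⟨a, ha, hpa⟩ := hpos
    have hneg : ∀ s ∈ Set.Ioo s₀ s₁, (deriv γ s).re ^ 2 - (deriv γ s).im ^ 2 < 0 := by
      intro s hs
      by_contra hcon
      push Not at hcon
      obtain ⟨x, hx, hx0⟩ := isPreconnected_Ioo.intermediate_value ha hs hrc ⟨hpa, hcon⟩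
      exact hr0 x hx hx0
    refine liesInPlane_of_coordinate_curve hκ (δ := Complex.I) (by simp [Complex.I_pow_three])
      Complex.I_pow_four (g := fun s => (deriv γ s).im)
      (fun s hs => (hd s hs).congr_deriv ?_) h0
    have h1 : (deriv γ s).im ≠ 0 := by
      intro h
      have := hneg s hs
      rw [h] at this
      nlinarith [sq_nonneg (deriv γ s).re]
    have h2 := (mul_eq_zero.mp (him s hs)).resolve_right h1
    apply Complex.ext <;> simp [h2]

/-! ### Every surface is a piece of a model surface -/

/-- A zero mean curvature surface whose Weierstrass data can be brought to those of a model surface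
by a change of the parameter is a piece of this model surface. -/
theorem IsZMCData.isPieceOf_modelSurf {Z : ℂ → Fin 3 → ℝ} {Ω : Set ℂ} {G q q₁ q₂ : ℂ → ℂ}
    (h : IsZMCData Z Ω G q q₁ q₂) (hΩ : IsOpen Ω) (hc : IsPreconnected Ω) {ε μ β : ℂ} {κ c : ℝ}
    {u : ℂ → ℂ} (hε : ε ≠ 0) (hμ : μ ≠ 0) (hu : ContDiffOn ℝ ∞ u Ω)
    (hφ : ∀ z ∈ Ω, phi c β (u z) ≠ 0)
    (hdu : ∀ z ∈ Ω, HasWDerivAt (fun x => ε⁻¹ * horiz Z x) u (μ * phi c β (u z) ^ 2)⁻¹ z)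
    (hq : ∀ z ∈ Ω, ε * q z * phi c β (u z) ^ 4 = κ * ‖μ‖ / μ ^ 2) :
    IsPieceOf Z Ω (modelSurf ε κ c β) := by
  have hw : ∀ z ∈ Ω, DifferentiableAt ℝ (horiz Z) z := fun z hz => h.differentiableAt_horiz hΩ hz
  have hself : ∀ z ∈ Ω, HasWDerivAt (fun x => ε⁻¹ * horiz Z x) (horiz Z) ε z := fun z hz => by
    simpa using (HasWDerivAt.self (hw z hz)).of_const_mul hε (hw z hz)
  have hr : 0 < ‖μ‖ := norm_pos_iff.mpr hμ
  have hr' : (‖μ‖ : ℂ) ≠ 0 := by exact_mod_cast hr.ne'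
  -- Three integrations compare `Z` with the model. Their constants yield the motion: `c₁` the
  -- horizontal translation, `c₂` the shear, `c₃` the vertical translation, each corrected for the
  -- homothety `‖μ‖` and the rotation by `arg μ`.
  obtain ⟨c₁, h1⟩ := eqOn_const_of_wDeriv_zero (w := fun x => ε⁻¹ * horiz Z x)
    (F := fun z => horiz Z z - μ * (ε * horizPrim c β (u z))) hΩ hc (fun z hz => by
      have := (hself z hz).sub ((((HasWDerivAt.comp (hasDerivAt_horizPrim c β (u z))
        (hdu z hz)).const_mul ε)).const_mul μ)
      refine this.congr_deriv ?_
      have := hφ z hz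
      field_simp
      ring)
  obtain ⟨c₂, h2⟩ := eqOn_const_of_wDeriv_zero (w := fun x => ε⁻¹ * horiz Z x)
    (F := fun z => G z - ‖μ‖ / μ * (κ * solS c (u z) / phi c β (u z))) hΩ hc (fun z hz => by
      have h0 := hφ z hz
      have hd : HasDerivAt (fun y => κ * solS c y / phi c β y) (κ * (phi c β (u z) ^ 2)⁻¹) (u z) := by
        refine (((hasDerivAt_solS c (u z)).const_mul (κ : ℂ)).div
          (hasDerivAt_phi c β (u z)) h0).congr_deriv ?_
        field_simp
        linear_combination (κ : ℂ) * wronskian_phi c β (u z)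
      have := ((h.dG z hz).of_const_mul hε (hw z hz)).sub
        ((HasWDerivAt.comp hd (hdu z hz)).const_mul (‖μ‖ / μ : ℂ))
      refine this.congr_deriv ?_
      have h3 := hq z hz
      field_simp at h3 ⊢
      linear_combination h3)
  obtain ⟨c₃, h3⟩ := eqOn_const_of_hasFDerivAt_zero
    (F := fun z => Z z 0 - ‖μ‖ * (ε * heightPrim κ c β (u z)).re - (c₂ * horiz Z z).re) hΩ hc
    (fun z hz => by
      have hZ := h.differentiableAt hΩ hz
      have d0 : HasFDerivAt (fun z => Z z 0) _ z := hasFDerivAt_pi'.mp hZ.hasFDerivAt 0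
      have d1 : HasFDerivAt (fun z => (ε * heightPrim κ c β (u z)).re) _ z :=
        Complex.reCLM.hasFDerivAt.comp z ((HasWDerivAt.comp (hasDerivAt_heightPrim κ c β (u z))
          (hdu z hz)).const_mul ε)
      have d2 : HasFDerivAt (fun z => (c₂ * horiz Z z).re) _ z :=
        Complex.reCLM.hasFDerivAt.comp z ((hself z hz).const_mul c₂)
      refine ((d0.sub (d1.const_mul ‖μ‖)).sub d2).congr_fderiv ?_
      ext a
      have e0 : (fderiv ℝ Z z a) 0 = (G z * fderiv ℝ (horiz Z) z a).re := h.height z hz a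
      have e1 := (hself z hz).apply a
      have e2 : G z = ‖μ‖ / μ * (κ * solS c (u z) / phi c β (u z)) + c₂ := by
        rw [← h2 z hz]; ring
      generalize hv : fderiv ℝ (fun x => ε⁻¹ * horiz Z x) z a = v at e1
      have e3 : G z * (ε * v) = ((‖μ‖ : ℝ) : ℂ) * (ε * (phi c β (u z) * (κ * solS c (u z)) *
          (μ * phi c β (u z) ^ 2)⁻¹) * v) + c₂ * ε * v := by
        rw [e2]
        have := hφ z hz
        field_simp
      have e4 := congrArg Complex.re e3
      rw [Complex.add_re, Complex.re_ofReal_mul, ← e1, ← e0] at e4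
      change (fderiv ℝ Z z a) 0 - ‖μ‖ * (ε * (phi c β (u z) * (κ * solS c (u z)) *
        (μ * phi c β (u z) ^ 2)⁻¹) * fderiv ℝ (fun x => ε⁻¹ * horiz Z x) z a).re -
        (c₂ * ε * fderiv ℝ (fun x => ε⁻¹ * horiz Z x) z a).re = 0
      rw [hv, e4]
      ring)
  let a : ℂ := c₂ * μ / ‖μ‖
  refine ⟨‖μ‖, μ.arg, a.re, -a.im, ![(c₃ + (c₂ * c₁).re) / ‖μ‖, (c₁ / ‖μ‖).re, (c₁ / ‖μ‖).im], u,
    hr, hu, ?_, fun z hz => ?_⟩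
  · rw [regularSet_modelSurf hε]
    exact hφ
  have e1 : horiz Z z = μ * (ε * horizPrim c β (u z)) + c₁ := by rw [← h1 z hz]; ring
  have e3 : Z z 0 = ‖μ‖ * (ε * heightPrim κ c β (u z)).re + (c₂ * horiz Z z).re + c₃ := by
    rw [← h3 z hz]; ring
  have hμe : μ = ‖μ‖ * (Real.cos μ.arg + Real.sin μ.arg * Complex.I) := by
    have := Complex.norm_mul_exp_arg_mul_I μ
    rw [Complex.exp_mul_I] at this
    rw [Complex.ofReal_cos, Complex.ofReal_sin, this]
  have e5 : (horiz Z z).re = Z z 1 := by simp [horiz, horizL]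
  have e6 : (horiz Z z).im = Z z 2 := by simp [horiz, horizL]
  have e7 : c₂ * horiz Z z = ((‖μ‖ : ℝ) : ℂ) * (a * (ε * horizPrim c β (u z))) + c₂ * c₁ := by
    rw [e1]
    simp only [a]
    field_simp
  have e8 := congrArg Complex.re e7
  rw [Complex.add_re, Complex.re_ofReal_mul] at e8
  have e9 : horiz Z z = ((‖μ‖ : ℝ) : ℂ) * ((Real.cos μ.arg + Real.sin μ.arg * Complex.I) *
      (ε * horizPrim c β (u z)) + c₁ / ‖μ‖) := by
    rw [e1]
    nth_rewrite 1 [hμe]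
    field_simp
  have e10 := congrArg Complex.re e9
  have e11 := congrArg Complex.im e9
  rw [Complex.re_ofReal_mul, e5] at e10
  rw [Complex.im_ofReal_mul, e6] at e11
  generalize hx : ε * horizPrim c β (u z) = x at *
  generalize hy : ε * heightPrim κ c β (u z) = y at *
  generalize c₂ * c₁ = m at *
  ext i
  fin_cases i
  · simp [isoSimilarity, modelSurf, hx, hy]
    rw [e3, e8, Complex.mul_re a x]
    field_simp
    ring
  · simp [isoSimilarity, modelSurf, hx]
    rw [e10]
    simp [-Complex.ofReal_cos, -Complex.ofReal_sin]
  · simp [isoSimilarity, modelSurf, hx]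
    rw [e11]
    simp [-Complex.ofReal_cos, -Complex.ofReal_sin]
    exact .inl (by ring)

/-! ### Finding the parameter that brings `Φ` to a model solution. -/

section Parameter

variable {w Φ P : ℂ → ℂ} {Ω : Set ℂ} {c₀ c σ : ℝ} {ρ β : ℂ}

/-- With `k = √c`, a solution satisfies `φ' + k φ = (k + β) e^(k u)`. Demanding `φ = ρ Φ` and `φ' =
ρ σ P` determines `e^(k u)`, and a logarithm gives `u`. Equality of energies, `hE`, then also
matches `φ' - k φ`, since the other factor does not vanish. -/
theorem exists_parameter_of_ne_zero (hΩ : IsOpen Ω) (hs : SimplyConnectedSpace Ω)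
    (hΦ : ContDiffOn ℝ ∞ Φ Ω) (hP : ContDiffOn ℝ ∞ P Ω) (hΦ0 : ∀ z ∈ Ω, Φ z ≠ 0)
    (dΦ : ∀ z ∈ Ω, HasWDerivAt w Φ (P z / Φ z ^ 2) z)
    (dP : ∀ z ∈ Ω, HasWDerivAt w P (c₀ / Φ z) z) (hσ : σ ≠ 0) (hρ : ρ ≠ 0)
    (hc : c = σ ^ 2 * c₀) (hc0 : c ≠ 0)
    (hE : ∀ z ∈ Ω, β ^ 2 - c = ρ ^ 2 * σ ^ 2 * (P z ^ 2 - c₀ * Φ z ^ 2))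
    (hβ : realSqrt c + β ≠ 0) (hne : ∀ z ∈ Ω, σ * P z + realSqrt c * Φ z ≠ 0) :
    ∃ u, ContDiffOn ℝ ∞ u Ω ∧ (∀ z ∈ Ω, phi c β (u z) = ρ * Φ z) ∧
      ∀ z ∈ Ω, HasWDerivAt w u (σ * Φ z ^ 2)⁻¹ z := by
  have hk0 := realSqrt_ne_zero hc0
  have hk := realSqrt_sq c
  have hexp := exp_eq c
  generalize realSqrt c = k at *
  have hσ' : (σ : ℂ) ≠ 0 := by exact_mod_cast hσ
  let f : ℂ → ℂ := fun z => (k + β)⁻¹ * ρ * (σ * P z + k * Φ z)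
  have hf : ContDiffOn ℝ ∞ f Ω :=
    contDiffOn_const.mul ((contDiffOn_const.mul hP).add (contDiffOn_const.mul hΦ))
  have hf0 : ∀ z ∈ Ω, f z ≠ 0 := fun z hz => mul_ne_zero (mul_ne_zero (inv_ne_zero hβ) hρ) (hne z hz)
  have hkc : k ^ 2 = σ ^ 2 * c₀ := by rw [hk, hc]; push_cast; ring
  have df : ∀ z ∈ Ω, HasWDerivAt w f (k / (σ * Φ z ^ 2) * f z) z := fun z hz => by
    refine ((((dP z hz).const_mul (σ : ℂ)).add ((dΦ z hz).const_mul k)).const_mul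
      ((k + β)⁻¹ * ρ)).congr_deriv ?_
    have := hΦ0 z hz
    simp only [f]
    field_simp
    linear_combination -Φ z * hkc
  obtain ⟨L, hL, he⟩ := exists_log_of_simplyConnected hΩ hs hf.continuousOn hf0
  have hLc : ∀ z ∈ Ω, ContinuousAt L z := fun z hz => hL.continuousAt (hΩ.mem_nhds hz)
  have hLe : ∀ z ∈ Ω, ∀ᶠ y in 𝓝 z, Complex.exp (L y) = f y := fun z hz => by
    filter_upwards [hΩ.mem_nhds hz] with y hy using he y hy
  refine ⟨fun z => k⁻¹ * L z, fun z hz => ?_, fun z hz => ?_, fun z hz => ?_⟩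
  · exact (contDiffAt_const.mul (contDiffAt_of_exp_eq (hLc z hz) (hLe z hz)
      (hf.contDiffAt (hΩ.mem_nhds hz)))).contDiffWithinAt
  · have h1 : phi' c β (k⁻¹ * L z) + k * phi c β (k⁻¹ * L z) = ρ * (σ * P z + k * Φ z) := by
      have h2 := hexp (k⁻¹ * L z)
      rw [mul_inv_cancel_left₀ hk0, he z hz] at h2
      have h3 : (k + β) * f z = ρ * (σ * P z + k * Φ z) := by
        simp only [f]
        field_simp
      rw [← h3, h2, phi, phi']
      linear_combination -solS c (k⁻¹ * L z) * hk
    have h2 := phi'_sq_sub c β (k⁻¹ * L z)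
    rw [hE z hz] at h2
    have h3 := mul_ne_zero hρ (hne z hz)
    have h4 : phi' c β (k⁻¹ * L z) - k * phi c β (k⁻¹ * L z) = ρ * (σ * P z - k * Φ z) := by
      apply mul_left_cancel₀ h3
      rw [← h1]
      nth_rewrite 2 [h1]
      linear_combination h2 - phi c β (k⁻¹ * L z) ^ 2 * hk + ρ ^ 2 * Φ z ^ 2 * hkc
    apply mul_left_cancel₀ (mul_ne_zero two_ne_zero hk0)
    linear_combination h1 - h4
  · refine (((df z hz).of_exp_eq (hLc z hz) (hLe z hz)).const_mul k⁻¹).congr_deriv ?_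
    have := hΦ0 z hz
    have := hf0 z hz
    field_simp

/-- For `c = 0` the model solution is `1 + β u`, so the parameter is found by solving a linear
equation. -/
theorem exists_parameter_of_eq_zero (hΦ : ContDiffOn ℝ ∞ Φ Ω) (hΦ0 : ∀ z ∈ Ω, Φ z ≠ 0)
    (dΦ : ∀ z ∈ Ω, HasWDerivAt w Φ (P z / Φ z ^ 2) z) (hσ : σ ≠ 0) (hβ : β ≠ 0)
    (hP : ∀ z ∈ Ω, β = ρ * σ * P z) :
    ∃ u, ContDiffOn ℝ ∞ u Ω ∧ (∀ z ∈ Ω, phi 0 β (u z) = ρ * Φ z) ∧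
      ∀ z ∈ Ω, HasWDerivAt w u (σ * Φ z ^ 2)⁻¹ z := by
  have hσ' : (σ : ℂ) ≠ 0 := by exact_mod_cast hσ
  refine ⟨fun z => β⁻¹ * (ρ * Φ z - 1), ?_, fun z hz => ?_, fun z hz => ?_⟩
  · exact contDiffOn_const.mul ((contDiffOn_const.mul hΦ).sub contDiffOn_const)
  · rw [phi, solC_const_zero, solS_const_zero]
    field_simp
    ring
  · refine ((((dΦ z hz).const_mul ρ).sub (.const 1)).const_mul β⁻¹).congr_deriv ?_
    have h1 := hΦ0 z hz
    have h2 := hP z hz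
    field_simp
    rw [h2]
    ring

end Parameter

/-- The function `Φ = q ^ (-1/4)` and `P = Φ² Φ_w`. -/
theorem exists_quarter_root {w q q₁ q₂ : ℂ → ℂ} {Ω : Set ℂ} (hΩ : IsOpen Ω)
    (hs : SimplyConnectedSpace Ω) (hq : ContDiffOn ℝ ∞ q Ω) (hq₁ : ContDiffOn ℝ ∞ q₁ Ω)
    (h0 : ∀ z ∈ Ω, q z ≠ 0) (dq : ∀ z ∈ Ω, HasWDerivAt w q (q₁ z) z)
    (dq₁ : ∀ z ∈ Ω, HasWDerivAt w q₁ (q₂ z) z) {C : ℂ}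
    (hC : ∀ z ∈ Ω, bonnetInv (q z) (q₁ z) (q₂ z) = C) :
    ∃ Φ P : ℂ → ℂ, ContDiffOn ℝ ∞ Φ Ω ∧ ContDiffOn ℝ ∞ P Ω ∧ (∀ z ∈ Ω, Φ z ≠ 0) ∧
      (∀ z ∈ Ω, q z * Φ z ^ 4 = 1) ∧ (∀ z ∈ Ω, HasWDerivAt w Φ (P z / Φ z ^ 2) z) ∧
      ∀ z ∈ Ω, HasWDerivAt w P (C / Φ z) z := by
  obtain ⟨L, hL, he⟩ := exists_log_of_simplyConnected hΩ hs hq.continuousOn h0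
  have hLc : ∀ z ∈ Ω, ContinuousAt L z := fun z hz => hL.continuousAt (hΩ.mem_nhds hz)
  have hLe : ∀ z ∈ Ω, ∀ᶠ y in 𝓝 z, Complex.exp (L y) = q y := fun z hz => by
    filter_upwards [hΩ.mem_nhds hz] with y hy using he y hy
  have hLs : ContDiffOn ℝ ∞ L Ω := fun z hz => (contDiffAt_of_exp_eq (hLc z hz) (hLe z hz)
    (hq.contDiffAt (hΩ.mem_nhds hz))).contDiffWithinAt
  let Φ : ℂ → ℂ := fun z => Complex.exp (-1 / 4 * L z)
  have hΦ0 : ∀ z, Φ z ≠ 0 := fun z => Complex.exp_ne_zero _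
  have hΦ : ContDiffOn ℝ ∞ Φ Ω := (contDiffOn_const.mul hLs).cexp
  have hqΦ : ∀ z ∈ Ω, q z * Φ z ^ 4 = 1 := fun z hz => by
    rw [← he z hz, ← Complex.exp_nat_mul, ← Complex.exp_add]
    convert Complex.exp_zero using 2
    push_cast
    ring
  have dΦ : ∀ z ∈ Ω, HasWDerivAt w Φ (-1 / 4 * Φ z ^ 7 * q₁ z / Φ z ^ 2) z := fun z hz => by
    refine (((dq z hz).of_exp_eq (hLc z hz) (hLe z hz)).const_mul (-1 / 4)).cexp.congr_deriv ?_
    change Φ z * _ = _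
    have h1 := hqΦ z hz
    have := h0 z hz
    have := hΦ0 z
    field_simp
    linear_combination q₁ z * h1
  -- In the parameter with `du = dw / Φ²` one has `P = Φ_u`, and the last claim is `Φ_uu = C Φ`.
  refine ⟨Φ, fun z => -1 / 4 * Φ z ^ 7 * q₁ z, hΦ, (contDiffOn_const.mul (hΦ.pow 7)).mul hq₁,
    fun z _ => hΦ0 z, hqΦ, dΦ, fun z hz => ?_⟩
  refine ((((dΦ z hz).pow 7).const_mul (-1 / 4)).mul (dq₁ z hz)).congr_deriv ?_
  rw [← hC z hz, bonnetInv]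
  have h1 := hqΦ z hz
  have := h0 z hz
  have := hΦ0 z
  have h2 : q z = (Φ z ^ 4)⁻¹ := eq_inv_of_mul_eq_one_left h1
  rw [h2]
  field_simp
  ring

/-! ### The parameters of the deformations -/

/-- The path has three stages. On `[0, 1/4]` the height factor grows from the plane with `φ = 1`. On
`[1/4, 1/2]`, `φ = e^(s z)` with `s` from `0` to `1`. On `[1/2, 1]`, `c` decreases from `1` to `-1`
with `β = modelSlope c`. -/
def kappaParam (t : ℝ) : ℝ := min (4 * t) 1

def stretchParam (t : ℝ) : ℝ := max 0 (min (4 * t - 1) 1)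

def twistParam (t : ℝ) : ℝ := max 0 (4 * t - 2)

def curvParam (t : ℝ) : ℝ := stretchParam t ^ 2 - twistParam t

def slopeParam (t : ℝ) : ℂ := stretchParam t + (Complex.I - 1) * twistParam t / 2

theorem continuous_kappaParam : Continuous kappaParam := by
  unfold kappaParam
  fun_prop

theorem continuous_curvParam : Continuous curvParam := by
  unfold curvParam stretchParam twistParam
  fun_prop

theorem continuous_slopeParam : Continuous slopeParam := by
  unfold slopeParam stretchParam twistParam
  fun_prop

theorem kappaParam_eq_zero_iff {t : ℝ} : kappaParam t = 0 ↔ t = 0 := by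
  rw [kappaParam]
  constructor
  · intro h
    rcases min_choice (4 * t) 1 with h1 | h1 <;> linarith
  · rintro rfl
    simp

/-- The value of the slope parameter for the curvature parameter `c`. -/
def modelSlope (c : ℝ) : ℂ := 1 + (Complex.I - 1) * (1 - c) / 2

/-- The slope is chosen so that the energy keeps a fixed phase for `|c| < 1` and vanishes at `c =
±1`, where the solutions are exponentials. -/
theorem modelSlope_sq_sub (c : ℝ) : modelSlope c ^ 2 - c = Complex.I * ((1 - c ^ 2) / 2 : ℝ) := by
  rw [modelSlope]
  push_cast
  linear_combination (1 - c) ^ 2 / 4 * Complex.I_sq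

theorem exists_param {c : ℝ} (h1 : -1 ≤ c) (h2 : c ≤ 1) :
    ∃ t ∈ Set.Icc (0 : ℝ) 1, kappaParam t = 1 ∧ curvParam t = c ∧ slopeParam t = modelSlope c := by
  have e1 : stretchParam ((3 - c) / 4) = 1 := by
    rw [stretchParam, min_eq_right (by linarith), max_eq_right (by norm_num)]
  -- `(3 - c) / 4` inverts `c = 3 - 4 t` on the last stage of the path.
  have e2 : twistParam ((3 - c) / 4) = 1 - c := by
    rw [twistParam, max_eq_right (by linarith)]
    ring
  refine ⟨(3 - c) / 4, ⟨by linarith, by linarith⟩, min_eq_right (by linarith), ?_, ?_⟩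
  · rw [curvParam, e1, e2]
    ring
  · rw [slopeParam, e1, e2, modelSlope]
    push_cast
    ring

theorem param_zero : kappaParam 0 = 0 ∧ curvParam 0 = 0 ∧ slopeParam 0 = 0 := by
  norm_num [kappaParam, curvParam, slopeParam, stretchParam, twistParam]

theorem param_quarter :
    kappaParam (1 / 4) = 1 ∧ curvParam (1 / 4) = 0 ∧ slopeParam (1 / 4) = 0 := by
  norm_num [kappaParam, curvParam, slopeParam, stretchParam, twistParam]

/-- The member of the deformations with parameter `t`. -/
def deformation (ε : ℂ) (t : ℝ) : ℂ → Fin 3 → ℝ :=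
  modelSurf ε (kappaParam t) (curvParam t) (slopeParam t)

theorem realSqrt_one : realSqrt 1 = 1 := by
  simp [realSqrt, Real.sqrt_eq_zero_of_nonpos]

theorem realSqrt_neg_one : realSqrt (-1) = Complex.I := by
  simp [realSqrt, Real.sqrt_eq_zero_of_nonpos]

theorem modelSlope_one : modelSlope 1 = 1 := by simp [modelSlope]

theorem modelSlope_neg_one : modelSlope (-1) = Complex.I := by
  rw [modelSlope]
  push_cast
  ring

/-- A real number `σ` that solves `(1 - (σ² c₀)²) / 2 = σ e`. -/
theorem exists_scale (c₀ : ℝ) {e : ℝ} (he : 0 < e) :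
    ∃ σ : ℝ, 0 < σ ∧ (1 - (σ ^ 2 * c₀) ^ 2) / 2 = σ * e := by
  -- The difference is `1/2` at `0` and nonpositive at `1 / (2 e)`, where `σ e = 1/2`.
  have hcont : ContinuousOn (fun σ : ℝ => (1 - (σ ^ 2 * c₀) ^ 2) / 2 - σ * e)
      (Set.Icc 0 (1 / (2 * e))) := by fun_prop
  have h := intermediate_value_Icc' (by positivity) hcont
  have h0 : (0 : ℝ) ∈ Set.Icc ((1 - ((1 / (2 * e)) ^ 2 * c₀) ^ 2) / 2 - 1 / (2 * e) * e)
      ((1 - (0 ^ 2 * c₀) ^ 2) / 2 - 0 * e) := by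
    constructor
    · have : 1 / (2 * e) * e = 1 / 2 := by field_simp
      rw [this]
      nlinarith [sq_nonneg ((1 / (2 * e)) ^ 2 * c₀)]
    · norm_num
  obtain ⟨σ, hσ, hσ0⟩ := h h0
  refine ⟨σ, lt_of_le_of_ne hσ.1 ?_, sub_eq_zero.mp hσ0⟩
  rintro rfl
  norm_num at hσ0

/-! ### Reduction to a normal form on the path. -/

section NormalForm

variable {w Φ P : ℂ → ℂ} {Ω : Set ℂ} {c₀ : ℝ}

/-- Rescaling by `σ` and `ρ` changes `c₀` to `σ² c₀` and `E` to `ρ² σ² E`. Under `|σ| ‖ρ‖² = 1` the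
latter has modulus `|σ| ‖E‖`, so `exists_scale` matches the modulus with the model energy and the
argument of `ρ` matches the phase. -/
theorem exists_normal_form_of_ne_zero (hΩ : IsOpen Ω) (hs : SimplyConnectedSpace Ω)
    (hΦ : ContDiffOn ℝ ∞ Φ Ω) (hP : ContDiffOn ℝ ∞ P Ω) (hΦ0 : ∀ z ∈ Ω, Φ z ≠ 0)
    (dΦ : ∀ z ∈ Ω, HasWDerivAt w Φ (P z / Φ z ^ 2) z)
    (dP : ∀ z ∈ Ω, HasWDerivAt w P (c₀ / Φ z) z) {E : ℂ}
    (hE : ∀ z ∈ Ω, P z ^ 2 - c₀ * Φ z ^ 2 = E) (hE0 : E ≠ 0) :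
    ∃ t ∈ Set.Icc (0 : ℝ) 1, kappaParam t = 1 ∧ ∃ (σ : ℝ) (ρ : ℂ) (u : ℂ → ℂ),
      |σ| * ‖ρ‖ ^ 2 = 1 ∧ ContDiffOn ℝ ∞ u Ω ∧
      (∀ z ∈ Ω, phi (curvParam t) (slopeParam t) (u z) = ρ * Φ z) ∧
      ∀ z ∈ Ω, HasWDerivAt w u (σ * Φ z ^ 2)⁻¹ z := by
  obtain ⟨σ, hσ, hσE⟩ := exists_scale c₀ (norm_pos_iff.mpr hE0)
  have hσ' : (σ : ℂ) ≠ 0 := by exact_mod_cast hσ.ne'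
  have hpos : 0 < σ * ‖E‖ := mul_pos hσ (norm_pos_iff.mpr hE0)
  have hc2 : (σ ^ 2 * c₀) ^ 2 < 1 := by linarith
  obtain ⟨hc1, hc1'⟩ := abs_lt.mp ((sq_lt_one_iff_abs_lt_one _).mp hc2)
  obtain ⟨t, ht, hκ, hc, hβ⟩ := exists_param hc1.le hc1'.le
  have hD := modelSlope_sq_sub (σ ^ 2 * c₀)
  rw [hσE] at hD
  have hD0 : Complex.I * ((σ * ‖E‖ : ℝ) : ℂ) ≠ 0 :=
    mul_ne_zero Complex.I_ne_zero (by exact_mod_cast hpos.ne')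
  obtain ⟨ρ, hρ⟩ := IsAlgClosed.exists_pow_nat_eq
    (Complex.I * ((σ * ‖E‖ : ℝ) : ℂ) / (σ ^ 2 * E)) two_pos
  replace hρ := hρ.symm
  have hρ0 : ρ ≠ 0 := by
    rintro rfl
    rw [zero_pow two_ne_zero, div_eq_zero_iff] at hρ
    exact hρ.elim hD0 (mul_ne_zero (pow_ne_zero 2 hσ') hE0)
  have hρn : |σ| * ‖ρ‖ ^ 2 = 1 := by
    rw [← norm_pow, ← hρ, abs_of_pos hσ]
    have := norm_ne_zero_iff.mpr hE0
    simp [abs_of_pos hσ]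
    field_simp
  have hDE : ∀ z ∈ Ω, modelSlope (σ ^ 2 * c₀) ^ 2 - ((σ ^ 2 * c₀ : ℝ) : ℂ) =
      ρ ^ 2 * σ ^ 2 * (P z ^ 2 - c₀ * Φ z ^ 2) := by
    intro z hz
    rw [hD, hE z hz, ← hρ]
    field_simp
  refine ⟨t, ht, hκ, ?_⟩
  rw [hc, hβ]
  rw [← hD] at hD0
  generalize modelSlope (σ ^ 2 * c₀) = β at *
  generalize hcc : σ ^ 2 * c₀ = c at *
  by_cases hc0 : c = 0
  · subst hc0
    have h0 : c₀ = 0 := (mul_eq_zero.mp hcc).resolve_left (pow_ne_zero 2 hσ.ne')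
    subst h0
    have hβ0 : β ≠ 0 := by
      rintro rfl
      simp at hD0
    obtain ⟨p, hp⟩ := eqOn_const_of_wDeriv_zero hΩ (isPreconnected_of_simplyConnected hs)
      (fun z hz => (dP z hz).congr_deriv (by simp))
    obtain ⟨z₀⟩ : Nonempty Ω := inferInstance
    have h1 := hDE z₀ z₀.2
    rw [hp z₀ z₀.2] at h1
    have h2 : β ^ 2 = (ρ * σ * p) ^ 2 := by
      push_cast at h1
      linear_combination h1
    -- Only `ρ²` has been fixed so far; for `c = 0` its sign has to be chosen so that the slopes
    -- agree, not just their squares.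
    rcases sq_eq_sq_iff_eq_or_eq_neg.mp h2 with h3 | h3
    · obtain ⟨u, hu⟩ := exists_parameter_of_eq_zero hΦ hΦ0 dΦ hσ.ne' hβ0
        (fun z hz => by rw [hp z hz]; exact h3)
      exact ⟨σ, ρ, u, hρn, hu⟩
    · obtain ⟨u, hu⟩ := exists_parameter_of_eq_zero (ρ := -ρ) hΦ hΦ0 dΦ hσ.ne' hβ0
        (fun z hz => by rw [hp z hz, h3]; ring)
      exact ⟨σ, -ρ, u, by rwa [norm_neg], hu⟩
  · obtain ⟨u, hu⟩ := exists_parameter_of_ne_zero hΩ hs hΦ hP hΦ0 dΦ dP hσ.ne' hρ0 hcc.symm hc0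
      hDE (fun h => hD0 (by
        rw [← realSqrt_sq c]
        linear_combination (β - realSqrt c) * h))
      (fun z hz h => hD0 (by
        rw [hDE z hz]
        have hk := realSqrt_sq c
        rw [← hcc] at hk
        push_cast at hk
        rw [hcc] at hk
        linear_combination ρ ^ 2 * (σ * P z - realSqrt c * Φ z) * h + ρ ^ 2 * Φ z ^ 2 * hk))
    exact ⟨σ, ρ, u, hρn, hu⟩

/-- With zero energy `P = m Φ` and `m² = c₀`, so `Φ` is constant or exponential in `u`. The constant
case is `t = 1/4`; the exponential ones are `c = 1` and `c = -1`, at `t = 1/2` and `t = 1`. -/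
theorem exists_normal_form_of_eq_zero (hΩ : IsOpen Ω) (hs : SimplyConnectedSpace Ω)
    (hw : ContDiffOn ℝ ∞ w Ω)
    (hΦ : ContDiffOn ℝ ∞ Φ Ω) (hP : ContDiffOn ℝ ∞ P Ω) (hΦ0 : ∀ z ∈ Ω, Φ z ≠ 0)
    (dΦ : ∀ z ∈ Ω, HasWDerivAt w Φ (P z / Φ z ^ 2) z)
    (dP : ∀ z ∈ Ω, HasWDerivAt w P (c₀ / Φ z) z)
    (hE : ∀ z ∈ Ω, P z ^ 2 - c₀ * Φ z ^ 2 = 0) :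
    ∃ t ∈ Set.Icc (0 : ℝ) 1, kappaParam t = 1 ∧ ∃ (σ : ℝ) (ρ : ℂ) (u : ℂ → ℂ),
      |σ| * ‖ρ‖ ^ 2 = 1 ∧ ContDiffOn ℝ ∞ u Ω ∧
      (∀ z ∈ Ω, phi (curvParam t) (slopeParam t) (u z) = ρ * Φ z) ∧
      ∀ z ∈ Ω, HasWDerivAt w u (σ * Φ z ^ 2)⁻¹ z := by
  have hcn := isPreconnected_of_simplyConnected hs
  obtain ⟨z₀⟩ : Nonempty Ω := inferInstance
  by_cases h0 : c₀ = 0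
  · subst h0
    have hP0 : ∀ z ∈ Ω, P z = 0 := fun z hz => by simpa using hE z hz
    obtain ⟨p, hp⟩ := eqOn_const_of_wDeriv_zero hΩ hcn
      (fun z hz => (dΦ z hz).congr_deriv (by simp [hP0 z hz]))
    have hp0 : p ≠ 0 := hp z₀ z₀.2 ▸ hΦ0 z₀ z₀.2
    obtain ⟨h1, h2, h3⟩ := param_quarter
    refine ⟨1 / 4, by norm_num, h1, ‖p‖ ^ 2, p⁻¹, fun z => ((‖p‖ ^ 2 : ℝ) * p ^ 2 : ℂ)⁻¹ * w z,
      ?_, contDiffOn_const.mul hw, fun z hz => ?_, fun z hz => ?_⟩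
    · have := norm_ne_zero_iff.mpr hp0
      simp
      field_simp
    · rw [h2, h3, hp z hz, phi, solC_const_zero, zero_mul, add_zero, inv_mul_cancel₀ hp0]
    · have hwz : DifferentiableAt ℝ w z :=
        (hw.contDiffAt (hΩ.mem_nhds hz)).differentiableAt (by simp)
      refine ((HasWDerivAt.self hwz).const_mul _).congr_deriv ?_
      rw [hp z hz, mul_one]
  · obtain ⟨m, hm⟩ := eqOn_const_of_wDeriv_zero (w := w) (F := fun z => P z * (Φ z)⁻¹) hΩ hcn
      (fun z hz => by
        refine ((dP z hz).mul ((dΦ z hz).inv (hΦ0 z hz))).congr_deriv ?_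
        have h1 := hΦ0 z hz
        have h2 := hE z hz
        field_simp
        linear_combination -h2)
    have hPm : ∀ z ∈ Ω, P z = m * Φ z := fun z hz => by
      have := hΦ0 z hz
      rw [← hm z hz]
      field_simp
    have hm2 : m ^ 2 = c₀ := by
      have h1 := hE z₀ z₀.2
      rw [hPm z₀ z₀.2] at h1
      have h2 : (m ^ 2 - c₀) * (Φ z₀ ^ 2) = 0 := by linear_combination h1
      exact sub_eq_zero.mp ((mul_eq_zero.mp h2).resolve_right (pow_ne_zero 2 (hΦ0 z₀ z₀.2)))
    obtain ⟨c, t, ht, hκ, hc, hβ, hk, hcabs⟩ : ∃ c : ℝ, ∃ t ∈ Set.Icc (0 : ℝ) 1,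
        kappaParam t = 1 ∧ curvParam t = c ∧ slopeParam t = realSqrt c ∧ c ≠ 0 ∧
        c = |c₀|⁻¹ * c₀ := by
      rcases lt_or_gt_of_ne h0 with h | h
      · obtain ⟨t, ht, h1, h2, h3⟩ := exists_param le_rfl (by norm_num : (-1 : ℝ) ≤ 1)
        refine ⟨-1, t, ht, h1, h2, ?_, by norm_num, ?_⟩
        · rw [h3, modelSlope_neg_one, realSqrt_neg_one]
        · rw [abs_of_neg h]
          field_simp
      · obtain ⟨t, ht, h1, h2, h3⟩ := exists_param (by norm_num : (-1 : ℝ) ≤ 1) le_rfl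
        refine ⟨1, t, ht, h1, h2, ?_, by norm_num, ?_⟩
        · rw [h3, modelSlope_one, realSqrt_one]
        · rw [abs_of_pos h]
          field_simp
    -- A negative `σ` reverses `u` and is needed when `Φ` is the exponential of the opposite sign.
    obtain ⟨σ, hσ, hσk⟩ : ∃ σ : ℝ, c = σ ^ 2 * c₀ ∧ σ * m = realSqrt c := by
      have h1 : Real.sqrt |c₀|⁻¹ ^ 2 = |c₀|⁻¹ := Real.sq_sqrt (by positivity)
      have h2 : realSqrt c ^ 2 = ((Real.sqrt |c₀|⁻¹ : ℝ) * m) ^ 2 := by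
        rw [realSqrt_sq, mul_pow, hm2, ← Complex.ofReal_pow, h1, ← Complex.ofReal_mul, ← hcabs]
      rcases sq_eq_sq_iff_eq_or_eq_neg.mp h2 with h3 | h3
      · exact ⟨_, by rw [h1, hcabs], h3.symm⟩
      · exact ⟨-Real.sqrt |c₀|⁻¹, by rw [neg_sq, h1, hcabs], by rw [h3]; push_cast; ring⟩
    have hσ0 : σ ≠ 0 := by
      rintro rfl
      exact hk (by simpa using hσ)
    have hk0 := realSqrt_ne_zero hk
    have hρ0 : ((Real.sqrt |σ|)⁻¹ : ℂ) ≠ 0 := by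
      have := Real.sqrt_ne_zero'.mpr (abs_pos.mpr hσ0)
      exact_mod_cast inv_ne_zero this
    have hE' : ∀ z ∈ Ω, realSqrt c ^ 2 - c =
        ((Real.sqrt |σ|)⁻¹ : ℂ) ^ 2 * σ ^ 2 * (P z ^ 2 - c₀ * Φ z ^ 2) := fun z hz => by
      rw [hE z hz, realSqrt_sq]
      simp
    have h2k : ∀ z, σ * (m * z) + realSqrt c * z = 2 * realSqrt c * z := fun z => by
      rw [← hσk]
      ring
    obtain ⟨u, hu⟩ := exists_parameter_of_ne_zero hΩ hs hΦ hP hΦ0 dΦ dP hσ0 hρ0 hσ hk hE'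
      (by rw [← two_mul]; exact mul_ne_zero two_ne_zero hk0)
      (fun z hz => by
        rw [hPm z hz, h2k]
        exact mul_ne_zero (mul_ne_zero two_ne_zero hk0) (hΦ0 z hz))
    refine ⟨t, ht, hκ, σ, _, u, ?_, by rwa [hc, hβ]⟩
    rw [norm_inv, Complex.norm_real, Real.norm_eq_abs, abs_of_nonneg (Real.sqrt_nonneg _), inv_pow,
      Real.sq_sqrt (abs_nonneg σ), mul_inv_cancel₀ (abs_ne_zero.mpr hσ0)]

end NormalForm

/-! ### Exhaustion of both classes and assembly of the deformations. -/

theorem IsZMCData.exists_isPieceOf {Z : ℂ → Fin 3 → ℝ} {Ω : Set ℂ} {G q q₁ q₂ : ℂ → ℂ}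
    (h : IsZMCData Z Ω G q q₁ q₂) (hΩ : IsOpen Ω) (hs : SimplyConnectedSpace Ω) {ε : ℂ}
    (hε : ε ≠ 0) (him : ∀ z ∈ Ω, q z ≠ 0 → (ε * bonnetInv (q z) (q₁ z) (q₂ z)).im = 0) :
    ∃ t ∈ Set.Icc (0 : ℝ) 1, IsPieceOf Z Ω (deformation ε t) := by
  have hcn := isPreconnected_of_simplyConnected hs
  have hws := horiz_contDiffOn h.smooth
  have hw : ∀ z ∈ Ω, DifferentiableAt ℝ (horiz Z) z := fun z hz => h.differentiableAt_horiz hΩ hz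
  have hws' : ContDiffOn ℝ ∞ (fun x => ε⁻¹ * horiz Z x) Ω := contDiffOn_const.mul hws
  obtain ⟨-, q₃, dq₂⟩ := exists_wDeriv_of_wDeriv hΩ hws h.jac_ne h.smooth_q₁ h.dq₁
  rcases umbilic_dichotomy hΩ hcn hws h.jac_ne h.dq h.dq₁ dq₂ hε him with h0 | ⟨h0, C, hC⟩
  · obtain ⟨h1, h2, h3⟩ := param_zero
    refine ⟨0, by simp, ?_⟩
    rw [deformation, h1, h2, h3]
    have hφ : ∀ z, phi 0 0 z = 1 := fun z => by simp [phi, solC_const_zero]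
    refine h.isPieceOf_modelSurf hΩ hcn hε one_ne_zero hws' (fun z _ => ?_) (fun z hz => ?_)
      fun z hz => ?_
    · rw [hφ]
      exact one_ne_zero
    · refine (HasWDerivAt.self ((hw z hz).const_mul ε⁻¹)).congr_deriv ?_
      simp [hφ]
    · simp [h0 z hz]
  obtain ⟨z₀⟩ : Nonempty Ω := inferInstance
  have hCre : ((ε * C).re : ℂ) = ε * C := by
    have := him z₀ z₀.2 (h0 z₀ z₀.2)
    rw [hC z₀ z₀.2] at this
    exact Complex.ext rfl (by simp [this])
  -- Passing from `w` to `ε⁻¹ w` multiplies `q`, `q₁`, `q₂` by `ε`, `ε²`, `ε³` and hence the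
  -- invariant by `ε`. It becomes the real number `ε C`, and both classes are treated at once.
  obtain ⟨Φ, P, hΦ, hP, hΦ0, hqΦ, dΦ, dP⟩ := exists_quarter_root (C := ((ε * C).re : ℂ))
    (q := fun z => ε * q z) (q₁ := fun z => ε ^ 2 * q₁ z) (q₂ := fun z => ε ^ 3 * q₂ z) hΩ hs
    (contDiffOn_const.mul h.smooth_q) (contDiffOn_const.mul h.smooth_q₁)
    (fun z hz => mul_ne_zero hε (h0 z hz))
    (fun z hz => (((h.dq z hz).of_const_mul hε (hw z hz)).const_mul ε).congr_deriv (by ring))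
    (fun z hz => (((h.dq₁ z hz).of_const_mul hε (hw z hz)).const_mul (ε ^ 2)).congr_deriv
      (by ring))
    (fun z hz => by
      have := h0 z hz
      rw [hCre, ← hC z hz, bonnetInv, bonnetInv]
      field_simp)
  obtain ⟨E, hE⟩ := eqOn_const_of_wDeriv_zero (w := fun x => ε⁻¹ * horiz Z x)
    (F := fun z => P z ^ 2 - (ε * C).re * Φ z ^ 2) hΩ hcn (fun z hz => by
      refine (((dP z hz).pow 2).sub (((dΦ z hz).pow 2).const_mul _)).congr_deriv ?_
      have := hΦ0 z hz
      field_simp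
      ring)
  obtain ⟨t, ht, hκ, σ, ρ, u, hσρ, hu, hφ, du⟩ : ∃ t ∈ Set.Icc (0 : ℝ) 1, kappaParam t = 1 ∧
      ∃ (σ : ℝ) (ρ : ℂ) (u : ℂ → ℂ), |σ| * ‖ρ‖ ^ 2 = 1 ∧ ContDiffOn ℝ ∞ u Ω ∧
      (∀ z ∈ Ω, phi (curvParam t) (slopeParam t) (u z) = ρ * Φ z) ∧
      ∀ z ∈ Ω, HasWDerivAt (fun x => ε⁻¹ * horiz Z x) u (σ * Φ z ^ 2)⁻¹ z := by
    by_cases hE0 : E = 0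
    · subst hE0
      exact exists_normal_form_of_eq_zero hΩ hs hws' hΦ hP hΦ0 dΦ dP hE
    · exact exists_normal_form_of_ne_zero hΩ hs hΦ hP hΦ0 dΦ dP hE hE0
  have hσ : (σ : ℂ) ≠ 0 := by
    norm_cast
    rintro rfl
    simp at hσρ
  have hρ : ρ ≠ 0 := by
    rintro rfl
    simp at hσρ
  -- As `φ = ρ Φ`, this `μ` gives `σ Φ² = μ φ²`. The normalization `|σ| ‖ρ‖² = 1` makes `‖μ‖ = σ²`,
  -- which is what `κ = 1` requires.
  refine ⟨t, ht, h.isPieceOf_modelSurf hΩ hcn (μ := σ / ρ ^ 2) hε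
    (div_ne_zero hσ (pow_ne_zero 2 hρ)) hu (fun z hz => ?_) (fun z hz => ?_) fun z hz => ?_⟩
  · rw [hφ z hz]
    exact mul_ne_zero hρ (hΦ0 z hz)
  · refine (du z hz).congr_deriv ?_
    rw [hφ z hz]
    field_simp
  · have h1 : ‖(σ : ℂ) / ρ ^ 2‖ = σ ^ 2 := by
      rw [norm_div, norm_pow, Complex.norm_real, Real.norm_eq_abs,
        div_eq_iff (pow_ne_zero 2 (norm_ne_zero_iff.mpr hρ)), ← sq_abs]
      linear_combination -|σ| * hσρ
    rw [hφ z hz, hκ, h1, mul_pow]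
    have h2 : ε * q z * (ρ ^ 4 * Φ z ^ 4) = ρ ^ 4 := by linear_combination ρ ^ 4 * hqΦ z hz
    rw [h2]
    push_cast
    field_simp

theorem IsZMCAffineMinimal.exists_isPieceOf {Z : ℂ → Fin 3 → ℝ} {Ω : Set ℂ} (hΩ : IsOpen Ω)
    (hs : SimplyConnectedSpace Ω) (hZ : IsZMCAffineMinimal Z Ω) :
    ∃ t ∈ Set.Icc (0 : ℝ) 1, IsPieceOf Z Ω (deformation Complex.I t) := by
  obtain ⟨G, q, q₁, q₂, h⟩ := hZ.1.exists_data hΩ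
  refine h.exists_isPieceOf hΩ hs Complex.I_ne_zero fun z hz hq0 => ?_
  have h1 := (h.exists_isAffineShape_iff hΩ hz hq0).mp
    (hZ.2 z hz ((h.affineDisc_ne_zero_iff hΩ hz).mpr hq0))
  rw [Complex.I_mul_im]
  exact h1

theorem IsZMCWithPlanarCurvatureLines.exists_isPieceOf {Z : ℂ → Fin 3 → ℝ} {Ω : Set ℂ}
    (hΩ : IsOpen Ω) (hs : SimplyConnectedSpace Ω) (hZ : IsZMCWithPlanarCurvatureLines Z Ω) :
    ∃ t ∈ Set.Icc (0 : ℝ) 1, IsPieceOf Z Ω (deformation 1 t) := by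
  obtain ⟨G, q, q₁, q₂, h⟩ := hZ.1.exists_data hΩ
  refine h.exists_isPieceOf hΩ hs one_ne_zero fun z hz hq0 => ?_
  rw [one_mul]
  exact h.im_eq_zero_of_planar hΩ hZ.2 hz hq0

theorem continuous_deformation (ε : ℂ) : Continuous fun p : ℝ × ℂ => deformation ε p.1 p.2 :=
  continuous_modelSurf ε continuous_kappaParam continuous_curvParam continuous_slopeParam

theorem tendstoUniformlyOn_deformation (ε : ℂ) (t : ℝ) {K : Set ℂ} (hK : IsCompact K) :
    TendstoUniformlyOn (deformation ε) (deformation ε t) (𝓝 t) K := by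
  -- Currying a jointly continuous map gives a continuous path in the compact-open topology, whose
  -- convergence is uniform on compact sets.
  let f : C(ℝ × ℂ, Fin 3 → ℝ) := ⟨_, continuous_deformation ε⟩
  exact ContinuousMap.tendsto_iff_forall_isCompact_tendstoUniformlyOn.mp
    (f.curry.continuous.tendsto t) K hK

/-- The deformation with factor `ε` consists exactly of the surfaces of a class which contains all
its members and whose surfaces are pieces of its members. -/
theorem isDeformationExactlyOf_deformation {C : (ℂ → Fin 3 → ℝ) → Set ℂ → Prop} {ε : ℂ}
    (hε : ε ≠ 0) (hmem : ∀ t, C (deformation ε t) (regularSet (deformation ε t)))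
    (hex : ∀ (Ω : Set ℂ) (Z : ℂ → Fin 3 → ℝ), IsOpen Ω → SimplyConnectedSpace Ω → C Z Ω →
      ∃ t ∈ Set.Icc (0 : ℝ) 1, IsPieceOf Z Ω (deformation ε t)) :
    IsDeformationExactlyOf C (deformation ε) where
  smooth _ _ := contDiff_modelSurf _ _ _ _
  continuous t _ _ hK u hu :=
    (tendstoUniformlyOn_deformation ε t hK u hu).filter_mono nhdsWithin_le_nhds
  singular _ _ _ hK := finite_singular_modelSurf hε _ _ _ hK
  mem t _ := hmem t
  exhaust := hex

theorem isConjugateOf_deformation (t : ℝ) :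
    IsConjugateOf (deformation Complex.I t) (deformation 1 t) := by
  have h := hasWeierstrassData_modelSurf 1 (kappaParam t) (curvParam t) (slopeParam t)
  simp only [one_mul] at h
  exact ⟨_, _, h, hasWeierstrassData_modelSurf Complex.I _ _ _⟩

theorem theorem6p3 :
    ∃ X Y : ℝ → ℂ → Fin 3 → ℝ,
      IsDeformationExactlyOf IsZMCAffineMinimal X ∧
      (∀ t ∈ Set.Icc (0 : ℝ) 1, LiesInPlane (Set.range (X t)) ↔ t = 0) ∧
      IsDeformationExactlyOf IsZMCWithPlanarCurvatureLines Y ∧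
      (∀ t ∈ Set.Icc (0 : ℝ) 1, IsConjugateOf (X t) (Y t)) :=
  ⟨deformation Complex.I, deformation 1,
    isDeformationExactlyOf_deformation Complex.I_ne_zero
      (fun _ => isZMCAffineMinimal_modelSurf _ _ _)
      fun _ _ hΩ hs hZ => hZ.exists_isPieceOf hΩ hs,
    fun _ _ => (liesInPlane_modelSurf_iff Complex.I_ne_zero _ _ _).trans kappaParam_eq_zero_iff,
    isDeformationExactlyOf_deformation one_ne_zero
      (fun _ => isZMCWithPlanarCurvatureLines_modelSurf _ _ _)
      fun _ _ hΩ hs hZ => hZ.exists_isPieceOf hΩ hs,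
    fun t _ => isConjugateOf_deformation t⟩

end
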